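/- **Setting.** Fix $p\ge 1$ and $\epsilon\in(0,1]$. For each index $n$ let $N=N_n$, $T=T_n$ with $N_n,T_n\to\infty$; all objects below may depend on $n$, and implied constants do not. Let $\{\boldsymbol r_t\}_{t\in\mathbb Z}\subset\mathbb R^N$ follow the BEKK-ARCH model $$\boldsymbol r_t=\boldsymbol\Sigma_t^{1/2}\boldsymbol\eta_t,\qquad \boldsymbol\Sigma_t=\boldsymbol\Omega^*+\sum_{i=1}^{p}\sum_{k=1}^{K_i^*}\mathbf A^*_{ik}\boldsymbol r_{t-i}\boldsymbol r_{t-i}^{\mathrm T}\mathbf A_{ik}^{*\mathrm T},$$ with $\boldsymbol\Omega^*$ positive definite, $\boldsymbol\Sigma_t^{1/2}$ the positive semidefinite square root, and $\boldsymbol\eta_t$ i.i.d. with mean $0$ and covariance $\mathbf I_N$, $\boldsymbol\eta_t$ independent of $\sigma(\boldsymbol r_s:s<t)$. For every lag $i$, $K_i^*\ge1$, $\langle\mathbf A^*_{ik},\mathbf A^*_{il}\rangle=0$ for $k\ne l$, and $\|\mathbf A^*_{i1}\|_{\mathrm F}>\dots>\|\mathbf A^*_{iK_i^*}\|_{\mathrm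 F}>0$. Put $d=N(N+1)/2$, $\boldsymbol y_t=\operatorname{vech}(\boldsymbol r_t\boldsymbol r_t^{\mathrm T})$, $\boldsymbol x_t=(1,\boldsymbol y_{t-1}^{\mathrm T},\dots,\boldsymbol y_{t-p}^{\mathrm T})^{\mathrm T}$, $\boldsymbol\Gamma_x=\mathbb E(\boldsymbol x_t\boldsymbol x_t^{\mathrm T})$, $\boldsymbol\Phi_i^*=\mathbf D_N^\dagger\big(\sum_k\mathbf A^*_{ik}\otimes\mathbf A^*_{ik}\big)\mathbf D_N$ with $\mathbf D_N$ the duplication matrix and $\mathbf D_N^\dagger=(\mathbf D_N^{\mathrm T}\mathbf D_N)^{-1}\mathbf D_N^{\mathrm T}$, and $\boldsymbol\Theta^*=(\operatorname{vech}(\boldsymbol\Omega^*),\boldsymbol\Phi^*_1,\dots,\boldsymbol\Phi^*_p)^{\mathrm T}$. Write $\|\cdot\|_{1,1}$ for the sum of the absolute entries and $\|\cdot\|_{1,\infty}$ for the largest column $\ell_1$-norm. **Estimators.** Let $\boldsymbol x_t(\tau),\boldsymbol y_t(\tau)$ be formed from the truncated returns $\operatorname{sign}(r_{t,j})\min\{|r_{t,j}|,\tau\}$,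 let $\mathbf X(\tau),\mathbf Y(\tau)$ have rows $\boldsymbol x_t(\tau)^{\mathrm T},\boldsymbol y_t(\tau)^{\mathrm T}$, $1\le t\le T$, and let $$\widehat{\boldsymbol\Theta}=(\widehat{\boldsymbol\omega},\widehat{\boldsymbol\Phi}_1,\dots,\widehat{\boldsymbol\Phi}_p)^{\mathrm T}\in\operatorname*{argmin}_{\boldsymbol\Theta}\ \tfrac1{2T}\|\mathbf Y(\tau)-\mathbf X(\tau)\boldsymbol\Theta\|_{\mathrm F}^2+\lambda\|\boldsymbol\Theta\|_{1,1}.$$ For $\boldsymbol\Phi\in\mathbb R^{d\times d}$, indexed by pairs $j\le l$, and $\mathbf W$, indexed by pairs $j<l$, let $\mathcal H(\boldsymbol\Phi,\mathbf W)\in\mathbb R^{N^2\times N^2}$ be the padded matrix whose entry at row pair $(u,v)$ and column pair $(x,y)$ is, with $\phi=\boldsymbol\Phi[\{u,v\},\{x,y\}]$ and $w=\mathbf W[\{x,y\},\{u,v\}]$: $\phi$ if $x=y$; $\phi/2$ if $u=v$, $x\ne y$; and, if $u\ne v$, $x\neq y$, $w$ when the two pairs are ordered in the same way and $\phi-w$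 otherwise. Let $\mathbf W_i^*$ be the matrix with $\mathcal H(\boldsymbol\Phi_i^*,\mathbf W_i^*)=\sum_k\mathbf A_{ik}^*\otimes\mathbf A_{ik}^*$. Let $\mathcal R$ be the rearrangement $\mathcal R(\mathbf M)[(i,k),(j,l)]=\mathbf M[(i,j),(k,l)]$, so that $\mathcal R(\mathbf A\otimes\mathbf A)=\operatorname{vec}(\mathbf A)\operatorname{vec}(\mathbf A)^{\mathrm T}$. Let $\widehat{\mathbf W}_i$ minimize the nuclear norm of $\mathcal R(\mathcal H(\widehat{\boldsymbol\Phi}_i,\mathbf W))$ over $\mathbf W$, let $\widehat\lambda_{i,1}\ge\dots\ge\widehat\lambda_{i,N^2}$ be the eigenvalues of the symmetric matrix $\mathcal R(\mathcal H(\widehat{\boldsymbol\Phi}_i,\widehat{\mathbf W}_i))$, and $$\widehat K_i\in\operatorname*{argmin}_{1\le k\le\overline K}\frac{\widehat\lambda_{i,k+1}+c(N,T)}{\widehat\lambda_{i,k}+c(N,T)},\qquad 1\le i\le p,$$ where $c(N,T)>0$ and $\overline K<N^2$ (for all large $n$). **Assumptions.** 1. $\{\boldsymbol r_t\}$ is strictly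 stationary, $\mathbb E|r_{t,j}|^{4+4\epsilon}\le M_{4+4\epsilon}$ for all $j$, and it is $\alpha$-mixing with $\alpha(\ell)\le C\zeta^\ell$, $0\le\zeta\le\bar\zeta<1$ ($C,\bar\zeta$ independent of $n$). Moreover $\lambda_{\min}(\boldsymbol\Gamma_x)>0$. 2. Every column of $\boldsymbol\Theta^*$ has at most $s$ nonzero entries, and $\|\boldsymbol\Theta^*\|_{1,\infty}$ is bounded away from $0$. 3. With $M=\max\{M_{4+4\epsilon},1\}$ and $T_{\rm eff}=T/(\log T)^2$: $T\gtrsim\log(pd+1)$, $\tau\asymp\big(MT_{\rm eff}/\log(pd+1)\big)^{1/(4+4\epsilon)}$ and $\lambda\asymp s\|\boldsymbol\Theta^*\|_{1,\infty}\big(M^{1/\epsilon}\log(pd+1)/T_{\rm eff}\big)^{\epsilon/(1+\epsilon)}$, where the implied lower constant for $\lambda$ is at least some $\Lambda_0>0$ that depends only on $p$, $\epsilon$, $C$, $\bar\zeta$, the implied constants for $\tau$ and the lower bound of $\|\boldsymbol\Theta^*\|_{1,\infty}$. 4. (Padding error) $\|\mathcal H(\widehat{\boldsymbol\Phi}_i,\widehat{\mathbf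 W}_i)-\mathcal H(\boldsymbol\Phi_i^*,\mathbf W_i^*)\|_{\mathrm F}\lesssim\|\widehat{\boldsymbol\Phi}_i-\boldsymbol\Phi_i^*\|_{\mathrm F}$ for all $1\le i\le p$, with probability tending to one. **Theorem.** Suppose that $K_i^*\le\overline K$ for all $i$ and that the above holds. Let $\varsigma=\min_{1\le i\le p}\|\mathbf A^*_{iK_i^*}\|_{\mathrm F}^2$. If $$s^{3/2}N\|\boldsymbol\Theta^*\|_{1,\infty}\lambda_{\min}^{-1}(\boldsymbol\Gamma_x)\Big(\frac{M^{1/\epsilon}\log(pd+1)}{T_{\rm eff}}\Big)^{\frac{\epsilon}{1+\epsilon}}\ll c(N,T)\ll\varsigma\min_{\substack{1\le i\le p\\1\le k\le K_i^*-1}}\frac{\|\mathbf A^*_{i(k+1)}\|_{\mathrm F}^2}{\|\mathbf A^*_{ik}\|_{\mathrm F}^2}$$ (the minimum being $1$ if all $K_i^*=1$), then $\mathbb P(\widehat K_i=K_i^*\text{ for all }1\le i\le p)\to1$ as $N,T\to\infty$. -/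

import Mathlib

open MeasureTheory ProbabilityTheory Filter Topology
open scoped Kronecker Matrix

noncomputable section

namespace BekkArch

/-! ### Matrix norms -/

/-- Frobenius norm. -/
def frob {m n : Type*} [Fintype m] [Fintype n] (M : Matrix m n ℝ) : ℝ :=
  Real.sqrt (∑ i, ∑ j, M i j ^ 2)

/-- Frobenius inner product `tr (Aᵀ B)`. -/
def frobInner {m n : Type*} [Fintype m] [Fintype n] (A B : Matrix m n ℝ) : ℝ :=
  (Aᵀ * B).trace

/-- The norm `‖M‖_{1,1}`: the sum of the absolute values of the entries. -/
def norm11 {m n : Type*} [Fintype m] [Fintype n] (M : Matrix m n ℝ) : ℝ :=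
  ∑ j, ∑ i, |M i j|

/-- The norm `‖M‖_{1,∞}`: the largest `ℓ₁` norm of a column. -/
def norm1Inf {m n : Type*} [Fintype m] (M : Matrix m n ℝ) : ℝ :=
  ⨆ j, ∑ i, |M i j|

/-- Nuclear norm: the sum of the singular values. -/
def nuclearNorm {n : Type*} [Fintype n] [DecidableEq n] (M : Matrix n n ℝ) : ℝ :=
  ∑ k ∈ Finset.range (Fintype.card n), ((Matrix.toEuclideanLin M).singularValues k : ℝ)

/-- The `k`-th largest eigenvalue (`1 ≤ k ≤ card n`, with multiplicity) of a symmetric matrix. -/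
def eigDesc {n : Type*} [Fintype n] [DecidableEq n] {M : Matrix n n ℝ} (hM : M.IsHermitian)
    (k : ℕ) : ℝ :=
  if h : k - 1 < Fintype.card n then hM.eigenvalues₀ ⟨k - 1, h⟩ else 0

/-- The smallest eigenvalue of a symmetric matrix. -/
def lamMin {n : Type*} [Fintype n] [DecidableEq n] {M : Matrix n n ℝ} (hM : M.IsHermitian) : ℝ :=
  ⨅ i, hM.eigenvalues i

/-! ### Half-vectorization, duplication, padding and rearrangement

The `d = N (N + 1) / 2` coordinates of a half-vectorization are indexed by the pairs `j ≤ l`, the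
`g = N (N - 1) / 2` rows and columns of the auxiliary matrix by the pairs `j < l`, and the `N ^ 2`
coordinates of a vectorization by all pairs. -/

/-- Index set of the half-vectorization. -/
abbrev VechIdx (N : ℕ) : Type := {q : Fin N × Fin N // q.1 ≤ q.2}

/-- Index set of the rows and of the columns of the auxiliary matrix. -/
abbrev StrictIdx (N : ℕ) : Type := {q : Fin N × Fin N // q.1 < q.2}

/-- The unordered pair of two coordinates as an index of the half-vectorization. -/
def vechIdx {N : ℕ} (u v : Fin N) : VechIdx N := ⟨(min u v, max u v), min_le_max⟩

/-- The unordered pair of two distinct coordinates as an index of the auxiliary matrix. -/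
def strictIdx {N : ℕ} (u v : Fin N) (h : u ≠ v) : StrictIdx N :=
  ⟨(min u v, max u v), min_lt_max.2 h⟩

/-- Half-vectorization (of the lower triangle). -/
def vech {N : ℕ} (M : Matrix (Fin N) (Fin N) ℝ) : VechIdx N → ℝ := fun q => M q.1.2 q.1.1

/-- The duplication matrix `D_N`. -/
def dupMat (N : ℕ) : Matrix (Fin N × Fin N) (VechIdx N) ℝ :=
  Matrix.of fun a q => if vechIdx a.1 a.2 = q then 1 else 0

/-- The elimination matrix `(DᵀD)⁻¹ Dᵀ`. -/
def elimMat (N : ℕ) : Matrix (VechIdx N) (Fin N × Fin N) ℝ :=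
  ((dupMat N)ᵀ * dupMat N)⁻¹ * (dupMat N)ᵀ

/-- The padding operator `H(Φ, W)`. An entry of `Φ` whose row and column are both off-diagonal pairs
merges two coefficients: one is the entry of `W` (indexed by the column pair, then the row pair)
and goes to the positions where row and column pair are ordered in the same way, the other is the
remainder and goes to the positions where they are ordered in opposite ways. -/
def padding {N : ℕ} (Φ : Matrix (VechIdx N) (VechIdx N) ℝ)
    (W : Matrix (StrictIdx N) (StrictIdx N) ℝ) : Matrix (Fin N × Fin N) (Fin N × Fin N) ℝ :=
  Matrix.of fun a b =>
    if ha : a.1 = a.2 then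
      if b.1 = b.2 then Φ (vechIdx a.1 a.2) (vechIdx b.1 b.2)
      else Φ (vechIdx a.1 a.2) (vechIdx b.1 b.2) / 2
    else if hb : b.1 = b.2 then Φ (vechIdx a.1 a.2) (vechIdx b.1 b.2)
    else if a.1 < a.2 ↔ b.1 < b.2 then W (strictIdx b.1 b.2 hb) (strictIdx a.1 a.2 ha)
    else Φ (vechIdx a.1 a.2) (vechIdx b.1 b.2) - W (strictIdx b.1 b.2 hb) (strictIdx a.1 a.2 ha)

/-- The rearrangement operator `R`, with `R(A ⊗ A) = vec(A) vec(A)ᵀ`. -/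
def rearr {N : ℕ} (M : Matrix (Fin N × Fin N) (Fin N × Fin N) ℝ) :
    Matrix (Fin N × Fin N) (Fin N × Fin N) ℝ :=
  Matrix.of fun a b => M (a.1, b.1) (a.2, b.2)

theorem vechIdx_comm {N : ℕ} (u v : Fin N) : vechIdx u v = vechIdx v u := by
  simp [vechIdx, min_comm, max_comm]

theorem strictIdx_comm {N : ℕ} (u v : Fin N) (h : u ≠ v) :
    strictIdx u v h = strictIdx v u h.symm := by
  simp [strictIdx, min_comm, max_comm]

theorem padding_swap {N : ℕ} (Φ : Matrix (VechIdx N) (VechIdx N) ℝ)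
    (W : Matrix (StrictIdx N) (StrictIdx N) ℝ) (a b : Fin N × Fin N) :
    padding Φ W a.swap b.swap = padding Φ W a b := by
  obtain ⟨u, v⟩ := a
  obtain ⟨x, y⟩ := b
  by_cases ha : u = v
  · subst ha
    by_cases hb : x = y
    · subst hb; rfl
    · simp [padding, hb, Ne.symm hb, vechIdx_comm y x]
  · by_cases hb : x = y
    · subst hb
      simp [padding, ha, Ne.symm ha, vechIdx_comm v u]
    · have h : (v < u ↔ y < x) ↔ (u < v ↔ x < y) := by
        rcases lt_or_gt_of_ne ha with h1 | h1 <;> rcases lt_or_gt_of_ne hb with h2 | h2 <;>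
          simp [h1, h2, h1.not_gt, h2.not_gt]
      simp [padding, ha, hb, Ne.symm ha, Ne.symm hb, vechIdx_comm v u, vechIdx_comm y x,
        strictIdx_comm v u (Ne.symm ha), strictIdx_comm y x (Ne.symm hb), h]

/-- The rearranged padded matrix is always symmetric. -/
theorem rearr_padding_isHermitian {N : ℕ} (Φ : Matrix (VechIdx N) (VechIdx N) ℝ)
    (W : Matrix (StrictIdx N) (StrictIdx N) ℝ) : (rearr (padding Φ W)).IsHermitian := by
  ext a b
  exact padding_swap Φ W (a.1, b.1) (a.2, b.2)

/-! ### Parameters of the model -/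

/-- Parameters of an `N`-dimensional BEKK-ARCH model of order `p`. The lag `i + 1` is indexed by
`i : Fin p`; its coefficient matrices are `A i 1, …, A i (K i)`, and no other value of `A i` is ever
used. -/
structure Param (N p : ℕ) where
  /-- the intercept matrix -/
  Om : Matrix (Fin N) (Fin N) ℝ
  /-- the numbers of components -/
  K : Fin p → ℕ
  /-- the coefficient matrices -/
  A : Fin p → ℕ → Matrix (Fin N) (Fin N) ℝ

variable {N p : ℕ}

/-- `Ω` is positive definite, every lag has at least one component, and at each lag the coefficient
matrices are orthogonal, nonzero and strictly descending in Frobenius norm. -/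
structure Param.Restricted (θ : Param N p) : Prop where
  posDef : θ.Om.PosDef
  one_le_K : ∀ i, 1 ≤ θ.K i
  orth : ∀ i k l, 1 ≤ k → k < l → l ≤ θ.K i → frobInner (θ.A i k) (θ.A i l) = 0
  desc : ∀ i k, 1 ≤ k → k < θ.K i → frob (θ.A i (k + 1)) < frob (θ.A i k)
  pos : ∀ i k, 1 ≤ k → k ≤ θ.K i → 0 < frob (θ.A i k)

/-- `Φ_i = D† (∑ₖ A_{ik} ⊗ A_{ik}) D`. -/
def Param.Phi (θ : Param N p) (i : Fin p) : Matrix (VechIdx N) (VechIdx N) ℝ :=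
  elimMat N * (∑ k ∈ Finset.Icc 1 (θ.K i), θ.A i k ⊗ₖ θ.A i k) * dupMat N

/-- The true auxiliary matrix `W_i`, for which `H(Φ_i, W_i) = ∑ₖ A_{ik} ⊗ A_{ik}`. -/
def Param.auxW (θ : Param N p) (i : Fin p) : Matrix (StrictIdx N) (StrictIdx N) ℝ :=
  Matrix.of fun c r =>
    ∑ k ∈ Finset.Icc 1 (θ.K i), θ.A i k r.1.1 c.1.1 * θ.A i k r.1.2 c.1.2

/-- Index set of the `p d + 1` regressors: the intercept and the lagged half-vectorizations. -/
abbrev RegIdx (N p : ℕ) : Type := Option (Fin p × VechIdx N)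

/-- The stacked coefficient matrix `Θ = (ω, Φ_1, …, Φ_p)ᵀ`. -/
def Param.Theta (θ : Param N p) : Matrix (RegIdx N p) (VechIdx N) ℝ :=
  Matrix.of fun a q => match a with
    | none => vech θ.Om q
    | some (i, q') => θ.Phi i q q'

/-- The block `Φ_i` of a stacked coefficient matrix. -/
def lagBlock (Θ : Matrix (RegIdx N p) (VechIdx N) ℝ) (i : Fin p) :
    Matrix (VechIdx N) (VechIdx N) ℝ :=
  Matrix.of fun q q' => Θ (some (i, q')) q

/-- `ς = min_i ‖A_{i K_i}‖²`. -/
def Param.signal (θ : Param N p) : ℝ := ⨅ i, frob (θ.A i (θ.K i)) ^ 2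

/-- The minimum of the ratios `‖A_{i(k+1)}‖² / ‖A_{ik}‖²` over all lags `i` and `1 ≤ k ≤ K_i - 1`,
and `1` if there is no such pair (all ratios are less than `1`). -/
def Param.minRatio (θ : Param N p) : ℝ :=
  sInf (insert 1 {x : ℝ | ∃ i k, 1 ≤ k ∧ k + 1 ≤ θ.K i ∧
    x = frob (θ.A i (k + 1)) ^ 2 / frob (θ.A i k) ^ 2})

/-! ### The process -/

/-- `Σ_t = Ω + ∑ᵢ ∑ₖ A_{ik} r_{t-i} r_{t-i}ᵀ A_{ik}ᵀ` along a path. -/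
def Param.Sig (θ : Param N p) (path : ℤ → Fin N → ℝ) (t : ℤ) : Matrix (Fin N) (Fin N) ℝ :=
  θ.Om + ∑ i : Fin p, ∑ k ∈ Finset.Icc 1 (θ.K i),
    θ.A i k * Matrix.vecMulVec (path (t - ((i : ℕ) + 1))) (path (t - ((i : ℕ) + 1))) * (θ.A i k)ᵀ

section process

variable {Ω : Type*} [MeasurableSpace Ω]

/-- The σ-algebra generated by the `r_s` with `s ∈ S`. -/
abbrev sigmaGen (r : ℤ → Ω → Fin N → ℝ) (S : Set ℤ) : MeasurableSpace Ω :=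
  ⨆ s ∈ S, MeasurableSpace.comap (r s) inferInstance

/-- `r` follows the BEKK-ARCH model: `r_t = Σ_t^{1/2} η_t`, where `Σ_t^{1/2}` is the positive
semidefinite square root and the `η_t` are i.i.d. with mean zero and identity covariance, each `η_t`
independent of the past of `r` (so that `Σ_t` is the conditional covariance of `r_t`). -/
structure IsBekk (μ : Measure Ω) (θ : Param N p) (r η : ℤ → Ω → Fin N → ℝ) : Prop where
  measurable_r : ∀ t, Measurable (r t)
  measurable_η : ∀ t, Measurable (η t)
  indep : iIndepFun η μ
  ident : ∀ t, IdentDistrib (η t) (η 0) μ μ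
  sq_int : ∀ t j, MemLp (fun ω => η t ω j) 2 μ
  mean : ∀ t j, ∫ ω, η t ω j ∂μ = 0
  cov : ∀ t j l, ∫ ω, η t ω j * η t ω l ∂μ = if j = l then 1 else 0
  past : ∀ t, Indep (MeasurableSpace.comap (η t) inferInstance) (sigmaGen r (Set.Iio t)) μ
  model : ∀ t, ∀ᵐ ω ∂μ, ∃ S : Matrix (Fin N) (Fin N) ℝ,
    S.PosSemidef ∧ S * S = θ.Sig (fun s => r s ω) t ∧ r t ω = S *ᵥ η t ω

/-- Strict stationarity. -/
def StrictlyStationary (μ : Measure Ω) (r : ℤ → Ω → Fin N → ℝ) : Prop :=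
  ∀ h : ℤ, IdentDistrib (fun ω t => r (t + h) ω) (fun ω t => r t ω) μ μ

/-- The `α`-mixing coefficient. -/
def alphaCoef (μ : Measure Ω) (r : ℤ → Ω → Fin N → ℝ) (l : ℕ) : ℝ :=
  sSup {x : ℝ | ∃ (t : ℤ) (A B : Set Ω), MeasurableSet[sigmaGen r (Set.Iic t)] A ∧
    MeasurableSet[sigmaGen r (Set.Ici (t + l))] B ∧ x = |μ.real (A ∩ B) - μ.real A * μ.real B|}

/-- `E|r_{t,j}|^q ≤ M` for all `t` and `j`. -/
def MomentBound (μ : Measure Ω) (r : ℤ → Ω → Fin N → ℝ) (q M : ℝ) : Prop :=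
  ∀ t j, Integrable (fun ω => |r t ω j| ^ q) μ ∧ ∫ ω, |r t ω j| ^ q ∂μ ≤ M

end process

/-! ### Regularized least squares -/

/-- `y_t = vech(r_t r_tᵀ)` along a path. -/
def yVec (path : ℤ → Fin N → ℝ) (t : ℤ) : VechIdx N → ℝ :=
  vech (Matrix.vecMulVec (path t) (path t))

/-- `x_t = (1, y_{t-1}ᵀ, …, y_{t-p}ᵀ)ᵀ` along a path. -/
def xVec (p : ℕ) (path : ℤ → Fin N → ℝ) (t : ℤ) : RegIdx N p → ℝ
  | none => 1
  | some (i, q) => yVec path (t - ((i : ℕ) + 1)) q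

/-- Element-wise truncation at level `τ`. -/
def trunc (τ : ℝ) (path : ℤ → Fin N → ℝ) : ℤ → Fin N → ℝ :=
  fun t j => Real.sign (path t j) * min |path t j| τ

/-- The matrix `Y = (y_1, …, y_T)ᵀ`. -/
def yMat (T : ℕ) (path : ℤ → Fin N → ℝ) : Matrix (Fin T) (VechIdx N) ℝ :=
  Matrix.of fun t q => yVec path (((t : ℕ) : ℤ) + 1) q

/-- The matrix `X = (x_1, …, x_T)ᵀ`. -/
def xMat (p T : ℕ) (path : ℤ → Fin N → ℝ) : Matrix (Fin T) (RegIdx N p) ℝ :=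
  Matrix.of fun t a => xVec p path (((t : ℕ) : ℤ) + 1) a

/-- The penalized objective `(2T)⁻¹ ‖Y(τ) - X(τ) Θ‖_F² + lam ‖Θ‖_{1,1}`. -/
def objective (T : ℕ) (lam τ : ℝ) (path : ℤ → Fin N → ℝ)
    (Θ : Matrix (RegIdx N p) (VechIdx N) ℝ) : ℝ :=
  1 / (2 * T) * frob (yMat T (trunc τ path) - xMat p T (trunc τ path) * Θ) ^ 2 + lam * norm11 Θ

/-- `Θ` is a regularized least squares estimate. -/
def IsRLSE (T : ℕ) (lam τ : ℝ) (path : ℤ → Fin N → ℝ)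
    (Θ : Matrix (RegIdx N p) (VechIdx N) ℝ) : Prop :=
  ∀ Θ' : Matrix (RegIdx N p) (VechIdx N) ℝ, objective T lam τ path Θ ≤ objective T lam τ path Θ'

/-- `W` minimizes the nuclear norm of `R(H(Φ, ·))`. -/
def IsPaddingArgmin (Φ : Matrix (VechIdx N) (VechIdx N) ℝ)
    (W : Matrix (StrictIdx N) (StrictIdx N) ℝ) : Prop :=
  ∀ W' : Matrix (StrictIdx N) (StrictIdx N) ℝ,
    nuclearNorm (rearr (padding Φ W)) ≤ nuclearNorm (rearr (padding Φ W'))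

/-- The ridge-type ratio `(λ_{k+1} + c) / (λ_k + c)` of the eigenvalues of `R(H(Φ, W))`. -/
def ridgeRatio (Φ : Matrix (VechIdx N) (VechIdx N) ℝ) (W : Matrix (StrictIdx N) (StrictIdx N) ℝ)
    (c : ℝ) (k : ℕ) : ℝ :=
  (eigDesc (rearr_padding_isHermitian Φ W) (k + 1) + c) /
    (eigDesc (rearr_padding_isHermitian Φ W) k + c)

/-- `k` minimizes the ridge-type ratio over `{1, …, Kbar}`. -/
def IsRidgeArgmin (Φ : Matrix (VechIdx N) (VechIdx N) ℝ) (W : Matrix (StrictIdx N) (StrictIdx N) ℝ)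
    (c : ℝ) (Kbar k : ℕ) : Prop :=
  (1 ≤ k ∧ k ≤ Kbar) ∧ ∀ l, 1 ≤ l → l ≤ Kbar → ridgeRatio Φ W c k ≤ ridgeRatio Φ W c l

/-! ### Quantities in the error rate -/

/-- `Γ_x = E(x_t x_tᵀ)` (at `t = 0`; the process is stationary). -/
def gramX {Ω : Type*} [MeasurableSpace Ω] (p : ℕ) (μ : Measure Ω) (r : ℤ → Ω → Fin N → ℝ) :
    Matrix (RegIdx N p) (RegIdx N p) ℝ :=
  Matrix.of fun a b => ∫ ω, xVec p (fun s => r s ω) 0 a * xVec p (fun s => r s ω) 0 b ∂μ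

theorem gramX_isHermitian {Ω : Type*} [MeasurableSpace Ω] (p : ℕ) (μ : Measure Ω)
    (r : ℤ → Ω → Fin N → ℝ) : (gramX p μ r).IsHermitian := by
  ext a b
  simp [gramX, mul_comm]

/-- `λ_min(Γ_x)`. -/
def lamMinGram {Ω : Type*} [MeasurableSpace Ω] (p : ℕ) (μ : Measure Ω)
    (r : ℤ → Ω → Fin N → ℝ) : ℝ :=
  lamMin (gramX_isHermitian p μ r)

/-- `T_eff = T / (log T)²`. -/
def Teff (T : ℕ) : ℝ := T / Real.log T ^ 2

/-- `log(pd + 1)` with `d = N (N + 1) / 2`. -/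
def logDim (N p : ℕ) : ℝ := Real.log (p * (N * (N + 1) / 2) + 1)

/-- `(M T_eff / log(pd + 1))^{1 / (4 + 4ε)}` with `M = max{M_{4+4ε}, 1}`. -/
def tauRate (N p T : ℕ) (ε Mom : ℝ) : ℝ :=
  (max Mom 1 * Teff T / logDim N p) ^ (1 / (4 + 4 * ε))

/-- `(M^{1/ε} log(pd + 1) / T_eff)^{ε / (1 + ε)}` with `M = max{M_{4+4ε}, 1}`. -/
def baseRate (N p T : ℕ) (ε Mom : ℝ) : ℝ :=
  (max Mom 1 ^ (1 / ε) * logDim N p / Teff T) ^ (ε / (1 + ε))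

/-- `s ‖Θ‖_{1,∞} (M^{1/ε} log(pd + 1) / T_eff)^{ε / (1 + ε)}`. -/
def Param.lamRate (θ : Param N p) (T s : ℕ) (ε Mom : ℝ) : ℝ :=
  s * norm1Inf θ.Theta * baseRate N p T ε Mom

/-- `s^{3/2} N ‖Θ‖_{1,∞} λ_min⁻¹(Γ_x) (M^{1/ε} log(pd + 1) / T_eff)^{ε / (1 + ε)}`. -/
def Param.errRate (θ : Param N p) (T s : ℕ) (ε Mom lmin : ℝ) : ℝ :=
  (s : ℝ) ^ (3 / 2 : ℝ) * N * norm1Inf θ.Theta * lmin⁻¹ * baseRate N p T ε Mom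

end BekkArch

end

/-! Off one event of vanishing probability the argument is deterministic. Rearranging $\sum_k
A_{ik}\otimes A_{ik}$ gives $\sum_k \operatorname{vec}(A_{ik})\operatorname{vec}(A_{ik})^T$, whose
nonzero eigenvalues are the $\|A_{ik}\|_F^2$, by orthogonality. Rearrangement permutes entries, so a
Frobenius error $\delta$ of the padded matrix moves each eigenvalue by at most $\delta$ (min-max
principle). Write rat for the minimal ratio of consecutive signals. If $\delta\le c/4$ and
$c\le\varsigma\cdot\mathrm{rat}/10$, the ridge-type ratio is at most rat/8 at the true number of
components, at least rat/2 before it and at least 3/5 after it (`argmin_ratio_eq`).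

The padding assumption bounds $\delta$ by the error of the least squares estimate, which is a lasso
in each column (`lasso_error_le`). The lasso needs a score below $\lambda/2$ and a sample Gram
matrix entrywise close to $\Gamma_x$. Since $E(x_ty_t^T)=\Gamma_x\Theta^*$
(`IsBekk.integral_xVec_mul_yVec`), both follow once all truncated sample moments are within $b\rho$
of the population moments, $\rho$ being `baseRate`; `badEvent` is the failure of this. The remaining
requirement, $s\rho/\lambda_{\min}(\Gamma_x)\to0$, comes from the window for $c$: it is nonempty
only if the error rate is small against the signal, and the signal is at most
$N\|\Theta^*\|_{1,\infty}$ (`signal_le_norm1Inf`, `sparsity_mul_baseRate_le`). As $s\ge1$ and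
$\lambda_{\min}(\Gamma_x)\le1$, also $\rho\to0$, so that $\tau\ge1$ eventually.

A product of four truncated factors is bounded by $\tau^4$, has second moment
$O(M\tau^{4-4\epsilon})$ and bias $O(M\tau^{-4\epsilon})$. Its sample mean obeys a Bernstein-type
inequality with blocks of length $O(\log T)$ (`GeomMixing.measure_abs_sum_ge_le`). The blocks are
built hierarchically: two blocks of level $j$ are separated by a gap $G+2^j$, so that the mixing
rate $z^{2^j}$ absorbs the sup norm of the exponentials, which is itself exponential in $2^j$.
Averaging over all translates and Jensen's inequality recover the observations lost in the gaps. The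
rate $R$ of $\tau$ satisfies $MR^{-4\epsilon}=\rho$ and $\rho T_{\rm eff}=\log(pd+1)R^4$; the
exponent then beats the number of moments, and the bad event has probability at most $4e/(pd+1)$. -/

namespace BekkArch

/-! ### Exponential inequality under strong mixing -/

section mixing

/-- The covariance of a bounded nonnegative `m`-measurable function with an integrable function is
controlled by the covariance of the latter with the indicator of an `m`-measurable event. -/
theorem exists_covariance_le_indicator {Ω : Type*} {m m0 : MeasurableSpace Ω} {μ : Measure Ω}
    [IsProbabilityMeasure μ] (hm : m ≤ m0) {f g : Ω → ℝ} {F : ℝ}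
    (hf : StronglyMeasurable[m] f) (hf0 : ∀ ω, 0 ≤ f ω) (hfF : ∀ ω, f ω ≤ F)
    (hg : Integrable g μ) :
    ∃ A, MeasurableSet[m] A ∧
      ∫ ω, f ω * g ω ∂μ - (∫ ω, f ω ∂μ) * ∫ ω, g ω ∂μ ≤
        F * (∫ ω in A, g ω ∂μ - μ.real A * ∫ ω, g ω ∂μ) := by
  have hF : 0 ≤ F := by
    obtain ⟨ω⟩ : Nonempty Ω := μ.nonempty_of_neZero
    exact (hf0 ω).trans (hfF ω)
  have hfm : StronglyMeasurable f := hf.mono hm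
  have hfb : ∀ ω, ‖f ω‖ ≤ F := fun ω => by
    rw [Real.norm_eq_abs, abs_of_nonneg (hf0 ω)]; exact hfF ω
  have hfg : Integrable (f * g) μ :=
    hg.bdd_mul hfm.aestronglyMeasurable (ae_of_all _ hfb)
  have hfi : Integrable f μ := Integrable.of_bound hfm.aestronglyMeasurable F (ae_of_all _ hfb)
  set e : ℝ := ∫ ω, g ω ∂μ
  set h : Ω → ℝ := fun ω => (μ[g|m]) ω - e with hh
  have hhm : StronglyMeasurable[m] h :=
    (stronglyMeasurable_condExp (μ := μ) (f := g)).sub stronglyMeasurable_const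
  have hhi : Integrable h μ := integrable_condExp.sub (integrable_const _)
  -- The covariance is the integral of `f * h`. Replacing `f` by `F` where `h ≥ 0` and by `0`
  -- elsewhere only increases it.
  let A : Set Ω := {ω | 0 ≤ h ω}
  have hA : MeasurableSet[m] A := by
    exact hhm.measurable measurableSet_Ici
  refine ⟨A, hA, ?_⟩
  have hA0 : MeasurableSet A := hm _ hA
  have e1 : ∫ ω, f ω * g ω ∂μ = ∫ ω, f ω * (μ[g|m]) ω ∂μ := by
    rw [← integral_condExp hm (f := fun ω => f ω * g ω)]
    exact integral_congr_ae (condExp_mul_of_stronglyMeasurable_left hf hfg hg)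
  have hfci : Integrable (fun ω => f ω * (μ[g|m]) ω) μ :=
    integrable_condExp.bdd_mul hfm.aestronglyMeasurable (ae_of_all _ hfb)
  have e2 : ∫ ω, f ω * g ω ∂μ - (∫ ω, f ω ∂μ) * e = ∫ ω, f ω * h ω ∂μ := by
    rw [e1, ← integral_mul_const, ← integral_sub hfci (hfi.mul_const _)]
    refine integral_congr_ae (ae_of_all _ fun ω => ?_)
    simp only [hh]; ring
  have e3 : ∫ ω in A, g ω ∂μ - μ.real A * e = ∫ ω in A, h ω ∂μ := by
    rw [← setIntegral_condExp hm hg hA, hh,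
      integral_sub integrable_condExp.integrableOn (integrable_const _)]
    simp
  rw [e2, e3, ← integral_indicator hA0, ← integral_const_mul]
  refine integral_mono (hhi.bdd_mul hfm.aestronglyMeasurable (ae_of_all _ hfb))
    ((hhi.indicator hA0).const_mul _) fun ω => ?_
  by_cases hω : ω ∈ A
  · simp only [Set.indicator_of_mem hω]
    exact mul_le_mul_of_nonneg_right (hfF ω) hω
  · simp only [Set.indicator_of_notMem hω, mul_zero]
    exact mul_nonpos_of_nonneg_of_nonpos (hf0 ω) (not_le.1 hω).le

/-- Covariance inequality for bounded nonnegative functions under strong mixing. -/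
theorem integral_mul_le_of_mixing {Ω : Type*} {m₁ m₂ m0 : MeasurableSpace Ω} {μ : Measure Ω}
    [IsProbabilityMeasure μ] (h₁ : m₁ ≤ m0) (h₂ : m₂ ≤ m0)
    {f g : Ω → ℝ} {F G a : ℝ}
    (hf : StronglyMeasurable[m₁] f) (hf0 : ∀ ω, 0 ≤ f ω) (hfF : ∀ ω, f ω ≤ F)
    (hg : StronglyMeasurable[m₂] g) (hg0 : ∀ ω, 0 ≤ g ω) (hgG : ∀ ω, g ω ≤ G)
    (hα : ∀ A B, MeasurableSet[m₁] A → MeasurableSet[m₂] B →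
      μ.real (A ∩ B) - μ.real A * μ.real B ≤ a) :
    ∫ ω, f ω * g ω ∂μ ≤ (∫ ω, f ω ∂μ) * (∫ ω, g ω ∂μ) + F * G * a := by
  obtain ⟨ω₀⟩ : Nonempty Ω := μ.nonempty_of_neZero
  have hF : 0 ≤ F := (hf0 ω₀).trans (hfF ω₀)
  have hG : 0 ≤ G := (hg0 ω₀).trans (hgG ω₀)
  have hgi : Integrable g μ := Integrable.of_bound (hg.mono h₂).aestronglyMeasurable G
    (ae_of_all _ fun ω => by rw [Real.norm_eq_abs, abs_of_nonneg (hg0 ω)]; exact hgG ω)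
  obtain ⟨A, hA, h1⟩ := exists_covariance_le_indicator (μ := μ) h₁ hf hf0 hfF hgi
  have hA0 : MeasurableSet A := h₁ _ hA
  -- Second use with the roles exchanged: the indicator of `A` is now the integrable function, so
  -- both functions end up replaced by events.
  obtain ⟨B, hB, h2⟩ := exists_covariance_le_indicator (μ := μ) h₂ hg hg0 hgG
    (g := A.indicator fun _ => (1 : ℝ)) ((integrable_const _).indicator hA0)
  have hB0 : MeasurableSet B := h₂ _ hB
  have e1 : ∫ ω, g ω * A.indicator (fun _ => (1 : ℝ)) ω ∂μ = ∫ ω in A, g ω ∂μ := by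
    rw [← integral_indicator hA0]
    refine integral_congr_ae (ae_of_all _ fun ω => ?_)
    by_cases hω : ω ∈ A <;> simp [hω]
  have e2 : ∫ ω, A.indicator (fun _ => (1 : ℝ)) ω ∂μ = μ.real A := by
    rw [integral_indicator hA0]; simp
  have e3 : ∫ ω in B, A.indicator (fun _ => (1 : ℝ)) ω ∂μ = μ.real (A ∩ B) := by
    rw [setIntegral_indicator hA0]; simp [Set.inter_comm]
  rw [e1, e2, e3] at h2
  have h3 := hα A B hA hB
  have h4 : F * (∫ ω in A, g ω ∂μ - μ.real A * ∫ ω, g ω ∂μ) ≤ F * (G * a) := by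
    refine mul_le_mul_of_nonneg_left ?_ hF
    have := mul_le_mul_of_nonneg_left h3 hG
    nlinarith [this, h2]
  nlinarith [h1, h4]

/-- Spacing between the two halves of a hierarchical block at a given level. -/
def hierGap (G j : ℕ) : ℕ := G + 2 ^ j

/-- Length of a hierarchical block at a given level. -/
def hierLen (m G : ℕ) : ℕ → ℕ
  | 0 => m
  | j + 1 => 2 * hierLen m G j + hierGap G j

/-- Sum over a hierarchical block: a block of level `j + 1` consists of two blocks of level `j`
separated by a gap. -/
def hierSum {E : Type*} [AddCommMonoid E] (m G : ℕ) (X : ℤ → E) : ℕ → ℤ → E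
  | 0, a => ∑ k ∈ Finset.range m, X (a + k)
  | j + 1, a => hierSum m G X j a + hierSum m G X j (a + (hierLen m G j + hierGap G j : ℕ))

/-- Each level contributes the same order `2 ^ j` of extra spacing, so the growing gaps cost only
the additive `j` beside `m + G`. If `G + J ≤ m`, a block is at most twice as long as the number of
its points. -/
theorem hierLen_add_le (m G j : ℕ) : hierLen m G j + G ≤ 2 ^ j * (m + G + j) := by
  induction j with
  | zero => simp [hierLen]
  | succ j ih =>
    simp only [hierLen, hierGap]
    calc 2 * hierLen m G j + (G + 2 ^ j) + G = 2 * (hierLen m G j + G) + 2 ^ j := by ring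
      _ ≤ 2 * (2 ^ j * (m + G + j)) + 2 * 2 ^ j := by omega
      _ = 2 ^ (j + 1) * (m + G + (j + 1)) := by ring

/-- Every index is covered by exactly `2 ^ j * m` translates, provided the window of shifts lets
each point of the block run over all of `[0, T)`. Thus the gaps lose nothing on average. -/
theorem sum_hierSum {E : Type*} [AddCommMonoid E] (m G T : ℕ) (X : ℤ → E)
    (hX : ∀ i, i ∉ Finset.Ico (0 : ℤ) T → X i = 0) (j : ℕ) :
    ∀ u w : ℤ, u ≤ -(hierLen m G j : ℤ) → (T : ℤ) ≤ w →
      ∑ a ∈ Finset.Ico u w, hierSum m G X j a =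
        (2 ^ j * m) • ∑ i ∈ Finset.Ico (0 : ℤ) T, X i := by
  induction j with
  | zero =>
    intro u w hu hw
    simp only [hierSum, hierLen] at hu ⊢
    rw [Finset.sum_comm]
    have : ∀ k ∈ Finset.range m, ∑ a ∈ Finset.Ico u w, X (a + k) =
        ∑ i ∈ Finset.Ico (0 : ℤ) T, X i := by
      intro k hk
      have hk' := Finset.mem_range.1 hk
      rw [Finset.sum_Ico_add' X u w (k : ℤ)]
      symm
      refine Finset.sum_subset (Finset.Ico_subset_Ico (by omega) (by omega)) ?_
      intro i _ hi
      exact hX i hi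
    rw [Finset.sum_congr rfl this]
    simp
  | succ j ih =>
    intro u w hu hw
    simp only [hierSum]
    have hl : hierLen m G (j + 1) = 2 * hierLen m G j + hierGap G j := rfl
    rw [Finset.sum_add_distrib, ih u w (by rw [hl] at hu; push_cast at hu ⊢; omega) hw,
      Finset.sum_Ico_add' (hierSum m G X j) u w,
      ih _ _ (by rw [hl] at hu; push_cast at hu ⊢; omega) (by push_cast; omega), ← add_smul]
    congr 1
    ring

theorem abs_hierSum_le {X : ℤ → ℝ} {B : ℝ} (hX : ∀ i, |X i| ≤ B) (m G j : ℕ) :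
    ∀ a, |hierSum m G X j a| ≤ B * (2 ^ j * m) := by
  induction j with
  | zero =>
    intro a
    simp only [hierSum]
    refine (Finset.abs_sum_le_sum_abs _ _).trans ?_
    refine (Finset.sum_le_sum fun k _ => hX _).trans (le_of_eq ?_)
    simp [mul_comm]
  | succ j ih =>
    intro a
    refine (abs_add_le _ _).trans ((add_le_add (ih _) (ih _)).trans (le_of_eq ?_))
    ring

theorem hierSum_apply {Ω : Type*} (X : ℤ → Ω → ℝ) (m G j : ℕ) (ω : Ω) :
    ∀ a, hierSum m G X j a ω = hierSum m G (fun i => X i ω) j a := by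
  induction j with
  | zero => intro a; simp [hierSum]
  | succ j ih => intro a; simp [hierSum, ih]

/-- With its counterpart for the future, this places the two halves of a block on opposite sides of
a gap, where mixing applies. -/
theorem stronglyMeasurable_hierSum_of_past {Ω : Type*} {P : ℤ → MeasurableSpace Ω} (hP : Monotone P)
    {X : ℤ → Ω → ℝ} (hX : ∀ i, StronglyMeasurable[P i] (X i)) (m G j : ℕ) :
    ∀ a, StronglyMeasurable[P (a + hierLen m G j)] (hierSum m G X j a) := by
  induction j with
  | zero =>
    intro a
    refine Finset.stronglyMeasurable_sum _ fun k hk => ?_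
    refine (hX _).mono (hP ?_)
    have := Finset.mem_range.1 hk
    simp only [hierLen]
    omega
  | succ j ih =>
    intro a
    refine StronglyMeasurable.add ((ih a).mono (hP ?_)) ((ih _).mono (hP ?_)) <;>
    · simp only [hierLen]; push_cast; omega

theorem stronglyMeasurable_hierSum_of_future {Ω : Type*} {Q : ℤ → MeasurableSpace Ω} (hQ : Antitone Q)
    {X : ℤ → Ω → ℝ} (hX : ∀ i, StronglyMeasurable[Q i] (X i)) (m G j : ℕ) :
    ∀ a, StronglyMeasurable[Q a] (hierSum m G X j a) := by
  induction j with
  | zero =>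
    intro a
    simp only [hierSum]
    refine Finset.stronglyMeasurable_sum _ fun k hk => ?_
    exact (hX _).mono (hQ (by omega))
  | succ j ih =>
    intro a
    simp only [hierSum]
    exact StronglyMeasurable.add (ih a) ((ih _).mono (hQ (by omega)))

variable {Ω : Type*} [m0 : MeasurableSpace Ω]

/-- The past `P` and the future `Q` of a process are strongly mixing at rate `C z ^ g`. -/
structure GeomMixing (μ : Measure Ω) (P Q : ℤ → MeasurableSpace Ω) (C z : ℝ) : Prop where
  past_le : ∀ i, P i ≤ m0
  future_le : ∀ i, Q i ≤ m0
  mono : Monotone P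
  anti : Antitone Q
  mixing : ∀ (i : ℤ) (g : ℕ) (A B : Set Ω), MeasurableSet[P i] A → MeasurableSet[Q (i + g)] B →
    μ.real (A ∩ B) - μ.real A * μ.real B ≤ C * z ^ g

variable {μ : Measure Ω} [IsProbabilityMeasure μ] {P Q : ℤ → MeasurableSpace Ω} {C z B v : ℝ} {X : ℤ → Ω → ℝ}

/-- For `|x| ≤ 1`, `exp x ≤ 1 + x + x ^ 2`. The linear term is centred, and Cauchy–Schwarz bounds
the squared sum by `m` times the sum of squares, whatever the dependence inside the block. -/
theorem integral_exp_block_le (hXm : ∀ i, StronglyMeasurable (X i)) (hXB : ∀ i ω, |X i ω| ≤ B)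
    (hX0 : ∀ i, ∫ ω, X i ω ∂μ = 0) (hXv : ∀ i, ∫ ω, X i ω ^ 2 ∂μ ≤ v) (m G : ℕ) {lam : ℝ}
    (hlam : 0 ≤ lam) (h1 : lam * (B * m) ≤ 1) (a : ℤ) :
    ∫ ω, Real.exp (lam * hierSum m G X 0 a ω) ∂μ ≤ Real.exp (lam ^ 2 * (m ^ 2 * v)) := by
  have hXi : ∀ i, Integrable (X i) μ := fun i =>
    Integrable.of_bound (hXm i).aestronglyMeasurable B (ae_of_all _ (hXB i))
  have hX2i : ∀ i, Integrable (fun ω => X i ω ^ 2) μ := fun i =>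
    Integrable.of_bound ((hXm i).pow 2).aestronglyMeasurable (B ^ 2) (ae_of_all _ fun ω => by
      rw [Real.norm_eq_abs, abs_pow]
      exact pow_le_pow_left₀ (abs_nonneg _) (hXB i ω) 2)
  have hZ : ∀ ω, |lam * hierSum m G X 0 a ω| ≤ 1 := fun ω => by
    rw [abs_mul, abs_of_nonneg hlam, hierSum_apply]
    refine (mul_le_mul_of_nonneg_left
      (abs_hierSum_le (X := fun i => X i ω) (fun i => hXB i ω) m G 0 a) hlam).trans ?_
    simpa using h1
  have hpt : ∀ ω, Real.exp (lam * hierSum m G X 0 a ω) ≤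
      1 + lam * (∑ k ∈ Finset.range m, X (a + k) ω) +
        lam ^ 2 * (m * ∑ k ∈ Finset.range m, X (a + k) ω ^ 2) := fun ω => by
    have h2 := (abs_le.1 (Real.abs_exp_sub_one_sub_id_le (hZ ω))).2
    have e : hierSum m G X 0 a ω = ∑ k ∈ Finset.range m, X (a + k) ω := by simp [hierSum]
    rw [e] at h2 ⊢
    have h3 := sq_sum_le_card_mul_sum_sq (s := Finset.range m) (f := fun k => X (a + k) ω)
    rw [Finset.card_range] at h3
    have := mul_le_mul_of_nonneg_left h3 (sq_nonneg lam)
    linarith [mul_pow lam (∑ k ∈ Finset.range m, X (a + k) ω) 2]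
  have i1 : Integrable (fun ω => ∑ k ∈ Finset.range m, X (a + k) ω) μ :=
    integrable_finsetSum _ fun k _ => hXi _
  have i2 : Integrable (fun ω => ∑ k ∈ Finset.range m, X (a + k) ω ^ 2) μ :=
    integrable_finsetSum _ fun k _ => hX2i _
  have hZm : StronglyMeasurable (fun ω => lam * hierSum m G X 0 a ω) := by
    refine StronglyMeasurable.const_mul ?_ lam
    exact Finset.stronglyMeasurable_sum _ fun k _ => hXm _
  have i3 : Integrable (fun ω => Real.exp (lam * hierSum m G X 0 a ω)) μ :=
    Integrable.of_bound (Real.continuous_exp.comp_stronglyMeasurable hZm).aestronglyMeasurable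
      (Real.exp 1) (ae_of_all _ fun ω => by
        rw [Real.norm_eq_abs, abs_of_pos (Real.exp_pos _)]
        exact Real.exp_le_exp.2 (abs_le.1 (hZ ω)).2)
  have i4 : Integrable (fun ω => 1 + lam * ∑ k ∈ Finset.range m, X (a + k) ω) μ :=
    (integrable_const _).add (i1.const_mul lam)
  refine (integral_mono i3 (i4.add ((i2.const_mul (m : ℝ)).const_mul (lam ^ 2))) hpt).trans ?_
  simp only [Pi.add_apply]
  rw [integral_add i4 ((i2.const_mul (m : ℝ)).const_mul (lam ^ 2)),
    integral_add (integrable_const _) (i1.const_mul lam), integral_const_mul, integral_const_mul,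
    integral_const_mul, integral_finsetSum _ (fun k _ => hXi _),
    integral_finsetSum _ (fun k _ => hX2i _)]
  simp only [hX0, Finset.sum_const_zero, mul_zero, add_zero, integral_const, probReal_univ,
    smul_eq_mul, mul_one]
  have h5 : ∑ k ∈ Finset.range m, ∫ ω, X (a + k) ω ^ 2 ∂μ ≤ m * v := by
    refine (Finset.sum_le_sum fun k _ => hXv _).trans (le_of_eq ?_)
    simp
  have h6 : lam ^ 2 * (m * ∑ k ∈ Finset.range m, ∫ ω, X (a + k) ω ^ 2 ∂μ) ≤
      lam ^ 2 * (m ^ 2 * v) := by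
    refine mul_le_mul_of_nonneg_left ?_ (sq_nonneg _)
    have := mul_le_mul_of_nonneg_left h5 (Nat.cast_nonneg (α := ℝ) m)
    linarith [this, show (m : ℝ) ^ 2 * v = m * (m * v) by ring]
  linarith [Real.add_one_le_exp (lam ^ 2 * (m ^ 2 * v))]

/-- Induction on the level. Decoupling two half blocks costs a covariance term, kept below `C * z ^
G` at every level by the gap. The `- C * z ^ G` in the exponent is a reserve that lets the induction
close. -/
theorem integral_exp_hierSum_le (hmix : GeomMixing μ P Q C z) (hC : 0 ≤ C) (hz0 : 0 < z)
    (hXP : ∀ i, StronglyMeasurable[P i] (X i)) (hXQ : ∀ i, StronglyMeasurable[Q i] (X i))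
    (hXB : ∀ i ω, |X i ω| ≤ B) (hX0 : ∀ i, ∫ ω, X i ω ∂μ = 0)
    (hXv : ∀ i, ∫ ω, X i ω ^ 2 ∂μ ≤ v) (hv : 0 ≤ v) (m G : ℕ) {lam : ℝ}
    (hlam : 0 ≤ lam) (h1 : lam * (B * m) ≤ 1) (h2 : 2 * (lam * (B * m)) ≤ Real.log (1 / z))
    (j : ℕ) :
    ∀ a, ∫ ω, Real.exp (lam * hierSum m G X j a ω) ∂μ ≤
      Real.exp (2 ^ j * (lam ^ 2 * (m ^ 2 * v) + C * z ^ G) - C * z ^ G) := by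
  induction j with
  | zero =>
    intro a
    refine (integral_exp_block_le (fun i => (hXP i).mono (hmix.past_le i)) hXB hX0 hXv m G hlam h1
      a).trans (Real.exp_le_exp.2 ?_)
    simp
  | succ j ih =>
    intro a
    set e := C * z ^ G with he
    set h := lam ^ 2 * (m ^ 2 * v)
    set a' : ℤ := a + (hierLen m G j + hierGap G j : ℕ) with ha'
    have he0 : 0 ≤ e := by positivity
    have hh0 : 0 ≤ h := by positivity
    have hb : ∀ a ω, Real.exp (lam * hierSum m G X j a ω) ≤
        Real.exp (2 ^ j * (lam * (B * m))) := fun a ω => by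
      refine Real.exp_le_exp.2 ?_
      have := (abs_le.1 (abs_hierSum_le (X := fun i => X i ω) (fun i => hXB i ω) m G j a)).2
      rw [hierSum_apply]
      have := mul_le_mul_of_nonneg_left this hlam
      linarith [this, show lam * (B * (2 ^ j * m)) = 2 ^ j * (lam * (B * m)) by ring]
    have hsm := stronglyMeasurable_hierSum_of_past hmix.mono hXP m G j a
    have hsq := stronglyMeasurable_hierSum_of_future hmix.anti hXQ m G j a'
    have hcov := integral_mul_le_of_mixing (μ := μ) (hmix.past_le _) (hmix.future_le _)
      (Real.continuous_exp.comp_stronglyMeasurable (hsm.const_mul lam))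
      (fun ω => (Real.exp_pos _).le) (hb a)
      (Real.continuous_exp.comp_stronglyMeasurable (hsq.const_mul lam))
      (fun ω => (Real.exp_pos _).le) (hb a') (a := C * z ^ (hierGap G j)) (by
        intro A D hA hD
        refine hmix.mixing (a + hierLen m G j) (hierGap G j) A D hA ?_
        have : a' = a + hierLen m G j + hierGap G j := by rw [ha']; push_cast; ring
        rwa [this] at hD)
    have e1 : ∀ ω, Real.exp (lam * hierSum m G X (j + 1) a ω) =
        Real.exp (lam * hierSum m G X j a ω) * Real.exp (lam * hierSum m G X j a' ω) := fun ω => by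
      rw [← Real.exp_add]; simp only [hierSum, Pi.add_apply, ← ha']; ring_nf
    simp only [e1]
    refine hcov.trans ?_
    -- The sup norms multiply to `exp (2 ^ j * (2 * lam * B * m))`; the part `z ^ (2 ^ j)` of the
    -- mixing coefficient absorbs them because `2 * lam * B * m ≤ log (1 / z)`.
    have herr : Real.exp (2 ^ j * (lam * (B * m))) * Real.exp (2 ^ j * (lam * (B * m))) *
        (C * z ^ (hierGap G j)) ≤ e := by
      have hz : z ^ (2 ^ j) = Real.exp (- (2 ^ j * Real.log (1 / z))) := by
        rw [one_div, Real.log_inv, mul_neg, neg_neg, mul_comm, Real.exp_mul, Real.exp_log hz0]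
        norm_cast
      rw [hierGap, pow_add, hz, ← Real.exp_add]
      have : Real.exp (2 ^ j * (lam * (B * m)) + 2 ^ j * (lam * (B * m))) *
          (C * (z ^ G * Real.exp (- (2 ^ j * Real.log (1 / z))))) =
          e * Real.exp (2 ^ j * (2 * (lam * (B * m)) - Real.log (1 / z))) := by
        rw [show (2 : ℝ) ^ j * (2 * (lam * (B * m)) - Real.log (1 / z)) =
          (2 ^ j * (lam * (B * m)) + 2 ^ j * (lam * (B * m))) + - (2 ^ j * Real.log (1 / z)) by ring,
          Real.exp_add _ (-(2 ^ j * Real.log (1 / z))), he]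
        ring
      rw [this]
      refine mul_le_of_le_one_right he0 (Real.exp_le_one_iff.2 ?_)
      exact mul_nonpos_of_nonneg_of_nonpos (by positivity) (by linarith)
    have hprod : (∫ ω, Real.exp (lam * hierSum m G X j a ω) ∂μ) *
        (∫ ω, Real.exp (lam * hierSum m G X j a' ω) ∂μ) ≤
        Real.exp (2 ^ (j + 1) * (h + e) - 2 * e) := by
      refine (mul_le_mul (ih a) (ih a') (integral_nonneg fun ω => (Real.exp_pos _).le)
        (Real.exp_pos _).le).trans (le_of_eq ?_)
      rw [← Real.exp_add]
      congr 1
      ring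
    -- With a nonnegative exponent the product bound is at least `1`, so adding `e` costs at most a
    -- factor `1 + e ≤ exp e`. This uses up one of the two reserves `e` inherited from the halves.
    have hy : 0 ≤ 2 ^ (j + 1) * (h + e) - 2 * e := by
      have : (1 : ℝ) ≤ 2 ^ j := one_le_pow₀ (by norm_num)
      have h3 : h + e ≤ 2 ^ j * (h + e) := le_mul_of_one_le_left (by positivity) this
      rw [pow_succ]
      nlinarith
    have hfin : Real.exp (2 ^ (j + 1) * (h + e) - e) =
        Real.exp (2 ^ (j + 1) * (h + e) - 2 * e) * Real.exp e := by
      rw [← Real.exp_add]; congr 1; ring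
    rw [hfin]
    have h4 := Real.add_one_le_exp e
    have h5 : 1 ≤ Real.exp (2 ^ (j + 1) * (h + e) - 2 * e) := Real.one_le_exp hy
    refine (add_le_add hprod herr).trans ?_
    nlinarith

/-- The full sum is a rescaled average of hierarchical sums over all translates, so convexity of
`exp` transfers their bound. -/
theorem GeomMixing.integral_exp_sum_le (hmix : GeomMixing μ P Q C z) (hC : 0 ≤ C) (hz0 : 0 < z)
    {X : ℤ → Ω → ℝ} (hXP : ∀ i, StronglyMeasurable[P i] (X i))
    (hXQ : ∀ i, StronglyMeasurable[Q i] (X i)) (hB : 0 ≤ B)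
    (hXB : ∀ i ω, |X i ω| ≤ B) (hX0 : ∀ i, ∫ ω, X i ω ∂μ = 0)
    (hXv : ∀ i, ∫ ω, X i ω ^ 2 ∂μ ≤ v) (hv : 0 ≤ v) {m G J T : ℕ} (hm : 0 < m) (hGJ : G + J ≤ m)
    (hT : T ≤ 2 ^ J * m) (hT' : 2 ^ J * m ≤ 2 * T) {lam : ℝ}
    (hlam : 0 ≤ lam) (h1 : 3 * lam * (B * m) ≤ 1)
    (h2 : 2 * (3 * lam * (B * m)) ≤ Real.log (1 / z)) :
    ∫ ω, Real.exp (lam * ∑ i ∈ Finset.Ico (0 : ℤ) T, X i ω) ∂μ ≤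
      Real.exp (18 * (lam ^ 2 * (T * m * v)) + 2 * T * (C * z ^ G)) := by
  classical
  -- Extension by zero outside the sample keeps centring, bounds and measurability, and allows
  -- blocks to overhang the ends.
  set X' : ℤ → Ω → ℝ := fun i => if i ∈ Finset.Ico (0 : ℤ) T then X i else 0 with hX'
  have cases : ∀ i, X' i = X i ∨ X' i = 0 := fun i => by
    by_cases h : i ∈ Finset.Ico (0 : ℤ) T
    · left; simp only [hX', if_pos h]
    · right; simp only [hX', if_neg h]
  have hP' : ∀ i, StronglyMeasurable[P i] (X' i) := fun i => by
    rcases cases i with h | h <;> rw [h]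
    · exact hXP i
    · exact stronglyMeasurable_zero
  have hQ' : ∀ i, StronglyMeasurable[Q i] (X' i) := fun i => by
    rcases cases i with h | h <;> rw [h]
    · exact hXQ i
    · exact stronglyMeasurable_zero
  have hB' : ∀ i ω, |X' i ω| ≤ B := fun i ω => by
    rcases cases i with h | h <;> rw [h]
    · exact hXB i ω
    · simpa using hB
  have h0' : ∀ i, ∫ ω, X' i ω ∂μ = 0 := fun i => by
    rcases cases i with h | h <;> rw [h]
    · exact hX0 i
    · simp
  have hv' : ∀ i, ∫ ω, X' i ω ^ 2 ∂μ ≤ v := fun i => by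
    rcases cases i with h | h <;> rw [h]
    · exact hXv i
    · simpa using hv
  set len := hierLen m G J with hlen
  have hlenle : len ≤ 2 * (2 ^ J * m) := by
    have h3 := hierLen_add_le m G J
    have : 2 ^ J * (m + G + J) ≤ 2 ^ J * (2 * m) := Nat.mul_le_mul_left _ (by omega)
    have e : 2 ^ J * (2 * m) = 2 * (2 ^ J * m) := by ring
    omega
  set w : ℕ := 2 ^ J * m with hw
  have hw0 : 0 < w := by positivity
  set I : Finset ℤ := Finset.Ico (-(len : ℤ)) T with hI
  have hIcard : I.card = len + T := by
    rw [hI, Int.card_Ico]; omega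
  have hI0 : 0 < I.card := by
    rw [hIcard]
    have : 0 < T := by omega
    omega
  have hIr : (0 : ℝ) < I.card := by exact_mod_cast hI0
  -- The block sums over `I` add up to `w` times the full sum, hence this rescaling. Since `I.card =
  -- len + T ≤ 3 * w`, it costs at most a factor 3.
  set lam' : ℝ := lam * I.card / w with hlam'
  have hwr : (0 : ℝ) < w := by exact_mod_cast hw0
  have hlam'0 : 0 ≤ lam' := by positivity
  have hlam'3 : lam' ≤ 3 * lam := by
    rw [hlam', div_le_iff₀ hwr]
    have : (I.card : ℝ) ≤ 3 * w := by
      rw [hIcard]; exact_mod_cast (by omega : len + T ≤ 3 * w)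
    nlinarith
  have hBm : 0 ≤ B * m := by positivity
  have hbd := integral_exp_hierSum_le hmix hC hz0 hP' hQ' hB' h0' hv' hv m G hlam'0
    ((mul_le_mul_of_nonneg_right hlam'3 hBm).trans h1)
    (by have := mul_le_mul_of_nonneg_right hlam'3 hBm; linarith) J
  have hmeas : ∀ a, StronglyMeasurable (hierSum m G X' J a) := fun a =>
    (stronglyMeasurable_hierSum_of_past hmix.mono hP' m G J a).mono (hmix.past_le _)
  have hint : ∀ a, Integrable (fun ω => Real.exp (lam' * hierSum m G X' J a ω)) μ := fun a =>
    Integrable.of_bound (Real.continuous_exp.comp_stronglyMeasurable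
      ((hmeas a).const_mul lam')).aestronglyMeasurable
      (Real.exp (lam' * (B * (2 ^ J * m)))) (ae_of_all _ fun ω => by
        rw [Real.norm_eq_abs, abs_of_pos (Real.exp_pos _)]
        refine Real.exp_le_exp.2 (mul_le_mul_of_nonneg_left ?_ hlam'0)
        rw [hierSum_apply]
        exact (abs_le.1 (abs_hierSum_le (X := fun i => X' i ω) (fun i => hB' i ω) m G J a)).2)
  have hpt : ∀ ω, Real.exp (lam * ∑ i ∈ Finset.Ico (0 : ℤ) T, X i ω) ≤
      ∑ a ∈ I, (1 / I.card : ℝ) * Real.exp (lam' * hierSum m G X' J a ω) := fun ω => by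
    have hs := sum_hierSum m G T (fun i => X' i ω)
      (fun i hi => by simp only [hX', if_neg hi, Pi.zero_apply]) J (-(len : ℤ)) T le_rfl le_rfl
    have hs' : ∑ i ∈ Finset.Ico (0 : ℤ) T, X' i ω = ∑ i ∈ Finset.Ico (0 : ℤ) T, X i ω :=
      Finset.sum_congr rfl fun i hi => by simp only [hX', if_pos hi]
    rw [hs', ← hw, nsmul_eq_mul] at hs
    have hj := convexOn_exp.map_sum_le (t := I) (w := fun _ => (1 / I.card : ℝ))
      (p := fun a => lam' * hierSum m G X' J a ω) (fun _ _ => by positivity)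
      (by simp [hIr.ne']) (fun _ _ => Set.mem_univ _)
    simp only [smul_eq_mul] at hj
    refine le_trans (le_of_eq ?_) hj
    congr 1
    rw [← Finset.mul_sum, ← Finset.mul_sum]
    have e : ∑ a ∈ I, hierSum m G X' J a ω =
        (w : ℝ) * ∑ i ∈ Finset.Ico (0 : ℤ) T, X i ω := by
      rw [← hs]; exact Finset.sum_congr rfl fun a _ => hierSum_apply X' m G J ω a
    rw [e, hlam']
    field_simp
  have hLint : Integrable (fun ω => Real.exp (lam * ∑ i ∈ Finset.Ico (0 : ℤ) T, X i ω)) μ := by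
    refine Integrable.mono' (integrable_finsetSum I fun a _ => (hint a).const_mul (1 / I.card : ℝ))
      ?_ (ae_of_all _ fun ω => ?_)
    · refine (Real.continuous_exp.comp_stronglyMeasurable (StronglyMeasurable.const_mul
        (?_ : StronglyMeasurable fun ω => ∑ i ∈ Finset.Ico (0 : ℤ) T, X i ω)
        lam)).aestronglyMeasurable
      exact Finset.stronglyMeasurable_fun_sum _ fun i _ => (hXP i).mono (hmix.past_le i)
    · rw [Real.norm_eq_abs, abs_of_pos (Real.exp_pos _)]; exact hpt ω
  refine (integral_mono hLint
    (integrable_finsetSum I fun a _ => (hint a).const_mul (1 / I.card : ℝ)) hpt).trans ?_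
  rw [integral_finsetSum _ fun a _ => (hint a).const_mul (1 / I.card : ℝ)]
  simp only [integral_const_mul]
  have : ∀ a ∈ I, (1 / I.card : ℝ) * ∫ ω, Real.exp (lam' * hierSum m G X' J a ω) ∂μ ≤
      (1 / I.card : ℝ) * Real.exp (18 * (lam ^ 2 * (T * m * v)) + 2 * T * (C * z ^ G)) := by
    intro a _
    refine mul_le_mul_of_nonneg_left ((hbd a).trans (Real.exp_le_exp.2 ?_)) (by positivity)
    set e := C * z ^ G
    have he : 0 ≤ e := by positivity
    have q1 : lam' ^ 2 ≤ 9 * lam ^ 2 := by nlinarith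
    have q2 : (2 : ℝ) ^ J * m ≤ 2 * T := by exact_mod_cast hT'
    have q3 : (2 : ℝ) ^ J ≤ 2 * T := by
      refine le_trans ?_ q2
      have : (1 : ℝ) ≤ m := by exact_mod_cast hm
      exact le_mul_of_one_le_right (by positivity) this
    -- The constant 18 is `9` from `lam' ≤ 3 * lam` times `2` from `2 ^ J * m ≤ 2 * T`.
    have q4 : (2 : ℝ) ^ J * (lam' ^ 2 * (m ^ 2 * v)) ≤ 18 * (lam ^ 2 * (T * m * v)) := by
      calc (2 : ℝ) ^ J * (lam' ^ 2 * (m ^ 2 * v)) = (2 ^ J * m) * (lam' ^ 2 * (m * v)) := by ring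
        _ ≤ (2 * T) * (9 * lam ^ 2 * (m * v)) := by
          refine mul_le_mul q2 (mul_le_mul_of_nonneg_right q1 (by positivity)) (by positivity)
            (by positivity)
        _ = _ := by ring
    have q5 := mul_le_mul_of_nonneg_right q3 he
    linarith [mul_add ((2 : ℝ) ^ J) (lam' ^ 2 * (m ^ 2 * v)) e]
  refine (Finset.sum_le_sum this).trans (le_of_eq ?_)
  rw [Finset.sum_const, nsmul_eq_mul]
  field_simp

end mixing

/-- Block parameters of logarithmic size for the exponential inequality. -/
theorem exists_block_parameters {C z : ℝ} (hC : 0 < C) (hz0 : 0 < z) (hz1 : z < 1) :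
    ∃ c₁ : ℝ, 0 < c₁ ∧ ∀ᶠ T : ℕ in atTop, ∃ m G J : ℕ, 0 < m ∧ G + J ≤ m ∧ T ≤ 2 ^ J * m ∧
      2 ^ J * m ≤ 2 * T ∧ (m : ℝ) ≤ c₁ * Real.log T ∧ 2 * T * (C * z ^ G) ≤ 1 := by
  set l := Real.log (1 / z) with hl
  have hl0 : 0 < l := Real.log_pos (by rw [lt_div_iff₀ hz0]; linarith)
  have hlog2 : 0 < Real.log 2 := Real.log_pos (by norm_num)
  set c₁ := 2 / l + 1 / Real.log 2 + 3 with hc₁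
  have hc₁0 : 0 < c₁ := by positivity
  refine ⟨c₁, hc₁0, ?_⟩
  have hlogT : Tendsto (fun T : ℕ => Real.log T) atTop atTop :=
    Real.tendsto_log_atTop.comp tendsto_natCast_atTop_atTop
  have hsmall : ∀ᶠ T : ℕ in atTop, c₁ * Real.log T ≤ T := by
    have h1 := (Real.isLittleO_log_id_atTop.comp_tendsto
      (tendsto_natCast_atTop_atTop (R := ℝ))).bound (c := 1 / c₁) (by positivity)
    filter_upwards [h1, hlogT.eventually_ge_atTop 0] with T h2 h3
    simp only [Function.comp_apply, id, Real.norm_eq_abs, Nat.abs_cast, abs_of_nonneg h3] at h2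
    rw [div_mul_eq_mul_div, one_mul, le_div_iff₀ hc₁0] at h2
    linarith
  filter_upwards [hsmall, hlogT.eventually_ge_atTop 1, hlogT.eventually_ge_atTop (Real.log (2 * C)),
    eventually_ge_atTop 1] with T h1 h2 h3 h4
  have hT : (0 : ℝ) < T := by exact_mod_cast h4
  -- Chosen so that `z ^ G ≤ 1 / (2 * C * T)`. The further `log₂ T + 2` in `m` leaves room for the
  -- number `J` of levels.
  set G := ⌈Real.log (2 * C * T) / l⌉₊ with hG
  set m := G + (Nat.log 2 T + 2) with hm
  have hm0 : 0 < m := by omega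
  have hGle : (G : ℝ) ≤ 2 / l * Real.log T + 1 := by
    have h5 : Real.log (2 * C * T) / l ≤ 2 / l * Real.log T := by
      rw [Real.log_mul (by positivity) hT.ne', div_mul_eq_mul_div]
      exact div_le_div_of_nonneg_right (by linarith) hl0.le
    refine (Nat.cast_le.2 (Nat.ceil_mono h5)).trans (Nat.ceil_lt_add_one ?_).le
    have : 0 ≤ Real.log T := by linarith
    positivity
  have hlogle : (Nat.log 2 T : ℝ) ≤ 1 / Real.log 2 * Real.log T := by
    have h5 : (2 : ℝ) ^ (Nat.log 2 T) ≤ T := by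
      exact_mod_cast Nat.pow_log_le_self 2 (by omega)
    have h6 := Real.log_le_log (by positivity) h5
    rw [Real.log_pow] at h6
    rw [div_mul_eq_mul_div, one_mul, le_div_iff₀ hlog2]
    exact h6
  have hmle : (m : ℝ) ≤ c₁ * Real.log T := by
    rw [hm, hc₁]; push_cast
    nlinarith
  have hmT : m ≤ T := by exact_mod_cast hmle.trans h1
  have hex : ∃ J, T ≤ 2 ^ J * m := ⟨T, by
    have := (Nat.lt_two_pow_self (n := T)).le
    nlinarith⟩
  classical
  -- Minimality of `J` gives `2 ^ J * m ≤ 2 * T`, and `2 ^ (J - 1) < T` gives `J ≤ log₂ T + 1`. If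
  -- `J = 0`, the former rests on `m ≤ T` instead.
  have hJ := Nat.find_spec hex
  set J := Nat.find hex with hJdef
  have hprev : J = 0 ∨ (1 ≤ J ∧ 2 ^ (J - 1) * m < T) := by
    rcases Nat.eq_zero_or_pos J with h | h
    · exact Or.inl h
    · exact Or.inr ⟨h, not_le.1 (Nat.find_min hex (by omega))⟩
  refine ⟨m, G, J, hm0, ?_, hJ, ?_, hmle, ?_⟩
  · rcases hprev with h | ⟨h, h'⟩
    · omega
    · have h5 : 2 ^ (J - 1) < T := lt_of_le_of_lt (Nat.le_mul_of_pos_right _ hm0) h'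
      have := Nat.le_log_of_pow_le (by norm_num) h5.le
      omega
  · rcases hprev with h | ⟨h, h'⟩
    · rw [h]; omega
    · have : 2 ^ J = 2 * 2 ^ (J - 1) := by
        rw [← pow_succ', Nat.sub_add_cancel h]
      rw [this, mul_assoc]; omega
  · have h5 : Real.log (2 * C * T) ≤ G * l := (div_le_iff₀ hl0).1 (Nat.le_ceil _)
    have h6 : z ^ G = Real.exp (-(G * l)) := by
      rw [hl, one_div, Real.log_inv, mul_neg, neg_neg, mul_comm, Real.exp_mul, Real.exp_log hz0]
      norm_cast
    have h7 : Real.exp (-(G * l)) ≤ Real.exp (-Real.log (2 * C * T)) :=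
      Real.exp_le_exp.2 (by linarith)
    rw [Real.exp_neg (Real.log _), Real.exp_log (by positivity)] at h7
    rw [h6]
    calc 2 * T * (C * Real.exp (-(G * l))) = 2 * C * T * Real.exp (-(G * l)) := by ring
      _ ≤ 2 * C * T * (2 * C * T)⁻¹ := mul_le_mul_of_nonneg_left h7 (by positivity)
      _ = 1 := mul_inv_cancel₀ (by positivity)

/-! ### Tail bounds from the exponential moment -/

section tail

variable {Ω : Type*} [m0 : MeasurableSpace Ω] {μ : Measure Ω} [IsProbabilityMeasure μ]
  {P Q : ℤ → MeasurableSpace Ω} {C z B v : ℝ}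

/-- Chernoff's bound; the `1` in the exponent is the accumulated mixing remainder `2 * T * (C * z ^
G)`. -/
theorem GeomMixing.measure_sum_ge_le (hmix : GeomMixing μ P Q C z) (hC : 0 ≤ C) (hz0 : 0 < z)
    {X : ℤ → Ω → ℝ} (hXP : ∀ i, StronglyMeasurable[P i] (X i))
    (hXQ : ∀ i, StronglyMeasurable[Q i] (X i)) (hB : 0 ≤ B)
    (hXB : ∀ i ω, |X i ω| ≤ B) (hX0 : ∀ i, ∫ ω, X i ω ∂μ = 0)
    (hXv : ∀ i, ∫ ω, X i ω ^ 2 ∂μ ≤ v) (hv : 0 ≤ v) {m G J T : ℕ} (hm : 0 < m) (hGJ : G + J ≤ m)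
    (hT : T ≤ 2 ^ J * m) (hT' : 2 ^ J * m ≤ 2 * T) (hG : 2 * T * (C * z ^ G) ≤ 1) {lam : ℝ}
    (hlam : 0 ≤ lam) (h1 : 3 * lam * (B * m) ≤ 1)
    (h2 : 2 * (3 * lam * (B * m)) ≤ Real.log (1 / z)) (x : ℝ) :
    μ.real {ω | x ≤ ∑ i ∈ Finset.Ico (0 : ℤ) T, X i ω} ≤
      Real.exp (1 + 18 * (lam ^ 2 * (T * m * v)) - lam * x) := by
  have hLint : Integrable (fun ω => Real.exp (lam * ∑ i ∈ Finset.Ico (0 : ℤ) T, X i ω)) μ := by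
    refine Integrable.of_bound (C := Real.exp (lam * (T * B))) ?_ (ae_of_all _ fun ω => ?_)
    · refine (Real.continuous_exp.comp_stronglyMeasurable (StronglyMeasurable.const_mul
        (?_ : StronglyMeasurable fun ω => ∑ i ∈ Finset.Ico (0 : ℤ) T, X i ω)
        lam)).aestronglyMeasurable
      exact Finset.stronglyMeasurable_fun_sum _ fun i _ => (hXP i).mono (hmix.past_le i)
    · rw [Real.norm_eq_abs, abs_of_pos (Real.exp_pos _)]
      refine Real.exp_le_exp.2 (mul_le_mul_of_nonneg_left ?_ hlam)
      refine (Finset.sum_le_sum fun i _ => (abs_le.1 (hXB i ω)).2).trans (le_of_eq ?_)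
      simp
  have h3 := measure_ge_le_exp_mul_mgf (μ := μ) x hlam hLint
  refine h3.trans ?_
  have h4 := hmix.integral_exp_sum_le hC hz0 hXP hXQ hB hXB hX0 hXv hv hm hGJ hT hT' hlam h1 h2
  refine (mul_le_mul_of_nonneg_left h4 (Real.exp_pos _).le).trans ?_
  rw [← Real.exp_add]
  exact Real.exp_le_exp.2 (by linarith)

/-- Two-sided Bernstein-type inequality for geometrically strongly mixing bounded variables. -/
theorem GeomMixing.measure_abs_sum_ge_le (hmix : GeomMixing μ P Q C z) (hC : 0 ≤ C) (hz0 : 0 < z)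
    {X : ℤ → Ω → ℝ} (hXP : ∀ i, StronglyMeasurable[P i] (X i))
    (hXQ : ∀ i, StronglyMeasurable[Q i] (X i)) (hB : 0 ≤ B)
    (hXB : ∀ i ω, |X i ω| ≤ B) (hX0 : ∀ i, ∫ ω, X i ω ∂μ = 0)
    (hXv : ∀ i, ∫ ω, X i ω ^ 2 ∂μ ≤ v) (hv : 0 ≤ v) {m G J T : ℕ} (hm : 0 < m) (hGJ : G + J ≤ m)
    (hT : T ≤ 2 ^ J * m) (hT' : 2 ^ J * m ≤ 2 * T) (hG : 2 * T * (C * z ^ G) ≤ 1) {lam : ℝ}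
    (hlam : 0 ≤ lam) (h1 : 3 * lam * (B * m) ≤ 1)
    (h2 : 2 * (3 * lam * (B * m)) ≤ Real.log (1 / z)) (x : ℝ) :
    μ.real {ω | x ≤ |∑ i ∈ Finset.Ico (0 : ℤ) T, X i ω|} ≤
      2 * Real.exp (1 + 18 * (lam ^ 2 * (T * m * v)) - lam * x) := by
  have u1 := hmix.measure_sum_ge_le hC hz0 hXP hXQ hB hXB hX0 hXv hv hm hGJ hT hT' hG hlam h1 h2 x
  have u2 := hmix.measure_sum_ge_le (X := fun i ω => -X i ω) hC hz0 (fun i => (hXP i).neg)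
    (fun i => (hXQ i).neg) hB (fun i ω => by rw [abs_neg]; exact hXB i ω)
    (fun i => by rw [integral_neg, hX0, neg_zero]) (fun i => by simpa using hXv i) hv hm hGJ hT hT'
    hG hlam h1 h2 x
  have hsub : {ω | x ≤ |∑ i ∈ Finset.Ico (0 : ℤ) T, X i ω|} ⊆
      {ω | x ≤ ∑ i ∈ Finset.Ico (0 : ℤ) T, X i ω} ∪
        {ω | x ≤ ∑ i ∈ Finset.Ico (0 : ℤ) T, -X i ω} := by
    intro ω hω
    simp only [Set.mem_ofPred_eq, Set.mem_union, Finset.sum_neg_distrib] at hω ⊢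
    exact le_abs.1 hω
  refine (measureReal_mono hsub).trans ((measureReal_union_le _ _).trans ?_)
  linarith

end tail

/-! ### Products of truncated variables -/

theorem exists_max_fin_four (u : Fin 4 → ℝ) : ∃ k, ∀ i, u i ≤ u k := by
  obtain ⟨k, -, hk⟩ := Finset.exists_max_image Finset.univ u Finset.univ_nonempty
  exact ⟨k, fun i => hk i (Finset.mem_univ i)⟩

theorem abs_prod_four_le {u : Fin 4 → ℝ} {b : ℝ} (h : ∀ i, |u i| ≤ b) : |∏ i, u i| ≤ b ^ 4 := by
  rw [Finset.abs_prod]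
  refine (Finset.prod_le_prod (fun i _ => abs_nonneg _) fun i _ => h i).trans (le_of_eq ?_)
  simp

/-- The largest factor to the power 8 splits into `4 - 4 * ε` powers bounded by `τ` (here `ε ≤ 1`
matters) and `4 + 4 * ε` powers controlled by the moment assumption. -/
theorem sq_prod_trunc_le {ε τ : ℝ} (hε0 : 0 < ε) (hε1 : ε ≤ 1) (hτ : 0 < τ) {z z' : Fin 4 → ℝ}
    (h1 : ∀ i, |z' i| ≤ |z i|) (h2 : ∀ i, |z' i| ≤ τ) :
    (∏ i, z' i) ^ 2 ≤ τ ^ (4 - 4 * ε) * ∑ i, |z i| ^ (4 + 4 * ε) := by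
  obtain ⟨k, hk⟩ := exists_max_fin_four fun i => |z' i|
  have h3 : (∏ i, z' i) ^ 2 ≤ |z' k| ^ 8 := by
    rw [← sq_abs]
    refine (pow_le_pow_left₀ (abs_nonneg _) (abs_prod_four_le hk) 2).trans (le_of_eq ?_)
    ring
  have h4 : |z' k| ^ 8 = |z' k| ^ (4 - 4 * ε) * |z' k| ^ (4 + 4 * ε) := by
    rw [← Real.rpow_add_of_nonneg (abs_nonneg _) (by linarith) (by linarith)]
    norm_num
  refine h3.trans (h4 ▸ ?_)
  refine mul_le_mul (Real.rpow_le_rpow (abs_nonneg _) (h2 k) (by linarith)) ?_ (by positivity)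
    (by positivity)
  refine (Real.rpow_le_rpow (abs_nonneg _) (h1 k) (by linarith)).trans ?_
  exact Finset.single_le_sum (f := fun i => |z i| ^ (4 + 4 * ε)) (fun i _ => by positivity)
    (Finset.mem_univ k)

/-- Truncation changes the product only if the largest factor exceeds `τ`; then both products are at
most its fourth power, and `4 * ε` surplus moments are traded for `τ ^ (-(4 * ε))`. -/
theorem abs_prod_sub_prod_trunc_le {ε τ : ℝ} (hε0 : 0 < ε) (hτ : 0 < τ)
    {z z' : Fin 4 → ℝ} (h1 : ∀ i, |z' i| ≤ |z i|) (h3 : ∀ i, |z i| ≤ τ → z' i = z i) :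
    |∏ i, z' i - ∏ i, z i| ≤ 2 * τ ^ (-(4 * ε)) * ∑ i, |z i| ^ (4 + 4 * ε) := by
  have hs : 0 ≤ ∑ i, |z i| ^ (4 + 4 * ε) := Finset.sum_nonneg fun i _ => by positivity
  obtain ⟨k, hk⟩ := exists_max_fin_four fun i => |z i|
  by_cases hz : |z k| ≤ τ
  · have : z' = z := funext fun i => h3 i ((hk i).trans hz)
    rw [this, sub_self, abs_zero]
    positivity
  · rw [not_le] at hz
    have hzk : 0 < |z k| := hτ.trans hz
    have a1 : |∏ i, z' i| ≤ |z k| ^ 4 := abs_prod_four_le fun i => (h1 i).trans (hk i)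
    have a2 : |∏ i, z i| ≤ |z k| ^ 4 := abs_prod_four_le hk
    have a3 : |z k| ^ 4 = |z k| ^ (-(4 * ε)) * |z k| ^ (4 + 4 * ε) := by
      rw [← Real.rpow_add hzk]
      norm_num
    have a4 : |z k| ^ (-(4 * ε)) ≤ τ ^ (-(4 * ε)) :=
      Real.rpow_le_rpow_of_nonpos hτ hz.le (by linarith)
    have a5 : |z k| ^ (4 + 4 * ε) ≤ ∑ i, |z i| ^ (4 + 4 * ε) :=
      Finset.single_le_sum (f := fun i => |z i| ^ (4 + 4 * ε)) (fun i _ => by positivity)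
        (Finset.mem_univ k)
    have a6 : |z k| ^ 4 ≤ τ ^ (-(4 * ε)) * ∑ i, |z i| ^ (4 + 4 * ε) := by
      rw [a3]; exact mul_le_mul a4 a5 (by positivity) (by positivity)
    refine (abs_sub _ _).trans ?_
    linarith

theorem abs_prod_four_le_one_add {ε : ℝ} (hε0 : 0 < ε) (z : Fin 4 → ℝ) :
    |∏ i, z i| ≤ 1 + ∑ i, |z i| ^ (4 + 4 * ε) := by
  obtain ⟨k, hk⟩ := exists_max_fin_four fun i => |z i|
  have a2 : |∏ i, z i| ≤ |z k| ^ 4 := abs_prod_four_le hk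
  have a5 : |z k| ^ (4 + 4 * ε) ≤ ∑ i, |z i| ^ (4 + 4 * ε) :=
    Finset.single_le_sum (f := fun i => |z i| ^ (4 + 4 * ε)) (fun i _ => by positivity)
      (Finset.mem_univ k)
  refine a2.trans ?_
  rcases le_total |z k| 1 with h | h
  · have : |z k| ^ 4 ≤ 1 := pow_le_one₀ (abs_nonneg _) h
    have : 0 ≤ |z k| ^ (4 + 4 * ε) := by positivity
    linarith
  · have : |z k| ^ (4 : ℝ) ≤ |z k| ^ (4 + 4 * ε) :=
      Real.rpow_le_rpow_of_exponent_le h (by linarith)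
    rw [show (4 : ℝ) = ((4 : ℕ) : ℝ) by norm_num, Real.rpow_natCast] at this
    refine (this.trans ?_).trans (a5.trans (le_add_of_nonneg_left zero_le_one))
    norm_num

/-! ### Sample moments of the truncated process -/

section lag

variable {N p : ℕ}

/-- A lagged coordinate of a path, or the constant `1`. -/
def lagVal (path : ℤ → Fin N → ℝ) (t : ℤ) : Option (ℕ × Fin N) → ℝ
  | none => 1
  | some (s, j) => path (t - s) j

/-- A product of four lagged coordinates. -/
def lagProd (path : ℤ → Fin N → ℝ) (t : ℤ) (k : Fin 4 → Option (ℕ × Fin N)) : ℝ :=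
  ∏ i, lagVal path t (k i)

/-- All lags are at most `p`. -/
def LagLE (p : ℕ) (k : Fin 4 → Option (ℕ × Fin N)) : Prop :=
  ∀ i s j, k i = some (s, j) → s ≤ p

theorem abs_sign_mul_min_le_abs (x : ℝ) {τ : ℝ} (hτ : 0 ≤ τ) : |x.sign * min |x| τ| ≤ |x| := by
  rw [abs_mul, abs_of_nonneg (le_min (abs_nonneg x) hτ)]
  have h1 : |x.sign| ≤ 1 := by
    rcases Real.sign_apply_eq x with h | h | h <;> simp [h]
  have h2 : 0 ≤ min |x| τ := le_min (abs_nonneg x) hτ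
  calc |x.sign| * min |x| τ ≤ 1 * min |x| τ := mul_le_mul_of_nonneg_right h1 h2
    _ ≤ |x| := by rw [one_mul]; exact min_le_left _ _

theorem abs_sign_mul_min_le (x : ℝ) {τ : ℝ} (hτ : 0 ≤ τ) : |x.sign * min |x| τ| ≤ τ := by
  rw [abs_mul, abs_of_nonneg (le_min (abs_nonneg x) hτ)]
  have h1 : |x.sign| ≤ 1 := by
    rcases Real.sign_apply_eq x with h | h | h <;> simp [h]
  have h2 : 0 ≤ min |x| τ := le_min (abs_nonneg x) hτ
  calc |x.sign| * min |x| τ ≤ 1 * min |x| τ := mul_le_mul_of_nonneg_right h1 h2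
    _ ≤ τ := by rw [one_mul]; exact min_le_right _ _

theorem sign_mul_min_eq_self {x τ : ℝ} (h : |x| ≤ τ) : x.sign * min |x| τ = x := by
  rw [min_eq_left h]
  rcases lt_trichotomy x 0 with h | h | h
  · rw [Real.sign_of_neg h, abs_of_neg h]; ring
  · simp [h]
  · rw [Real.sign_of_pos h, abs_of_pos h]; ring

theorem measurable_sign_real : Measurable Real.sign := by
  unfold Real.sign
  exact Measurable.ite measurableSet_Iio measurable_const
    (Measurable.ite measurableSet_Ioi measurable_const measurable_const)

theorem abs_lagVal_trunc_le_abs (path : ℤ → Fin N → ℝ) (t : ℤ) {τ : ℝ} (hτ : 0 ≤ τ)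
    (o : Option (ℕ × Fin N)) : |lagVal (trunc τ path) t o| ≤ |lagVal path t o| := by
  rcases o with _ | ⟨s, j⟩
  · exact le_rfl
  · exact abs_sign_mul_min_le_abs _ hτ

/-- The constant regressor is a factor as well, which is why `τ` must be at least `1`. -/
theorem abs_lagVal_trunc_le (path : ℤ → Fin N → ℝ) (t : ℤ) {τ : ℝ} (hτ : 1 ≤ τ)
    (o : Option (ℕ × Fin N)) : |lagVal (trunc τ path) t o| ≤ τ := by
  rcases o with _ | ⟨s, j⟩
  · simpa [lagVal] using hτ
  · exact abs_sign_mul_min_le _ (by linarith)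

theorem lagVal_trunc_eq (path : ℤ → Fin N → ℝ) (t : ℤ) {τ : ℝ} (o : Option (ℕ × Fin N))
    (h : |lagVal path t o| ≤ τ) : lagVal (trunc τ path) t o = lagVal path t o := by
  rcases o with _ | ⟨s, j⟩
  · rfl
  · exact sign_mul_min_eq_self h

variable {Ω : Type*}

theorem measurable_coord_sigmaGen (r : ℤ → Ω → Fin N → ℝ) {S : Set ℤ} {t : ℤ} (ht : t ∈ S)
    (j : Fin N) : Measurable[sigmaGen r S] fun ω => r t ω j := by
  have h1 : Measurable[MeasurableSpace.comap (r t) inferInstance] fun ω => r t ω j :=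
    (measurable_pi_apply j).comp (comap_measurable (r t))
  exact h1.mono (le_iSup₂_of_le t ht le_rfl) le_rfl

theorem measurable_lagProd_trunc (r : ℤ → Ω → Fin N → ℝ) {S : Set ℤ} {t : ℤ}
    {k : Fin 4 → Option (ℕ × Fin N)} (hS : ∀ i s j, k i = some (s, j) → t - (s : ℤ) ∈ S)
    (τ : ℝ) : Measurable[sigmaGen r S] fun ω => lagProd (trunc τ fun s => r s ω) t k := by
  refine Finset.measurable_fun_prod _ fun i _ => ?_
  rcases h : k i with _ | ⟨s, j⟩
  · exact measurable_const
  · have := measurable_coord_sigmaGen r (hS i s j h) j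
    exact (measurable_sign_real.comp this).mul
      ((measurable_norm.comp this).min measurable_const)

theorem measurable_lagProd (r : ℤ → Ω → Fin N → ℝ) {S : Set ℤ} {t : ℤ}
    {k : Fin 4 → Option (ℕ × Fin N)} (hS : ∀ i s j, k i = some (s, j) → t - (s : ℤ) ∈ S) :
    Measurable[sigmaGen r S] fun ω => lagProd (fun s => r s ω) t k := by
  refine Finset.measurable_fun_prod _ fun i _ => ?_
  rcases h : k i with _ | ⟨s, j⟩
  · exact measurable_const
  · exact measurable_coord_sigmaGen r (hS i s j h) j

variable [m0 : MeasurableSpace Ω] {μ : Measure Ω} [IsProbabilityMeasure μ]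
  {r : ℤ → Ω → Fin N → ℝ}

theorem sigmaGen_le (hr : ∀ t, Measurable (r t)) (S : Set ℤ) : sigmaGen r S ≤ m0 :=
  iSup₂_le fun t _ => (hr t).comap_le

omit m0 in
theorem sigmaGen_mono {S S' : Set ℤ} (h : S ⊆ S') : sigmaGen r S ≤ sigmaGen r S' :=
  biSup_mono h

theorem measure_inter_sub_le_alphaCoef {l : ℕ} {t : ℤ} {A B : Set Ω}
    (hA : MeasurableSet[sigmaGen r (Set.Iic t)] A)
    (hB : MeasurableSet[sigmaGen r (Set.Ici (t + l))] B) :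
    μ.real (A ∩ B) - μ.real A * μ.real B ≤ alphaCoef μ r l := by
  refine (le_abs_self _).trans (le_csSup ⟨1, ?_⟩ ⟨t, A, B, hA, hB, rfl⟩)
  rintro x ⟨t, A, B, -, -, rfl⟩
  have h1 : μ.real (A ∩ B) ≤ 1 := measureReal_le_one
  have h2 : μ.real A * μ.real B ≤ 1 :=
    mul_le_one₀ measureReal_le_one measureReal_nonneg measureReal_le_one
  have h3 : 0 ≤ μ.real A * μ.real B := by positivity
  have h4 : 0 ≤ μ.real (A ∩ B) := measureReal_nonneg
  exact abs_le.2 ⟨by linarith, by linarith⟩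

/-- Geometric strong mixing of the functionals of `p + 1` consecutive observations. -/
theorem geomMixing_sigmaGen (hr : ∀ t, Measurable (r t)) {C z : ℝ} (hC : 1 ≤ C) (hz0 : 0 < z)
    (hz1 : z ≤ 1) (hα : ∀ l, alphaCoef μ r l ≤ C * z ^ l) (p : ℕ) :
    GeomMixing μ (fun i => sigmaGen r (Set.Iic (i + 1))) (fun i => sigmaGen r (Set.Ici (i + 1 - p)))
      (C / z ^ p) z where
  past_le _ := sigmaGen_le hr _
  future_le _ := sigmaGen_le hr _
  mono _ _ h := sigmaGen_mono (Set.Iic_subset_Iic.2 (by omega))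
  anti _ _ h := sigmaGen_mono (Set.Ici_subset_Ici.2 (by omega))
  mixing := by
    intro i g A B hA hB
    rcases le_or_gt p g with h | h
    · have hB' : MeasurableSet[sigmaGen r (Set.Ici (i + 1 + (g - p : ℕ)))] B := by
        have e : i + 1 + ((g - p : ℕ) : ℤ) = i + g + 1 - p := by omega
        rw [e]; exact hB
      refine (measure_inter_sub_le_alphaCoef hA hB').trans ((hα _).trans (le_of_eq ?_))
      rw [div_mul_eq_mul_div, eq_div_iff (by positivity), mul_assoc, ← pow_add,
        Nat.sub_add_cancel h]
    -- At distance less than `p` the observation windows overlap; the factor `1 / z ^ p` makes the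
    -- claimed bound at least `1`.
    · have h1 : μ.real (A ∩ B) ≤ 1 := measureReal_le_one
      have h3 : 0 ≤ μ.real A * μ.real B := by positivity
      have h4 : (1 : ℝ) ≤ C / z ^ p * z ^ g := by
        rw [div_mul_eq_mul_div, le_div_iff₀ (by positivity), one_mul]
        have h5 : z ^ p ≤ z ^ g := pow_le_pow_of_le_one hz0.le hz1 h.le
        have : 0 < z ^ g := by positivity
        nlinarith
      linarith

theorem lagVal_moment {q Mom : ℝ} (hmom : MomentBound μ r q Mom) (t : ℤ)
    (o : Option (ℕ × Fin N)) :
    Integrable (fun ω => |lagVal (fun s => r s ω) t o| ^ q) μ ∧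
      ∫ ω, |lagVal (fun s => r s ω) t o| ^ q ∂μ ≤ max Mom 1 := by
  rcases o with _ | ⟨s, j⟩
  · simp [lagVal]
  · exact ⟨(hmom (t - s) j).1, (hmom (t - s) j).2.trans (le_max_left _ _)⟩

theorem sum_lagVal_moment {q Mom : ℝ} (hmom : MomentBound μ r q Mom) (t : ℤ)
    (k : Fin 4 → Option (ℕ × Fin N)) :
    Integrable (fun ω => ∑ i, |lagVal (fun s => r s ω) t (k i)| ^ q) μ ∧
      ∫ ω, ∑ i, |lagVal (fun s => r s ω) t (k i)| ^ q ∂μ ≤ 4 * max Mom 1 := by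
  refine ⟨integrable_finsetSum _ fun i _ => (lagVal_moment hmom t (k i)).1, ?_⟩
  rw [integral_finsetSum _ fun i _ => (lagVal_moment hmom t (k i)).1]
  refine (Finset.sum_le_sum fun i _ => (lagVal_moment hmom t (k i)).2).trans (le_of_eq ?_)
  simp

theorem measurable_lagProd' (hr : ∀ t, Measurable (r t)) (t : ℤ)
    (k : Fin 4 → Option (ℕ × Fin N)) : Measurable fun ω => lagProd (fun s => r s ω) t k :=
  (measurable_lagProd r (S := Set.univ) fun _ _ _ _ => Set.mem_univ _).mono
    (sigmaGen_le hr _) le_rfl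

theorem measurable_lagProd_trunc' (hr : ∀ t, Measurable (r t)) (t : ℤ)
    (k : Fin 4 → Option (ℕ × Fin N)) (τ : ℝ) :
    Measurable fun ω => lagProd (trunc τ fun s => r s ω) t k :=
  (measurable_lagProd_trunc r (S := Set.univ) (fun _ _ _ _ => Set.mem_univ _) τ).mono
    (sigmaGen_le hr _) le_rfl

theorem integrable_lagProd (hr : ∀ t, Measurable (r t)) {ε Mom : ℝ} (hε0 : 0 < ε)
    (hmom : MomentBound μ r (4 + 4 * ε) Mom) (t : ℤ) (k : Fin 4 → Option (ℕ × Fin N)) :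
    Integrable (fun ω => lagProd (fun s => r s ω) t k) μ := by
  refine Integrable.mono' ((integrable_const (1 : ℝ)).add (sum_lagVal_moment hmom t k).1)
    (measurable_lagProd' hr t k).aestronglyMeasurable (ae_of_all _ fun ω => ?_)
  exact abs_prod_four_le_one_add hε0 _

theorem integrable_lagProd_trunc (hr : ∀ t, Measurable (r t)) {τ : ℝ} (hτ : 1 ≤ τ) (t : ℤ)
    (k : Fin 4 → Option (ℕ × Fin N)) :
    Integrable (fun ω => lagProd (trunc τ fun s => r s ω) t k) μ :=
  Integrable.of_bound (measurable_lagProd_trunc' hr t k τ).aestronglyMeasurable (τ ^ 4)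
    (ae_of_all _ fun _ => abs_prod_four_le fun i => abs_lagVal_trunc_le _ t hτ (k i))

theorem abs_integral_lagProd_trunc_sub_le (hr : ∀ t, Measurable (r t)) {ε Mom : ℝ} (hε0 : 0 < ε)
    (hmom : MomentBound μ r (4 + 4 * ε) Mom) {τ : ℝ} (hτ : 1 ≤ τ) (t : ℤ)
    (k : Fin 4 → Option (ℕ × Fin N)) :
    |∫ ω, lagProd (trunc τ fun s => r s ω) t k ∂μ - ∫ ω, lagProd (fun s => r s ω) t k ∂μ| ≤
      8 * max Mom 1 * τ ^ (-(4 * ε)) := by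
  have hτ0 : 0 < τ := by linarith
  rw [← integral_sub (integrable_lagProd_trunc hr hτ t k) (integrable_lagProd hr hε0 hmom t k)]
  refine abs_integral_le_integral_abs.trans ?_
  have h1 := integral_mono
    ((integrable_lagProd_trunc hr hτ t k).sub (integrable_lagProd hr hε0 hmom t k)).abs
    ((sum_lagVal_moment hmom t k).1.const_mul (2 * τ ^ (-(4 * ε))))
    (fun ω => abs_prod_sub_prod_trunc_le hε0 hτ0
      (fun i => abs_lagVal_trunc_le_abs (fun s => r s ω) t hτ0.le (k i))
      (fun i => lagVal_trunc_eq (fun s => r s ω) t (k i)))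
  refine h1.trans ?_
  rw [integral_const_mul]
  have h2 := mul_le_mul_of_nonneg_left (sum_lagVal_moment hmom t k).2
    (by positivity : 0 ≤ 2 * τ ^ (-(4 * ε)))
  linarith

theorem integral_sq_lagProd_trunc_le (hr : ∀ t, Measurable (r t)) {ε Mom : ℝ} (hε0 : 0 < ε)
    (hε1 : ε ≤ 1) (hmom : MomentBound μ r (4 + 4 * ε) Mom) {τ : ℝ} (hτ : 1 ≤ τ) (t : ℤ)
    (k : Fin 4 → Option (ℕ × Fin N)) :
    ∫ ω, lagProd (trunc τ fun s => r s ω) t k ^ 2 ∂μ ≤ 4 * max Mom 1 * τ ^ (4 - 4 * ε) := by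
  have hτ0 : 0 < τ := by linarith
  have hi : Integrable (fun ω => lagProd (trunc τ fun s => r s ω) t k ^ 2) μ :=
    Integrable.of_bound ((measurable_lagProd_trunc' hr t k τ).pow_const 2).aestronglyMeasurable
      ((τ ^ 4) ^ 2) (ae_of_all _ fun ω => by
        rw [Real.norm_eq_abs, abs_pow]
        exact pow_le_pow_left₀ (abs_nonneg _)
          (abs_prod_four_le fun i => abs_lagVal_trunc_le _ t hτ (k i)) 2)
  have h1 := integral_mono hi ((sum_lagVal_moment hmom t k).1.const_mul (τ ^ (4 - 4 * ε)))
    (fun ω => sq_prod_trunc_le hε0 hε1 hτ0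
      (fun i => abs_lagVal_trunc_le_abs (fun s => r s ω) t hτ0.le (k i))
      (fun i => abs_lagVal_trunc_le (fun s => r s ω) t hτ (k i)))
  refine h1.trans ?_
  rw [integral_const_mul]
  have h2 := mul_le_mul_of_nonneg_left (sum_lagVal_moment hmom t k).2
    (by positivity : 0 ≤ τ ^ (4 - 4 * ε))
  linarith

omit [IsProbabilityMeasure μ] in
theorem StrictlyStationary.integral_comp {E : Type*} [NormedAddCommGroup E] [NormedSpace ℝ E]
    [MeasurableSpace E] [BorelSpace E]
    (hs : StrictlyStationary μ r) (h : ℤ) {f : (ℤ → Fin N → ℝ) → E} (hf : Measurable f) :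
    ∫ ω, f (fun t => r (t + h) ω) ∂μ = ∫ ω, f (fun t => r t ω) ∂μ :=
  ((hs h).comp hf).integral_eq

theorem lagProd_shift (path : ℤ → Fin N → ℝ) (t : ℤ) (k : Fin 4 → Option (ℕ × Fin N)) :
    lagProd (fun s => path (s + t)) 0 k = lagProd path t k := by
  refine Finset.prod_congr rfl fun i _ => ?_
  rcases k i with _ | ⟨s, j⟩
  · rfl
  · simp only [lagVal]; congr 1; ring

omit [IsProbabilityMeasure μ] in
theorem StrictlyStationary.integral_lagProd (hs : StrictlyStationary μ r) (t : ℤ)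
    (k : Fin 4 → Option (ℕ × Fin N)) :
    ∫ ω, lagProd (fun s => r s ω) t k ∂μ = ∫ ω, lagProd (fun s => r s ω) 0 k ∂μ := by
  have hf : Measurable fun path : ℤ → Fin N → ℝ => lagProd path 0 k := by
    refine Finset.measurable_fun_prod _ fun i _ => ?_
    rcases k i with _ | ⟨s, j⟩
    · exact measurable_const
    · exact (measurable_pi_apply j).comp (measurable_pi_apply _)
  rw [← hs.integral_comp t hf]
  refine integral_congr_ae (ae_of_all _ fun ω => ?_)
  exact (lagProd_shift (fun s => r s ω) t k).symm

/-- Deviation inequality for a sample moment of the truncated process. -/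
theorem measure_sampleMoment_le (hr : ∀ t, Measurable (r t)) {ε Mom : ℝ} (hε0 : 0 < ε)
    (hε1 : ε ≤ 1) (hmom : MomentBound μ r (4 + 4 * ε) Mom) (hs : StrictlyStationary μ r)
    {C z : ℝ} (hC : 1 ≤ C) (hz0 : 0 < z) (hz1 : z ≤ 1) (hα : ∀ l, alphaCoef μ r l ≤ C * z ^ l)
    {m G J T : ℕ} (hm : 0 < m) (hGJ : G + J ≤ m) (hT0 : 0 < T)
    (hT : T ≤ 2 ^ J * m) (hT' : 2 ^ J * m ≤ 2 * T) (hG : 2 * T * (C / z ^ p * z ^ G) ≤ 1)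
    {τ : ℝ} (hτ : 1 ≤ τ) {lam : ℝ} (hlam : 0 ≤ lam) (h1 : 3 * lam * (2 * τ ^ 4 * m) ≤ 1)
    (h2 : 2 * (3 * lam * (2 * τ ^ 4 * m)) ≤ Real.log (1 / z)) (x : ℝ)
    {k : Fin 4 → Option (ℕ × Fin N)} (hk : LagLE p k) :
    μ.real {ω | x + 8 * max Mom 1 * τ ^ (-(4 * ε)) ≤
        |(1 / T : ℝ) * ∑ t : Fin T, lagProd (trunc τ fun s => r s ω) (((t : ℕ) : ℤ) + 1) k -
          ∫ ω, lagProd (fun s => r s ω) 0 k ∂μ|} ≤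
      2 * Real.exp (1 + 18 * (lam ^ 2 * (T * m * (4 * max Mom 1 * τ ^ (4 - 4 * ε)))) -
        lam * (x * T)) := by
  have hTr : (0 : ℝ) < T := by exact_mod_cast hT0
  set b := 8 * max Mom 1 * τ ^ (-(4 * ε))
  -- Index `i` stands for time `i + 1`, as in the σ-algebras of `geomMixing_sigmaGen`, so that `0 ≤
  -- i < T` runs over the sample.
  set e : ℤ → ℝ := fun i => ∫ ω, lagProd (trunc τ fun s => r s ω) (i + 1) k ∂μ with he
  set X : ℤ → Ω → ℝ := fun i ω => lagProd (trunc τ fun s => r s ω) (i + 1) k - e i with hX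
  have hbd : ∀ t ω, |lagProd (trunc τ fun s => r s ω) t k| ≤ τ ^ 4 := fun t ω =>
    abs_prod_four_le fun i => abs_lagVal_trunc_le _ t hτ (k i)
  have hint : ∀ t, Integrable (fun ω => lagProd (trunc τ fun s => r s ω) t k) μ := fun t =>
    integrable_lagProd_trunc hr hτ t k
  have hmix := geomMixing_sigmaGen hr hC hz0 hz1 hα p
  have hmain := hmix.measure_abs_sum_ge_le (X := X) (B := 2 * τ ^ 4)
    (v := 4 * max Mom 1 * τ ^ (4 - 4 * ε)) (by positivity) hz0
    (fun i => ((measurable_lagProd_trunc r (fun a s j h => by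
        simp only [Set.mem_Iic]; omega) τ).sub_const _).stronglyMeasurable)
    (fun i => ((measurable_lagProd_trunc r (fun a s j h => by
        have := hk a s j h
        simp only [Set.mem_Ici]; omega) τ).sub_const _).stronglyMeasurable)
    (by positivity)
    (fun i ω => by
      have h4 : |e i| ≤ τ ^ 4 := by
        refine abs_integral_le_integral_abs.trans ?_
        refine (integral_mono (hint _).abs (integrable_const (τ ^ 4)) fun ω => hbd _ ω).trans ?_
        simp
      refine (abs_sub _ _).trans ?_
      have := hbd (i + 1) ω
      linarith)
    (fun i => by
      simp only [hX]
      rw [integral_sub (hint _) (integrable_const _)]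
      simp [he])
    (fun i => by
      have h5 : ∫ ω, X i ω ^ 2 ∂μ =
          ∫ ω, lagProd (trunc τ fun s => r s ω) (i + 1) k ^ 2 ∂μ - e i ^ 2 := by
        have hi2 : Integrable (fun ω => lagProd (trunc τ fun s => r s ω) (i + 1) k ^ 2) μ :=
          Integrable.of_bound
            ((measurable_lagProd_trunc' hr _ k τ).pow_const 2).aestronglyMeasurable
            ((τ ^ 4) ^ 2) (ae_of_all _ fun ω => by
              rw [Real.norm_eq_abs, abs_pow]
              exact pow_le_pow_left₀ (abs_nonneg _) (hbd _ ω) 2)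
        have e1 : ∀ ω, X i ω ^ 2 = lagProd (trunc τ fun s => r s ω) (i + 1) k ^ 2 -
            (2 * e i * lagProd (trunc τ fun s => r s ω) (i + 1) k - e i ^ 2) := fun ω => by
          simp only [hX]; ring
        simp only [e1]
        have hi3 : Integrable (fun ω =>
            2 * e i * lagProd (trunc τ fun s => r s ω) (i + 1) k - e i ^ 2) μ :=
          ((hint _).const_mul _).sub (integrable_const _)
        rw [integral_sub hi2 hi3,
          integral_sub ((hint _).const_mul _) (integrable_const _), integral_const_mul]
        simp [he]
        ring
      have h6 := integral_sq_lagProd_trunc_le hr hε0 hε1 hmom hτ (i + 1) k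
      rw [h5]
      nlinarith [sq_nonneg (e i)])
    (by positivity) hm hGJ hT hT' hG hlam h1 h2 (x * T)
  refine (measureReal_mono ?_).trans hmain
  intro ω hω
  simp only [Set.mem_ofPred_eq] at hω ⊢
  set E := ∫ ω, lagProd (fun s => r s ω) 0 k ∂μ
  have hconv : ∑ t : Fin T, lagProd (trunc τ fun s => r s ω) (((t : ℕ) : ℤ) + 1) k =
      ∑ i ∈ Finset.Ico (0 : ℤ) T, lagProd (trunc τ fun s => r s ω) (i + 1) k := by
    rw [Fin.sum_univ_eq_sum_range
      (fun t : ℕ => lagProd (trunc τ fun s => r s ω) ((t : ℤ) + 1) k) T]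
    refine Finset.sum_nbij (fun t : ℕ => (t : ℤ)) ?_ ?_ ?_ ?_
    · intro a ha
      have := Finset.mem_range.1 ha
      exact Finset.mem_Ico.2 ⟨by omega, by omega⟩
    · intro a _ b _ h
      exact Int.ofNat_inj.1 h
    · intro a ha
      have := Finset.mem_Ico.1 ha
      exact ⟨a.toNat, by simp; omega, by simp; omega⟩
    · intro a _; rfl
  rw [hconv] at hω
  have hsum : (1 / T : ℝ) * ∑ i ∈ Finset.Ico (0 : ℤ) T, lagProd (trunc τ fun s => r s ω) (i + 1) k
      - E = (1 / T : ℝ) * ∑ i ∈ Finset.Ico (0 : ℤ) T, X i ω +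
        (1 / T : ℝ) * ∑ i ∈ Finset.Ico (0 : ℤ) T, (e i - E) := by
    simp only [hX, Finset.sum_sub_distrib, Finset.sum_const, Int.card_Ico]
    have : ((T : ℤ) - 0).toNat = T := by simp
    rw [this, nsmul_eq_mul]
    field_simp
    ring
  -- Stationarity makes `E`, taken at time `0`, the common mean of the untruncated products, so
  -- every summand is a pure truncation bias.
  have hbias : |(1 / T : ℝ) * ∑ i ∈ Finset.Ico (0 : ℤ) T, (e i - E)| ≤ b := by
    rw [abs_mul, abs_of_pos (by positivity : (0 : ℝ) < 1 / T), one_div, inv_mul_le_iff₀ hTr]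
    refine (Finset.abs_sum_le_sum_abs _ _).trans ?_
    refine (Finset.sum_le_sum fun i _ => ?_ : _ ≤ ∑ i ∈ Finset.Ico (0 : ℤ) T, b).trans
      (le_of_eq (by simp))
    have := abs_integral_lagProd_trunc_sub_le hr hε0 hmom hτ (i + 1) k
    rwa [hs.integral_lagProd] at this
  rw [hsum] at hω
  have h7 := hω.trans (abs_add_le _ _)
  have h8 : x ≤ |(1 / T : ℝ) * ∑ i ∈ Finset.Ico (0 : ℤ) T, X i ω| := by linarith
  rw [abs_mul, abs_of_pos (by positivity : (0 : ℝ) < 1 / T), one_div, le_inv_mul_iff₀ hTr] at h8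
  linarith

end lag

/-! ### The coefficient matrices -/

section algebra

variable {N p : ℕ}

theorem vechIdx_self (q : VechIdx N) : vechIdx q.1.1 q.1.2 = q := by
  obtain ⟨⟨u, v⟩, h⟩ := q
  simp only [vechIdx, Subtype.mk.injEq, Prod.mk.injEq]
  exact ⟨min_eq_left h, max_eq_right h⟩

theorem vechIdx_val_eq_or (a : Fin N × Fin N) :
    (vechIdx a.1 a.2).1 = a ∨ (vechIdx a.1 a.2).1 = a.swap := by
  obtain ⟨u, v⟩ := a
  rcases le_total u v with h | h
  · left; simp [vechIdx, h]
  · right; simp [vechIdx, h]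

/-- Invariance under the simultaneous swap of the row pair and of the column pair. -/
def SwapInvariant (M : Matrix (Fin N × Fin N) (Fin N × Fin N) ℝ) : Prop :=
  ∀ a b, M a.swap b.swap = M a b

theorem SwapInvariant.swap_left {M : Matrix (Fin N × Fin N) (Fin N × Fin N) ℝ}
    (hM : SwapInvariant M) (a b : Fin N × Fin N) : M a.swap b = M a b.swap := by
  rw [← hM a b.swap, Prod.swap_swap]

theorem SwapInvariant.mul_dupMat_swap {M : Matrix (Fin N × Fin N) (Fin N × Fin N) ℝ}
    (hM : SwapInvariant M) (a : Fin N × Fin N) (q : VechIdx N) :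
    (M * dupMat N) a.swap q = (M * dupMat N) a q := by
  simp only [Matrix.mul_apply]
  refine Fintype.sum_equiv (Equiv.prodComm _ _) _ _ fun b => ?_
  rw [hM.swap_left]
  simp [dupMat, vechIdx_comm b.2 b.1]

theorem dupMat_mul_apply {n : Type*} (Φ : Matrix (VechIdx N) n ℝ) (a : Fin N × Fin N) (q : n) :
    (dupMat N * Φ) a q = Φ (vechIdx a.1 a.2) q := by
  simp [Matrix.mul_apply, dupMat]

/-- Full column rank: the row of the duplication matrix at the ordered pair `q.1` reads off the
coordinate `q`. -/
theorem isUnit_dupMat_gram : IsUnit ((dupMat N)ᵀ * dupMat N) := by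
  have h : ((dupMat N)ᴴ * dupMat N).PosDef := by
    refine Matrix.PosDef.conjTranspose_mul_self _ ?_
    intro v w hvw
    funext q
    have := congrFun hvw q.1
    simpa [Matrix.mulVec, dotProduct, dupMat, vechIdx_self] using this
  rw [Matrix.conjTranspose_eq_transpose_of_trivial] at h
  exact h.isUnit

/-- Swap invariance puts the columns of `M * dupMat N` in the range of the duplication matrix, on
which the elimination matrix is a left inverse. No explicit inverse of the Gram matrix is needed. -/
theorem SwapInvariant.elimMat_mul_dupMat {M : Matrix (Fin N × Fin N) (Fin N × Fin N) ℝ}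
    (hM : SwapInvariant M) (q q' : VechIdx N) :
    (elimMat N * M * dupMat N) q q' = (M * dupMat N) q.1 q' := by
  set Φ : Matrix (VechIdx N) (VechIdx N) ℝ := Matrix.of fun q q' => (M * dupMat N) q.1 q' with hΦ
  have h : M * dupMat N = dupMat N * Φ := by
    ext a q
    rw [dupMat_mul_apply, hΦ, Matrix.of_apply]
    rcases vechIdx_val_eq_or a with h | h <;> rw [h]
    exact (hM.mul_dupMat_swap a q).symm
  have h2 : elimMat N * M * dupMat N = Φ := by
    rw [Matrix.mul_assoc, h, elimMat, ← Matrix.mul_assoc, Matrix.mul_assoc _ (dupMat N)ᵀ,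
      Matrix.nonsing_inv_mul _ ((Matrix.isUnit_iff_isUnit_det _).1 isUnit_dupMat_gram),
      Matrix.one_mul]
  rw [h2]; rfl

/-- The matrix `∑ₖ A_{ik} ⊗ A_{ik}`. -/
def Param.kronSum (θ : Param N p) (i : Fin p) : Matrix (Fin N × Fin N) (Fin N × Fin N) ℝ :=
  ∑ k ∈ Finset.Icc 1 (θ.K i), θ.A i k ⊗ₖ θ.A i k

theorem Param.kronSum_apply (θ : Param N p) (i : Fin p) (a b : Fin N × Fin N) :
    θ.kronSum i a b = ∑ k ∈ Finset.Icc 1 (θ.K i), θ.A i k a.1 b.1 * θ.A i k a.2 b.2 := by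
  simp [Param.kronSum, Matrix.sum_apply, Matrix.kroneckerMap_apply]

theorem Param.kronSum_swapInvariant (θ : Param N p) (i : Fin p) :
    SwapInvariant (θ.kronSum i) := by
  intro a b
  simp only [Param.kronSum_apply, Prod.fst_swap, Prod.snd_swap]
  exact Finset.sum_congr rfl fun k _ => mul_comm _ _

theorem Param.Phi_apply (θ : Param N p) (i : Fin p) (q q' : VechIdx N) :
    θ.Phi i q q' = ∑ b : Fin N × Fin N, if vechIdx b.1 b.2 = q' then θ.kronSum i q.1 b else 0 := by
  rw [Param.Phi, ← Param.kronSum, (θ.kronSum_swapInvariant i).elimMat_mul_dupMat,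
    Matrix.mul_apply]
  simp [dupMat]

theorem vechIdx_eq_iff (a b : Fin N × Fin N) :
    vechIdx a.1 a.2 = vechIdx b.1 b.2 ↔ a = b ∨ a = b.swap := by
  constructor
  · intro h
    have h' : (vechIdx a.1 a.2).1 = (vechIdx b.1 b.2).1 := congrArg Subtype.val h
    rcases vechIdx_val_eq_or a with h1 | h1 <;> rcases vechIdx_val_eq_or b with h2 | h2 <;>
      rw [h1, h2] at h'
    · exact Or.inl h'
    · exact Or.inr h'
    · right; rw [← h', Prod.swap_swap]
    · left; exact Prod.swap_injective h'
  · rintro (rfl | rfl)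
    · rfl
    · exact vechIdx_comm _ _

/-- A diagonal column pair has one preimage among the `N ^ 2` positions and an off-diagonal one has
two. This merging of two entries is what the padding operator undoes. -/
theorem Param.Phi_vechIdx_diag (θ : Param N p) (i : Fin p) (a b : Fin N × Fin N)
    (hb : b.1 = b.2) : θ.Phi i (vechIdx a.1 a.2) (vechIdx b.1 b.2) = θ.kronSum i a b := by
  have hbs : b.swap = b := Prod.ext hb.symm hb
  rw [Param.Phi_apply]
  simp only [vechIdx_eq_iff, hbs, or_self]
  rw [Finset.sum_ite_eq' Finset.univ b, if_pos (Finset.mem_univ _)]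
  rcases vechIdx_val_eq_or a with h | h <;> rw [h]
  rw [(θ.kronSum_swapInvariant i).swap_left, hbs]

theorem Param.Phi_vechIdx_offDiag (θ : Param N p) (i : Fin p) (a b : Fin N × Fin N)
    (hb : b.1 ≠ b.2) :
    θ.Phi i (vechIdx a.1 a.2) (vechIdx b.1 b.2) =
      θ.kronSum i a b + θ.kronSum i a b.swap := by
  have hne : b ≠ b.swap := fun h => hb (congrArg Prod.fst h)
  rw [Param.Phi_apply]
  simp only [vechIdx_eq_iff]
  rw [← Finset.sum_filter]
  have : Finset.univ.filter (fun c : Fin N × Fin N => c = b ∨ c = b.swap) = {b, b.swap} := by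
    ext c; simp
  rw [this, Finset.sum_pair hne]
  rcases vechIdx_val_eq_or a with h | h <;> rw [h]
  rw [(θ.kronSum_swapInvariant i).swap_left, (θ.kronSum_swapInvariant i).swap_left,
    Prod.swap_swap, add_comm]

/-- The padding of `Φ_i` with the true auxiliary matrix is `∑ₖ A_{ik} ⊗ A_{ik}`. -/
theorem Param.padding_Phi_auxW (θ : Param N p) (i : Fin p) :
    padding (θ.Phi i) (θ.auxW i) = θ.kronSum i := by
  have hsw := θ.kronSum_swapInvariant i
  have haux : ∀ (a b : Fin N × Fin N) (ha : a.1 ≠ a.2) (hb : b.1 ≠ b.2),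
      θ.auxW i (strictIdx b.1 b.2 hb) (strictIdx a.1 a.2 ha) =
        θ.kronSum i (vechIdx a.1 a.2).1 (vechIdx b.1 b.2).1 := by
    intro a b ha hb
    rw [Param.kronSum_apply]; rfl
  ext a b
  simp only [padding, Matrix.of_apply]
  split_ifs with ha hb hb hab
  · exact θ.Phi_vechIdx_diag i a b hb
  -- On a diagonal row the two merged entries coincide, so halving recovers each.
  · rw [θ.Phi_vechIdx_offDiag i a b hb, ← hsw.swap_left, show a.swap = a from Prod.ext ha.symm ha]
    ring
  · exact θ.Phi_vechIdx_diag i a b hb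
  · rw [haux]
    rcases lt_or_gt_of_ne ha with h1 | h1
    · have h2 := hab.1 h1
      simp [vechIdx, h1.le, h2.le]
    · have h2 : b.2 < b.1 := lt_of_le_of_ne (not_lt.1 fun h => absurd (hab.2 h) h1.not_gt)
        (Ne.symm hb)
      simp only [vechIdx, min_eq_right h1.le, max_eq_left h1.le, min_eq_right h2.le,
        max_eq_left h2.le]
      exact hsw a b
  · rw [haux, θ.Phi_vechIdx_offDiag i a b hb]
    -- The auxiliary matrix stores the entry at the sorted pairs. Here exactly one of the pairs has
    -- to be sorted, so up to a simultaneous swap this is the entry with the column pair reversed.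
    have key : θ.kronSum i (vechIdx a.1 a.2).1 (vechIdx b.1 b.2).1 = θ.kronSum i a b.swap := by
      rcases lt_or_gt_of_ne ha with h1 | h1
      · have h2 : b.2 < b.1 := lt_of_le_of_ne
          (not_lt.1 fun h => hab ⟨fun _ => h, fun _ => h1⟩) (Ne.symm hb)
        simp only [vechIdx, min_eq_left h1.le, max_eq_right h1.le, min_eq_right h2.le,
          max_eq_left h2.le]
        rfl
      · have h2 : b.1 < b.2 := by
          by_contra h
          exact hab ⟨fun h' => absurd h' h1.not_gt, fun h' => absurd h' h⟩
        simp only [vechIdx, min_eq_right h1.le, max_eq_left h1.le, min_eq_left h2.le,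
          max_eq_right h2.le]
        exact hsw.swap_left a b
    rw [key]; ring

theorem Param.rearr_padding_apply (θ : Param N p) (i : Fin p) (a b : Fin N × Fin N) :
    rearr (padding (θ.Phi i) (θ.auxW i)) a b =
      ∑ k ∈ Finset.Icc 1 (θ.K i), θ.A i k a.1 a.2 * θ.A i k b.1 b.2 := by
  rw [θ.padding_Phi_auxW]
  simp only [rearr, Matrix.of_apply, Param.kronSum_apply]

theorem Param.sum_Phi_mul (θ : Param N p) (i : Fin p) (q : VechIdx N) (y : VechIdx N → ℝ) :
    ∑ q', θ.Phi i q q' * y q' =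
      ∑ b : Fin N × Fin N, θ.kronSum i q.1 b * y (vechIdx b.1 b.2) := by
  simp only [Param.Phi_apply, Finset.sum_mul]
  rw [Finset.sum_comm]
  refine Finset.sum_congr rfl fun b _ => ?_
  simp

theorem yVec_vechIdx (path : ℤ → Fin N → ℝ) (t : ℤ) (b : Fin N × Fin N) :
    yVec path t (vechIdx b.1 b.2) = path t b.1 * path t b.2 := by
  have : ∀ q : VechIdx N, yVec path t q = path t q.1.2 * path t q.1.1 := fun q => rfl
  rw [this]
  rcases vechIdx_val_eq_or b with h | h <;> rw [h]
  · ring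
  · rfl

/-- The conditional covariance is quadratic in the lagged returns, hence linear in their products;
this is the source of the linear regression of `y_t` on `x_t`. -/
theorem Param.Sig_eq (θ : Param N p) (path : ℤ → Fin N → ℝ) (t : ℤ) (q : VechIdx N) :
    θ.Sig path t q.1.2 q.1.1 = ∑ b, xVec p path t b * θ.Theta b q := by
  rw [Fintype.sum_option]
  simp only [xVec, Param.Theta, Matrix.of_apply, one_mul, vech, Param.Sig, Matrix.add_apply]
  congr 1
  rw [Fintype.sum_prod_type, Matrix.sum_apply]
  refine Finset.sum_congr rfl fun i _ => ?_
  have h1 : ∀ q', yVec path (t - ((i : ℕ) + 1)) q' * θ.Phi i q q' =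
      θ.Phi i q q' * yVec path (t - ((i : ℕ) + 1)) q' := fun q' => mul_comm _ _
  simp only [h1]
  rw [θ.sum_Phi_mul i q, Matrix.sum_apply]
  simp only [yVec_vechIdx, Param.kronSum_apply, Finset.sum_mul]
  rw [Finset.sum_comm]
  refine Finset.sum_congr rfl fun k _ => ?_
  simp only [Matrix.mul_apply, Matrix.vecMulVec_apply, Matrix.transpose_apply, Finset.sum_mul]
  rw [Fintype.sum_prod_type]
  refine Finset.sum_congr rfl fun x _ => Finset.sum_congr rfl fun y _ => ?_
  ring

/-! ### Size of the signal against the coefficient norm -/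

theorem frob_sq {m n : Type*} [Fintype m] [Fintype n] (M : Matrix m n ℝ) :
    frob M ^ 2 = ∑ i, ∑ j, M i j ^ 2 :=
  Real.sq_sqrt (Finset.sum_nonneg fun _ _ => Finset.sum_nonneg fun _ _ => sq_nonneg _)

theorem frob_nonneg {m n : Type*} [Fintype m] [Fintype n] (M : Matrix m n ℝ) : 0 ≤ frob M :=
  Real.sqrt_nonneg _

theorem sum_abs_le_norm1Inf {m n : Type*} [Fintype m] [Finite n] (M : Matrix m n ℝ) (j : n) :
    ∑ i, |M i j| ≤ norm1Inf M :=
  le_ciSup (f := fun j => ∑ i, |M i j|) (Set.finite_range _).bddAbove j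

/-- In the column of `Θ` for the pair `(u, u)`, the entry at `(x, x)` is `∑ₖ A_{ik}(u, x) ^ 2`: a
sum of squares, so components cannot cancel. Hence each row of `A_{ik}` has squared norm at most the
column norm, and there are `N` rows. -/
theorem frob_sq_le_norm1Inf (θ : Param N p) (i : Fin p) {k : ℕ} (hk1 : 1 ≤ k) (hk : k ≤ θ.K i) :
    frob (θ.A i k) ^ 2 ≤ N * norm1Inf θ.Theta := by
  rw [frob_sq]
  refine (Finset.sum_le_sum fun u _ => ?_ : _ ≤ ∑ u : Fin N, norm1Inf θ.Theta).trans
    (le_of_eq (by simp))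
  refine le_trans ?_ (sum_abs_le_norm1Inf θ.Theta (vechIdx u u))
  have h1 : ∀ x, θ.A i k u x ^ 2 ≤ |θ.Theta (some (i, vechIdx x x)) (vechIdx u u)| := by
    intro x
    have h2 : θ.Theta (some (i, vechIdx x x)) (vechIdx u u) = θ.kronSum i (u, u) (x, x) :=
      θ.Phi_vechIdx_diag i (u, u) (x, x) rfl
    rw [h2, Param.kronSum_apply]
    refine le_trans ?_ (le_abs_self _)
    rw [sq]
    exact Finset.single_le_sum (f := fun k => θ.A i k u x * θ.A i k u x)
      (fun k _ => mul_self_nonneg _) (Finset.mem_Icc.2 ⟨hk1, hk⟩)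
  refine (Finset.sum_le_sum fun x _ => h1 x).trans ?_
  have hinj : Function.Injective fun x : Fin N => (some (i, vechIdx x x) : RegIdx N p) := by
    intro x y h
    simpa [vechIdx] using h
  rw [← Finset.sum_image (f := fun b => |θ.Theta b (vechIdx u u)|)
    (g := fun x : Fin N => (some (i, vechIdx x x) : RegIdx N p)) (fun x _ y _ h => hinj h)]
  exact Finset.sum_le_sum_of_subset_of_nonneg (Finset.subset_univ _) fun _ _ _ => abs_nonneg _

/-- Links the two ends of the window for the ridge parameter: the upper end cannot exceed `N *
norm1Inf θ.Theta`, a factor of the lower end. -/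
theorem signal_le_norm1Inf {θ : Param N p} (hθ : θ.Restricted) (hp : 1 ≤ p) :
    θ.signal ≤ N * norm1Inf θ.Theta := by
  have i : Fin p := ⟨0, hp⟩
  exact (ciInf_le (Set.finite_range _).bddBelow i).trans
    (frob_sq_le_norm1Inf θ i (hθ.one_le_K i) le_rfl)

theorem signal_pos {θ : Param N p} (hθ : θ.Restricted) (hp : 1 ≤ p) : 0 < θ.signal := by
  have : Nonempty (Fin p) := ⟨⟨0, hp⟩⟩
  obtain ⟨i, hi⟩ := exists_eq_ciInf_of_finite (f := fun i => frob (θ.A i (θ.K i)) ^ 2)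
  rw [Param.signal, ← hi]
  have := hθ.pos i (θ.K i) (hθ.one_le_K i) le_rfl
  positivity

/-- Finiteness makes the infimum attained, hence positive. -/
theorem ratioSet_finite (θ : Param N p) :
    (insert 1 {x : ℝ | ∃ i k, 1 ≤ k ∧ k + 1 ≤ θ.K i ∧
      x = frob (θ.A i (k + 1)) ^ 2 / frob (θ.A i k) ^ 2}).Finite := by
  refine Set.Finite.insert _ ?_
  refine (Set.finite_iUnion fun i : Fin p => (Set.finite_Iic (θ.K i)).image
    fun k => frob (θ.A i (k + 1)) ^ 2 / frob (θ.A i k) ^ 2).subset ?_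
  rintro x ⟨i, k, -, h, rfl⟩
  exact Set.mem_iUnion.2 ⟨i, k, Set.mem_Iic.2 (by omega), rfl⟩

theorem minRatio_pos {θ : Param N p} (hθ : θ.Restricted) : 0 < θ.minRatio := by
  have h := (Set.insert_nonempty _ _).csInf_mem (ratioSet_finite θ)
  rw [← Param.minRatio] at h
  rcases h with h | ⟨i, k, h1, h2, h⟩
  · rw [h]; norm_num
  · rw [h]
    have a1 := hθ.pos i k h1 (by omega)
    have a2 := hθ.pos i (k + 1) (by omega) h2
    positivity

theorem minRatio_le_one (θ : Param N p) : θ.minRatio ≤ 1 :=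
  csInf_le (ratioSet_finite θ).bddBelow (Set.mem_insert _ _)

theorem minRatio_le (θ : Param N p) {i : Fin p} {k : ℕ} (h1 : 1 ≤ k) (h2 : k + 1 ≤ θ.K i) :
    θ.minRatio ≤ frob (θ.A i (k + 1)) ^ 2 / frob (θ.A i k) ^ 2 :=
  csInf_le (ratioSet_finite θ).bddBelow (Set.mem_insert_of_mem _ ⟨i, k, h1, h2, rfl⟩)

end algebra

/-! ### The regression equation -/

open scoped MatrixOrder Matrix.Norms.L2Operator in
theorem posSemidef_eq_of_mul_self_eq {n : Type*} [Fintype n] [DecidableEq n] {S S' : Matrix n n ℝ}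
    (hS : S.PosSemidef) (hS' : S'.PosSemidef) (h : S * S = S' * S') : S = S' := by
  rw [← CFC.sqrt_unique rfl hS.nonneg, h, CFC.sqrt_unique rfl hS'.nonneg]

theorem isClosed_posSemidef (N : ℕ) :
    IsClosed {S : Fin N → Fin N → ℝ | (Matrix.of S).PosSemidef} := by
  have : {S : Fin N → Fin N → ℝ | (Matrix.of S).PosSemidef} =
      {S | (Matrix.of S)ᴴ = Matrix.of S} ∩
        ⋂ x : Fin N → ℝ, {S | 0 ≤ star x ⬝ᵥ (Matrix.of S *ᵥ x)} := by
    ext S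
    simp [Matrix.posSemidef_iff_dotProduct_mulVec, Matrix.IsHermitian]
  rw [this]
  have hc : Continuous fun S : Fin N → Fin N → ℝ => (Matrix.of S) := continuous_id
  refine IsClosed.inter (isClosed_eq hc.matrix_conjTranspose hc) (isClosed_iInter fun x => ?_)
  exact isClosed_le continuous_const
    (Continuous.dotProduct continuous_const (hc.matrix_mulVec continuous_const))

/-- The positive semidefinite square root is a measurable function of the entries. -/
theorem exists_measurable_sqrt (N : ℕ) :
    ∃ φ : (Fin N → Fin N → ℝ) → (Fin N → Fin N → ℝ), Measurable φ ∧
      ∀ S : Matrix (Fin N) (Fin N) ℝ, S.PosSemidef → φ (S * S) = S := by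
  let PS := {S : Fin N → Fin N → ℝ | (Matrix.of S).PosSemidef}
  have hPS : MeasurableSet PS := (isClosed_posSemidef N).measurableSet
  have : StandardBorelSpace PS := hPS.standardBorel
  let f : PS → (Fin N → Fin N → ℝ) := fun S => Matrix.of S.1 * Matrix.of S.1
  have hf : Measurable f := by
    refine measurable_pi_iff.2 fun i => measurable_pi_iff.2 fun j => ?_
    have hent : ∀ a b : Fin N, Measurable fun S : PS => S.1 a b := fun a b =>
      (measurable_pi_apply b).comp ((measurable_pi_apply a).comp measurable_subtype_coe)
    have hsum : Measurable fun S : PS => ∑ k, S.1 i k * S.1 k j :=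
      Finset.measurable_fun_sum _ fun k _ => (hent i k).mul (hent k j)
    exact hsum
  have hinj : Function.Injective f := fun S S' h =>
    Subtype.ext (posSemidef_eq_of_mul_self_eq (S := Matrix.of S.1) (S' := Matrix.of S'.1)
      S.2 S'.2 h)
  -- Lusin–Souslin: squaring is an injective measurable map on a standard Borel space, hence a
  -- measurable embedding, and its inverse extends measurably.
  obtain ⟨φ, hφ, h⟩ := (hf.measurableEmbedding hinj).exists_measurable_extend
    measurable_subtype_coe (fun _ => ⟨0⟩)
  exact ⟨φ, hφ, fun S hS => congrFun h ⟨S, hS⟩⟩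

section regression

variable {N p : ℕ}

/-- The two lagged coordinates whose product is a regressor. -/
def xLag : RegIdx N p → Option (ℕ × Fin N) × Option (ℕ × Fin N)
  | none => (none, none)
  | some (i, q) => (some (i + 1, q.1.2), some (i + 1, q.1.1))

/-- The two coordinates whose product is a response. -/
def yLag (q : VechIdx N) : Option (ℕ × Fin N) × Option (ℕ × Fin N) :=
  (some (0, q.1.2), some (0, q.1.1))

/-- The four factors of a product of two products. -/
def pairLag (a b : Option (ℕ × Fin N) × Option (ℕ × Fin N)) : Fin 4 → Option (ℕ × Fin N) :=
  ![a.1, a.2, b.1, b.2]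

theorem xVec_eq (path : ℤ → Fin N → ℝ) (t : ℤ) (a : RegIdx N p) :
    xVec p path t a = lagVal path t (xLag a).1 * lagVal path t (xLag a).2 := by
  rcases a with _ | ⟨i, q⟩
  · simp [xVec, xLag, lagVal]
  · simp [xVec, xLag, lagVal, yVec, vech, Matrix.vecMulVec_apply]

theorem yVec_eq (path : ℤ → Fin N → ℝ) (t : ℤ) (q : VechIdx N) :
    yVec path t q = lagVal path t (yLag q).1 * lagVal path t (yLag q).2 := by
  simp [yLag, lagVal, yVec, vech, Matrix.vecMulVec_apply]

theorem lagProd_pairLag (path : ℤ → Fin N → ℝ) (t : ℤ)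
    (a b : Option (ℕ × Fin N) × Option (ℕ × Fin N)) :
    lagProd path t (pairLag a b) =
      (lagVal path t a.1 * lagVal path t a.2) * (lagVal path t b.1 * lagVal path t b.2) := by
  simp [lagProd, pairLag, Fin.prod_univ_four, mul_assoc]

theorem xVec_mul_xVec (path : ℤ → Fin N → ℝ) (t : ℤ) (a b : RegIdx N p) :
    xVec p path t a * xVec p path t b = lagProd path t (pairLag (xLag a) (xLag b)) := by
  rw [lagProd_pairLag, xVec_eq, xVec_eq]

theorem xVec_mul_yVec (path : ℤ → Fin N → ℝ) (t : ℤ) (a : RegIdx N p) (q : VechIdx N) :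
    xVec p path t a * yVec path t q = lagProd path t (pairLag (xLag a) (yLag q)) := by
  rw [lagProd_pairLag, xVec_eq, yVec_eq]

theorem xLag_le (a : RegIdx N p) :
    (∀ s j, (xLag a).1 = some (s, j) → s ≤ p) ∧ ∀ s j, (xLag a).2 = some (s, j) → s ≤ p := by
  rcases a with _ | ⟨i, q⟩
  · simp [xLag]
  · have := i.2
    constructor <;> intro s j h <;> simp only [xLag, Option.some.injEq, Prod.mk.injEq] at h <;>
      omega

theorem lagLE_pairLag {a b : Option (ℕ × Fin N) × Option (ℕ × Fin N)}
    (ha : (∀ s j, a.1 = some (s, j) → s ≤ p) ∧ ∀ s j, a.2 = some (s, j) → s ≤ p)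
    (hb : (∀ s j, b.1 = some (s, j) → s ≤ p) ∧ ∀ s j, b.2 = some (s, j) → s ≤ p) :
    LagLE p (pairLag a b) := by
  intro i s j h
  fin_cases i
  · exact ha.1 s j h
  · exact ha.2 s j h
  · exact hb.1 s j h
  · exact hb.2 s j h

theorem yLag_le (q : VechIdx N) :
    (∀ s j, (yLag q).1 = some (s, j) → s ≤ p) ∧ ∀ s j, (yLag q).2 = some (s, j) → s ≤ p := by
  constructor <;> intro s j h <;> simp only [yLag, Option.some.injEq, Prod.mk.injEq] at h <;>
    omega

variable {Ω : Type*}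

theorem measurable_xVec_past (r : ℤ → Ω → Fin N → ℝ) (t : ℤ) (a : RegIdx N p) :
    Measurable[sigmaGen r (Set.Iio t)] fun ω => xVec p (fun s => r s ω) t a := by
  rcases a with _ | ⟨i, q⟩
  · exact measurable_const
  · have h : t - ((i : ℕ) + 1) ∈ Set.Iio t := by simp only [Set.mem_Iio]; omega
    exact (measurable_coord_sigmaGen r h q.1.2).mul (measurable_coord_sigmaGen r h q.1.1)

theorem measurable_Sig_past (θ : Param N p) (r : ℤ → Ω → Fin N → ℝ) (t : ℤ) :
    Measurable[sigmaGen r (Set.Iio t)] fun ω j l =>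
      θ.Sig (fun s => r s ω) t j l := by
  refine @measurable_pi_lambda _ _ _ (sigmaGen r (Set.Iio t)) _ _ fun j =>
    @measurable_pi_lambda _ _ _ (sigmaGen r (Set.Iio t)) _ _ fun l => ?_
  have e : ∀ ω, θ.Sig (fun s => r s ω) t j l = θ.Om j l + ∑ i : Fin p,
      ∑ k ∈ Finset.Icc 1 (θ.K i), ∑ y, (∑ x, θ.A i k j x *
        (r (t - ((i : ℕ) + 1)) ω x * r (t - ((i : ℕ) + 1)) ω y)) * θ.A i k l y := by
    intro ω
    simp [Param.Sig, Matrix.add_apply, Matrix.sum_apply, Matrix.mul_apply, Matrix.vecMulVec_apply]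
  simp only [e]
  refine measurable_const.add (Finset.measurable_fun_sum _ fun i _ =>
    Finset.measurable_fun_sum _ fun k _ => Finset.measurable_fun_sum _ fun y _ =>
      (Finset.measurable_fun_sum _ fun x _ => measurable_const.mul ?_).mul measurable_const)
  have h : t - ((i : ℕ) + 1) ∈ Set.Iio t := by simp only [Set.mem_Iio]; omega
  exact (measurable_coord_sigmaGen r h x).mul (measurable_coord_sigmaGen r h y)

variable [m0 : MeasurableSpace Ω] {μ : Measure Ω} [IsProbabilityMeasure μ]
  {r η : ℤ → Ω → Fin N → ℝ}

theorem Param.Sig_vechIdx_diag (θ : Param N p) (path : ℤ → Fin N → ℝ) (t : ℤ) (j : Fin N) :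
    θ.Sig path t j j = ∑ b, xVec p path t b * θ.Theta b (vechIdx j j) := by
  rw [← θ.Sig_eq]; simp [vechIdx]

theorem integrable_xVec_mul_xVec (hr : ∀ t, Measurable (r t)) {ε Mom : ℝ} (hε0 : 0 < ε)
    (hmom : MomentBound μ r (4 + 4 * ε) Mom) (t : ℤ) (a b : RegIdx N p) :
    Integrable (fun ω => xVec p (fun s => r s ω) t a * xVec p (fun s => r s ω) t b) μ := by
  simp only [xVec_mul_xVec]
  exact integrable_lagProd hr hε0 hmom t _

/-- The regression equation `E(x_t y_tᵀ) = E(x_t x_tᵀ) Θ`. -/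
theorem IsBekk.integral_xVec_mul_yVec {θ : Param N p} (hB : IsBekk μ θ r η) {ε Mom : ℝ}
    (hε0 : 0 < ε) (hmom : MomentBound μ r (4 + 4 * ε) Mom) (a : RegIdx N p) (q : VechIdx N) :
    ∫ ω, xVec p (fun s => r s ω) 0 a * yVec (fun s => r s ω) 0 q ∂μ =
      ∑ b, gramX p μ r a b * θ.Theta b q := by
  obtain ⟨φ, hφ, hφS⟩ := exists_measurable_sqrt N
  set j := q.1.2
  set l := q.1.1
  -- The model provides a square root only pathwise. Writing it as a measurable function of `Σ_0`
  -- makes it measurable with respect to the past, hence independent of `η_0`.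
  set S : Ω → Fin N → Fin N → ℝ := fun ω => φ (θ.Sig (fun s => r s ω) 0) with hS
  have hSm : Measurable[sigmaGen r (Set.Iio 0)] S := hφ.comp (measurable_Sig_past θ r 0)
  have hSm' : ∀ u v, Measurable[sigmaGen r (Set.Iio 0)] fun ω => S ω u v := fun u v =>
    (measurable_pi_apply v).comp ((measurable_pi_apply u).comp hSm)
  have hxx := integrable_xVec_mul_xVec (p := p) hB.measurable_r hε0 hmom 0
  have hmod : ∀ᵐ ω ∂μ, (∀ u v, ∑ w, S ω u w * S ω v w = θ.Sig (fun s => r s ω) 0 u v) ∧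
      ∀ u, r 0 ω u = ∑ w, S ω u w * η 0 ω w := by
    filter_upwards [hB.model 0] with ω ⟨S', hpsd, hsq, hr⟩
    have e : S ω = S' := by
      simp only [hS]
      rw [← hsq]
      exact hφS S' hpsd
    have hsym : ∀ u v, S' u v = S' v u := fun u v => by
      have := congrFun (congrFun hpsd.1 v) u
      simpa using this
    refine ⟨fun u v => ?_, fun u => ?_⟩
    · rw [e, ← hsq, Matrix.mul_apply]
      exact Finset.sum_congr rfl fun w _ => by rw [hsym v w]
    · rw [e, hr]; rfl
  have hdiag : ∀ u, Integrable (fun ω => xVec p (fun s => r s ω) 0 a *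
      θ.Sig (fun s => r s ω) 0 u u) μ := fun u => by
    simp only [Param.Sig_vechIdx_diag, Finset.mul_sum, ← mul_assoc]
    exact integrable_finsetSum _ fun b _ => (hxx a b).mul_const _
  have hFm : ∀ u v, Measurable[sigmaGen r (Set.Iio 0)] fun ω =>
      xVec p (fun s => r s ω) 0 a * (S ω j u * S ω l v) := fun u v =>
    (measurable_xVec_past r 0 a).mul ((hSm' j u).mul (hSm' l v))
  -- `|S_{ju} S_{lv}| ≤ Σ_{jj} + Σ_{ll}`, since the rows of `S` have squared norms `Σ_{jj}` and
  -- `Σ_{ll}`; the diagonal of `Σ` is linear in the regressors, whose products are integrable.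
  have hFi : ∀ u v, Integrable (fun ω =>
      xVec p (fun s => r s ω) 0 a * (S ω j u * S ω l v)) μ := fun u v => by
    refine Integrable.mono' ((hdiag j).abs.add (hdiag l).abs)
      ((hFm u v).mono (sigmaGen_le hB.measurable_r _) le_rfl).aestronglyMeasurable ?_
    filter_upwards [hmod] with ω ⟨h1, _⟩
    have h2 : ∀ c w, S ω c w ^ 2 ≤ |θ.Sig (fun s => r s ω) 0 c c| := fun c w => by
      refine le_trans ?_ (le_abs_self _)
      rw [← h1 c c, sq]
      exact Finset.single_le_sum (f := fun w => S ω c w * S ω c w)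
        (fun _ _ => mul_self_nonneg _) (Finset.mem_univ w)
    simp only [Pi.add_apply, Real.norm_eq_abs, abs_mul (xVec p (fun s => r s ω) 0 a)]
    rw [← mul_add]
    refine mul_le_mul_of_nonneg_left ?_ (abs_nonneg _)
    have h3 := h2 j u
    have h4 := h2 l v
    rw [abs_le]
    constructor <;> nlinarith [sq_nonneg (S ω j u - S ω l v), sq_nonneg (S ω j u + S ω l v)]
  have hηi : ∀ u v, Integrable (fun ω => η 0 ω u * η 0 ω v) μ := fun u v =>
    (hB.sq_int 0 u).integrable_mul (hB.sq_int 0 v)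
  have hind : ∀ u v, IndepFun (fun ω => xVec p (fun s => r s ω) 0 a * (S ω j u * S ω l v))
      (fun ω => η 0 ω u * η 0 ω v) μ := fun u v => by
    rw [IndepFun_iff_Indep]
    refine indep_of_indep_of_le_left (indep_of_indep_of_le_right (hB.past 0).symm ?_)
      (hFm u v).comap_le
    have : Measurable[MeasurableSpace.comap (η 0) inferInstance] fun ω => η 0 ω u * η 0 ω v :=
      ((measurable_pi_apply u).comp (comap_measurable (η 0))).mul
        ((measurable_pi_apply v).comp (comap_measurable (η 0)))
    exact this.comap_le
  have hterm : ∀ u v, Integrable (fun ω =>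
      xVec p (fun s => r s ω) 0 a * (S ω j u * S ω l v) * (η 0 ω u * η 0 ω v)) μ := fun u v =>
    (hind u v).integrable_mul (hFi u v) (hηi u v)
  have e1 : ∫ ω, xVec p (fun s => r s ω) 0 a * yVec (fun s => r s ω) 0 q ∂μ =
      ∫ ω, ∑ u, ∑ v,
        xVec p (fun s => r s ω) 0 a * (S ω j u * S ω l v) * (η 0 ω u * η 0 ω v) ∂μ := by
    refine integral_congr_ae ?_
    filter_upwards [hmod] with ω ⟨_, h2⟩
    have h3 : yVec (fun s => r s ω) 0 q = r 0 ω j * r 0 ω l := rfl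
    rw [h3, h2 j, h2 l, Finset.sum_mul_sum, Finset.mul_sum]
    refine Finset.sum_congr rfl fun u _ => ?_
    rw [Finset.mul_sum]
    exact Finset.sum_congr rfl fun v _ => by ring
  rw [e1, integral_finsetSum _ fun u _ => integrable_finsetSum _ fun v _ => hterm u v]
  -- Independence factors each term, and the identity covariance of `η_0` keeps only `u = v`, which
  -- reassembles `S Sᵀ = Σ`.
  have e2 : ∀ u, ∫ ω, ∑ v, xVec p (fun s => r s ω) 0 a * (S ω j u * S ω l v) *
      (η 0 ω u * η 0 ω v) ∂μ = ∫ ω, xVec p (fun s => r s ω) 0 a * (S ω j u * S ω l u) ∂μ := by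
    intro u
    rw [integral_finsetSum _ fun v _ => hterm u v]
    have : ∀ v, ∫ ω, xVec p (fun s => r s ω) 0 a * (S ω j u * S ω l v) *
        (η 0 ω u * η 0 ω v) ∂μ =
        if u = v then ∫ ω, xVec p (fun s => r s ω) 0 a * (S ω j u * S ω l v) ∂μ else 0 := by
      intro v
      rw [(hind u v).integral_fun_mul_eq_mul_integral (hFi u v).aestronglyMeasurable
        (hηi u v).aestronglyMeasurable, hB.cov 0 u v]
      split_ifs <;> simp
    simp only [this]
    simp
  simp only [e2]
  rw [← integral_finsetSum _ fun u _ => hFi u u]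
  have e3 : ∫ ω, ∑ u, xVec p (fun s => r s ω) 0 a * (S ω j u * S ω l u) ∂μ =
      ∫ ω, ∑ b, xVec p (fun s => r s ω) 0 a * xVec p (fun s => r s ω) 0 b * θ.Theta b q ∂μ := by
    refine integral_congr_ae ?_
    filter_upwards [hmod] with ω ⟨h1, _⟩
    rw [← Finset.mul_sum, h1 j l, θ.Sig_eq _ _ q, Finset.mul_sum]
    exact Finset.sum_congr rfl fun b _ => by ring
  rw [e3, integral_finsetSum _ fun b _ => (hxx a b).mul_const _]
  simp only [integral_mul_const]
  rfl

end regression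

/-! ### Eigenvalues of a perturbed sum of orthogonal rank one matrices -/

section eigen

variable {n : Type*} [Fintype n]

/-- Fewer homogeneous equations than unknowns. The nonzero object is the coefficient vector; that
the combination itself is nonzero is argued where the lemma is used. -/
theorem exists_ne_zero_combination_dotProduct_eq_zero {k k' : ℕ} (hk : k' < k) (f : Fin k → n → ℝ)
    (g : Fin k' → n → ℝ) : ∃ c : Fin k → ℝ, c ≠ 0 ∧ ∀ i, g i ⬝ᵥ (∑ j, c j • f j) = 0 := by
  let L : (Fin k → ℝ) →ₗ[ℝ] (Fin k' → ℝ) :=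
    Matrix.toLin' (Matrix.of fun i j => g i ⬝ᵥ f j)
  have h : L.ker ≠ ⊥ := LinearMap.ker_ne_bot_of_finrank_lt (by simpa using hk)
  obtain ⟨c, hc, hc0⟩ := Submodule.exists_mem_ne_zero_of_ne_bot h
  refine ⟨c, hc0, fun i => ?_⟩
  have := congrFun (LinearMap.mem_ker.1 hc) i
  simp only [L, Matrix.toLin'_apply, Matrix.mulVec, Pi.zero_apply] at this
  rw [dotProduct_sum, ← this]
  simp only [dotProduct_smul, smul_eq_mul]
  exact Finset.sum_congr rfl fun j _ => mul_comm _ _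

variable [DecidableEq n] {M : Matrix n n ℝ}

/-- The `j`-th eigenvector, in the order of descending eigenvalues. -/
noncomputable def eigVec (hM : M.IsHermitian) (j : Fin (Fintype.card n)) : n → ℝ :=
  (hM.eigenvectorBasis (Fintype.equivOfCardEq (Fintype.card_fin _) j)).ofLp

theorem eigenvalues_equiv (hM : M.IsHermitian) (j : Fin (Fintype.card n)) :
    hM.eigenvalues (Fintype.equivOfCardEq (Fintype.card_fin _) j) = hM.eigenvalues₀ j := by
  simp [Matrix.IsHermitian.eigenvalues]

theorem eigVec_dotProduct (hM : M.IsHermitian) (i j : Fin (Fintype.card n)) :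
    eigVec hM i ⬝ᵥ eigVec hM j = if i = j then 1 else 0 := by
  have h := orthonormal_iff_ite.1 hM.eigenvectorBasis.orthonormal
    (Fintype.equivOfCardEq (Fintype.card_fin _) i) (Fintype.equivOfCardEq (Fintype.card_fin _) j)
  simp only [EmbeddingLike.apply_eq_iff_eq] at h
  rw [← h, dotProduct_comm]
  simp [eigVec, EuclideanSpace.inner_eq_star_dotProduct]

theorem sum_eigVec_dotProduct_mul (hM : M.IsHermitian) (x y : n → ℝ) :
    ∑ j, (eigVec hM j ⬝ᵥ x) * (eigVec hM j ⬝ᵥ y) = x ⬝ᵥ y := by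
  have h := hM.eigenvectorBasis.sum_inner_mul_inner (WithLp.toLp 2 x) (WithLp.toLp 2 y)
  rw [← Equiv.sum_comp (Fintype.equivOfCardEq (Fintype.card_fin (Fintype.card n)))] at h
  simp only [EuclideanSpace.inner_eq_star_dotProduct, star_trivial] at h
  rw [dotProduct_comm x y, ← h]
  refine Finset.sum_congr rfl fun j _ => ?_
  rw [dotProduct_comm (eigVec hM j) y]
  rfl

theorem eigVec_dotProduct_mulVec (hM : M.IsHermitian) (j : Fin (Fintype.card n)) (x : n → ℝ) :
    eigVec hM j ⬝ᵥ (M *ᵥ x) = hM.eigenvalues₀ j * (eigVec hM j ⬝ᵥ x) := by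
  have h := hM.mulVec_eigenvectorBasis (Fintype.equivOfCardEq (Fintype.card_fin _) j)
  rw [eigenvalues_equiv] at h
  have hT : Mᵀ = M := by simpa [Matrix.conjTranspose_eq_transpose_of_trivial] using hM.eq
  rw [Matrix.dotProduct_mulVec, ← Matrix.mulVec_transpose, hT]
  change (M *ᵥ (hM.eigenvectorBasis _).ofLp) ⬝ᵥ x = _
  rw [h, smul_dotProduct]
  rfl

theorem dotProduct_self_eq_sum (hM : M.IsHermitian) (x : n → ℝ) :
    x ⬝ᵥ x = ∑ j, (eigVec hM j ⬝ᵥ x) ^ 2 := by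
  rw [← sum_eigVec_dotProduct_mul hM x x]
  exact Finset.sum_congr rfl fun j _ => (sq _).symm

theorem dotProduct_mulVec_eq_sum (hM : M.IsHermitian) (x : n → ℝ) :
    x ⬝ᵥ (M *ᵥ x) = ∑ j, hM.eigenvalues₀ j * (eigVec hM j ⬝ᵥ x) ^ 2 := by
  rw [← sum_eigVec_dotProduct_mul hM x (M *ᵥ x)]
  refine Finset.sum_congr rfl fun j _ => ?_
  rw [eigVec_dotProduct_mulVec]; ring

/-- Lower half of the min-max principle. -/
theorem le_eigDesc (hM : M.IsHermitian) {k : ℕ} (hk : 1 ≤ k) (hkn : k ≤ Fintype.card n) {c : ℝ}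
    (f : Fin k → n → ℝ)
    (hf : ∀ a : Fin k → ℝ, a ≠ 0 → 0 < (∑ j, a j • f j) ⬝ᵥ (∑ j, a j • f j) ∧
      c * ((∑ j, a j • f j) ⬝ᵥ (∑ j, a j • f j)) ≤
        (∑ j, a j • f j) ⬝ᵥ (M *ᵥ (∑ j, a j • f j))) :
    c ≤ eigDesc hM k := by
  have hk' : k - 1 < Fintype.card n := by omega
  rw [eigDesc, dif_pos hk']
  -- A vector of the test space orthogonal to the top `k - 1` eigenvectors: only eigenvalues up to
  -- the `k`-th largest enter its quadratic form.
  obtain ⟨a, ha, hg⟩ := exists_ne_zero_combination_dotProduct_eq_zero (k' := k - 1) (k := k)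
    (by omega) f (fun i => eigVec hM ⟨i, by omega⟩)
  set x := ∑ j, a j • f j
  obtain ⟨hx, hcx⟩ := hf a ha
  refine le_of_mul_le_mul_right (hcx.trans ?_) hx
  rw [dotProduct_mulVec_eq_sum hM, dotProduct_self_eq_sum hM, Finset.mul_sum]
  refine Finset.sum_le_sum fun j _ => ?_
  rcases lt_or_ge (j : ℕ) (k - 1) with h | h
  · have := hg ⟨j, h⟩
    simp only [Fin.eta] at this
    rw [this]; simp
  · exact mul_le_mul_of_nonneg_right (hM.eigenvalues₀_antitone (Fin.le_def.2 h)) (sq_nonneg _)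

/-- Upper half of the min-max principle. -/
theorem eigDesc_le (hM : M.IsHermitian) {k : ℕ} (hk : 1 ≤ k) (hkn : k ≤ Fintype.card n) {c : ℝ}
    {k' : ℕ} (hkk : k' < k) (g : Fin k' → n → ℝ)
    (hg : ∀ x : n → ℝ, (∀ i, g i ⬝ᵥ x = 0) → x ⬝ᵥ (M *ᵥ x) ≤ c * (x ⬝ᵥ x)) :
    eigDesc hM k ≤ c := by
  have hk' : k - 1 < Fintype.card n := by omega
  rw [eigDesc, dif_pos hk']
  -- Dually, a combination of the top `k` eigenvectors satisfying the fewer than `k` constraints.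
  obtain ⟨a, ha, hgx⟩ := exists_ne_zero_combination_dotProduct_eq_zero hkk
    (fun i : Fin k => eigVec hM ⟨i, by omega⟩) g
  set x := ∑ j : Fin k, a j • eigVec hM ⟨j, by omega⟩ with hx
  have hproj : ∀ i, eigVec hM i ⬝ᵥ x = if h : (i : ℕ) < k then a ⟨i, h⟩ else 0 := by
    intro i
    rw [hx, dotProduct_sum]
    simp only [dotProduct_smul, eigVec_dotProduct, smul_eq_mul]
    split_ifs with h
    · rw [Finset.sum_eq_single ⟨i, h⟩]
      · simp
      · intro b _ hb
        rw [if_neg, mul_zero]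
        intro e
        exact hb (Fin.ext (congrArg Fin.val e).symm)
      · simp
    · refine Finset.sum_eq_zero fun j _ => ?_
      rw [if_neg, mul_zero]
      intro e
      exact h ((congrArg Fin.val e).trans_lt j.2)
  have hxx : 0 < x ⬝ᵥ x := by
    obtain ⟨i, hi⟩ := Function.ne_iff.1 ha
    rw [dotProduct_self_eq_sum hM]
    refine lt_of_lt_of_le ?_ (Finset.single_le_sum (f := fun j => (eigVec hM j ⬝ᵥ x) ^ 2)
      (fun _ _ => sq_nonneg _) (Finset.mem_univ (⟨i, by omega⟩ : Fin (Fintype.card n))))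
    simp only [hproj, dif_pos i.2, Fin.eta]
    have hi' : a i ≠ 0 := hi
    positivity
  refine le_of_mul_le_mul_right (le_trans ?_ (hg x hgx)) hxx
  rw [dotProduct_mulVec_eq_sum hM, dotProduct_self_eq_sum hM, Finset.mul_sum]
  refine Finset.sum_le_sum fun j _ => ?_
  rcases lt_or_ge (j : ℕ) k with h | h
  · exact mul_le_mul_of_nonneg_right (hM.eigenvalues₀_antitone (Fin.le_def.2 (by simp; omega)))
      (sq_nonneg _)
  · rw [hproj, dif_neg (by omega)]; simp

/-- Orthogonal nonzero vectors `v 1, …, v K` with descending norms. -/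
structure OrthoDesc (v : ℕ → n → ℝ) (K : ℕ) : Prop where
  orth : ∀ k l, k ∈ Finset.Icc 1 K → l ∈ Finset.Icc 1 K → k ≠ l → v k ⬝ᵥ v l = 0
  pos : ∀ k ∈ Finset.Icc 1 K, 0 < v k ⬝ᵥ v k
  desc : ∀ k l, 1 ≤ k → k ≤ l → l ≤ K → v l ⬝ᵥ v l ≤ v k ⬝ᵥ v k

variable {v : ℕ → n → ℝ} {K : ℕ}

omit [DecidableEq n] in
theorem OrthoDesc.bessel (hv : OrthoDesc v K) (x : n → ℝ) :
    ∑ k ∈ Finset.Icc 1 K, (v k ⬝ᵥ x) ^ 2 / (v k ⬝ᵥ v k) ≤ x ⬝ᵥ x := by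
  set a : ℕ → ℝ := fun k => (v k ⬝ᵥ x) / (v k ⬝ᵥ v k)
  set y := ∑ k ∈ Finset.Icc 1 K, a k • v k with hy
  have h1 : y ⬝ᵥ x = ∑ k ∈ Finset.Icc 1 K, (v k ⬝ᵥ x) ^ 2 / (v k ⬝ᵥ v k) := by
    rw [hy, sum_dotProduct]
    refine Finset.sum_congr rfl fun k _ => ?_
    simp only [smul_dotProduct, smul_eq_mul, a]; ring
  have h2 : y ⬝ᵥ y = ∑ k ∈ Finset.Icc 1 K, (v k ⬝ᵥ x) ^ 2 / (v k ⬝ᵥ v k) := by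
    conv_lhs => rw [hy, sum_dotProduct]
    refine Finset.sum_congr rfl fun k hk => ?_
    have hp := hv.pos k hk
    rw [dotProduct_sum, Finset.sum_eq_single k]
    · simp only [smul_dotProduct, dotProduct_smul, smul_eq_mul, a]
      field_simp
    · intro l hl hne
      simp [smul_dotProduct, dotProduct_smul, hv.orth k l hk hl hne.symm]
    · exact fun h => absurd hk h
  have h3 : 0 ≤ (x - y) ⬝ᵥ (x - y) := by
    simpa using dotProduct_star_self_nonneg (x - y)
  rw [sub_dotProduct, dotProduct_sub, dotProduct_sub, h2, dotProduct_comm x y, h1] at h3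
  linarith

/-- The quadratic form of `M` is within `δ` of that of `∑ₖ v_k v_kᵀ`. -/
def QuadClose (M : Matrix n n ℝ) (v : ℕ → n → ℝ) (K : ℕ) (δ : ℝ) : Prop :=
  ∀ x : n → ℝ, |x ⬝ᵥ (M *ᵥ x) - ∑ k ∈ Finset.Icc 1 K, (v k ⬝ᵥ x) ^ 2| ≤ δ * (x ⬝ᵥ x)

/-- The test space is the span of `v 1, …, v k`, on which the unperturbed form is at least `‖v k‖²`
times the squared norm. -/
theorem OrthoDesc.le_eigDesc (hv : OrthoDesc v K) (hM : M.IsHermitian) {δ : ℝ}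
    (hδ : QuadClose M v K δ) {k : ℕ} (hk1 : 1 ≤ k) (hk : k ≤ K) (hn : k ≤ Fintype.card n) :
    v k ⬝ᵥ v k - δ ≤ eigDesc hM k := by
  have hmem : ∀ j : Fin k, (j : ℕ) + 1 ∈ Finset.Icc 1 K := fun j =>
    Finset.mem_Icc.2 ⟨by omega, by have := j.2; omega⟩
  refine BekkArch.le_eigDesc hM hk1 hn (fun j : Fin k => v (j + 1)) fun a ha => ?_
  set x := ∑ j : Fin k, a j • v (j + 1) with hx
  have hproj : ∀ j : Fin k, v (j + 1) ⬝ᵥ x = a j * (v (j + 1) ⬝ᵥ v (j + 1)) := by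
    intro j
    rw [hx, dotProduct_sum, Finset.sum_eq_single j]
    · simp [dotProduct_smul]
    · intro l _ hne
      rw [dotProduct_smul, hv.orth _ _ (hmem j) (hmem l)
        (fun h => hne (Fin.ext (by omega))), smul_zero]
    · simp
  have hxx : x ⬝ᵥ x = ∑ j : Fin k, a j ^ 2 * (v (j + 1) ⬝ᵥ v (j + 1)) := by
    conv_lhs => rw [hx, sum_dotProduct]
    refine Finset.sum_congr rfl fun j _ => ?_
    rw [smul_dotProduct, hproj, smul_eq_mul]; ring
  constructor
  · obtain ⟨j, hj⟩ := Function.ne_iff.1 ha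
    have hj' : a j ≠ 0 := hj
    rw [hxx]
    refine lt_of_lt_of_le ?_ (Finset.single_le_sum
      (f := fun j : Fin k => a j ^ 2 * (v (j + 1) ⬝ᵥ v (j + 1)))
      (fun i _ => mul_nonneg (sq_nonneg _) (hv.pos _ (hmem i)).le) (Finset.mem_univ j))
    have := hv.pos _ (hmem j)
    positivity
  · have h1 := (abs_le.1 (hδ x)).1
    have h2 : ∑ j : Fin k, (v (j + 1) ⬝ᵥ x) ^ 2 ≤ ∑ l ∈ Finset.Icc 1 K, (v l ⬝ᵥ x) ^ 2 := by
      rw [← Finset.sum_image (f := fun l => (v l ⬝ᵥ x) ^ 2)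
        (g := fun j : Fin k => (j : ℕ) + 1) (fun i _ j _ h => Fin.ext (by simpa using h))]
      refine Finset.sum_le_sum_of_subset_of_nonneg ?_ fun _ _ _ => sq_nonneg _
      intro l hl
      obtain ⟨j, -, rfl⟩ := Finset.mem_image.1 hl
      exact hmem j
    have h3 : v k ⬝ᵥ v k * (x ⬝ᵥ x) ≤ ∑ j : Fin k, (v (j + 1) ⬝ᵥ x) ^ 2 := by
      rw [hxx, Finset.mul_sum]
      refine Finset.sum_le_sum fun j _ => ?_
      rw [hproj]
      have hd := hv.desc (j + 1) k (by omega) (by have := j.2; omega) hk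
      have hp := hv.pos _ (hmem j)
      have := mul_le_mul_of_nonneg_right hd
        (mul_nonneg (sq_nonneg (a j)) hp.le)
      linarith [mul_pow (a j) (v (j + 1) ⬝ᵥ v (j + 1)) 2,
        show (a j) ^ 2 * (v (j + 1) ⬝ᵥ v (j + 1)) ^ 2 = v (j + 1) ⬝ᵥ v (j + 1) *
          (a j ^ 2 * (v (j + 1) ⬝ᵥ v (j + 1))) by ring]
    linarith

/-- On vectors orthogonal to `v 1, …, v (k - 1)`, Bessel's inequality and the descending norms bound
the unperturbed form by `‖v k‖²` times the squared norm. -/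
theorem OrthoDesc.eigDesc_le (hv : OrthoDesc v K) (hM : M.IsHermitian) {δ : ℝ}
    (hδ : QuadClose M v K δ) {k : ℕ} (hk1 : 1 ≤ k) (hk : k ≤ K) (hn : k ≤ Fintype.card n) :
    eigDesc hM k ≤ v k ⬝ᵥ v k + δ := by
  refine BekkArch.eigDesc_le hM hk1 hn (k' := k - 1) (by omega) (fun j => v (j + 1)) fun x hx => ?_
  have h1 := (abs_le.1 (hδ x)).2
  have h2 : ∑ l ∈ Finset.Icc 1 K, (v l ⬝ᵥ x) ^ 2 ≤ v k ⬝ᵥ v k * (x ⬝ᵥ x) := by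
    refine le_trans ?_ (mul_le_mul_of_nonneg_left (hv.bessel x)
      (hv.pos k (Finset.mem_Icc.2 ⟨hk1, hk⟩)).le)
    rw [Finset.mul_sum]
    refine Finset.sum_le_sum fun l hl => ?_
    obtain ⟨hl1, hl2⟩ := Finset.mem_Icc.1 hl
    have hp := hv.pos l hl
    rcases lt_or_ge l k with h | h
    · have := hx ⟨l - 1, by omega⟩
      simp only [Nat.sub_add_cancel hl1] at this
      rw [this]; simp
    · rw [← mul_div_assoc, le_div_iff₀ hp, mul_comm]
      exact mul_le_mul_of_nonneg_right (hv.desc k l hk1 h hl2) (sq_nonneg _)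
  linarith

/-- Orthogonality to all of `v 1, …, v K` leaves only the perturbation. -/
theorem eigDesc_le_of_gt (hM : M.IsHermitian) {δ : ℝ}
    (hδ : QuadClose M v K δ) {k : ℕ} (hk : K < k) (hn : k ≤ Fintype.card n) :
    eigDesc hM k ≤ δ := by
  refine BekkArch.eigDesc_le hM (by omega) hn hk (fun j => v (j + 1)) fun x hx => ?_
  have h1 := (abs_le.1 (hδ x)).2
  have h2 : ∑ l ∈ Finset.Icc 1 K, (v l ⬝ᵥ x) ^ 2 = 0 := by
    refine Finset.sum_eq_zero fun l hl => ?_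
    obtain ⟨hl1, hl2⟩ := Finset.mem_Icc.1 hl
    have := hx ⟨l - 1, by omega⟩
    simp only [Nat.sub_add_cancel hl1] at this
    rw [this]; simp
  linarith

/-- The unperturbed form is nonnegative; test on a unit eigenvector. This keeps the denominators of
the ridge-type ratio positive. -/
theorem neg_le_eigDesc (hM : M.IsHermitian) {δ : ℝ}
    (hδ : QuadClose M v K δ) {k : ℕ} (hk1 : 1 ≤ k) (hn : k ≤ Fintype.card n) :
    -δ ≤ eigDesc hM k := by
  have hk' : k - 1 < Fintype.card n := by omega
  rw [eigDesc, dif_pos hk']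
  set u := eigVec hM ⟨k - 1, hk'⟩
  have h1 := (abs_le.1 (hδ u)).1
  have h2 : u ⬝ᵥ u = 1 := by simp [u, eigVec_dotProduct]
  rw [eigVec_dotProduct_mulVec, h2] at h1
  have : 0 ≤ ∑ l ∈ Finset.Icc 1 K, (v l ⬝ᵥ u) ^ 2 := Finset.sum_nonneg fun _ _ => sq_nonneg _
  linarith

-- Cauchy–Schwarz between `D` and `x xᵀ`, whose Frobenius norm is `x ⬝ᵥ x`.
omit [DecidableEq n] in
theorem abs_dotProduct_mulVec_le_frob (D : Matrix n n ℝ) (x : n → ℝ) :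
    |x ⬝ᵥ (D *ᵥ x)| ≤ frob D * (x ⬝ᵥ x) := by
  have hx : 0 ≤ x ⬝ᵥ x := by simpa using dotProduct_star_self_nonneg x
  refine abs_le_of_sq_le_sq ?_ (mul_nonneg (frob_nonneg D) hx)
  rw [mul_pow, frob_sq]
  have h := Finset.sum_mul_sq_le_sq_mul_sq (Finset.univ : Finset (n × n))
    (fun a => D a.1 a.2) (fun a => x a.1 * x a.2)
  have e1 : ∑ a : n × n, D a.1 a.2 * (x a.1 * x a.2) = x ⬝ᵥ (D *ᵥ x) := by
    rw [Fintype.sum_prod_type]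
    simp only [dotProduct, Matrix.mulVec, Finset.mul_sum]
    exact Finset.sum_congr rfl fun i _ => Finset.sum_congr rfl fun j _ => by ring
  have e2 : ∑ a : n × n, (x a.1 * x a.2) ^ 2 = (x ⬝ᵥ x) ^ 2 := by
    rw [Fintype.sum_prod_type, sq (x ⬝ᵥ x)]
    simp only [dotProduct, Finset.sum_mul_sum]
    exact Finset.sum_congr rfl fun i _ => Finset.sum_congr rfl fun j _ => by ring
  rw [e1, e2, Fintype.sum_prod_type] at h
  exact h

/-- Selection of the number of components by the ratio of eigenvalues. -/
theorem argmin_ratio_eq {lam w : ℕ → ℝ} {K Kbar k : ℕ} {c δ sig rat : ℝ} (hc : 0 < c)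
    (hδ : δ ≤ c / 4) (hcs : c ≤ sig * rat / 10) (hrat1 : rat ≤ 1) (hrat0 : 0 < rat)
    (hsig0 : 0 < sig) (hK1 : 1 ≤ K)
    (hKbar : K ≤ Kbar) (hsig : ∀ l, 1 ≤ l → l ≤ K → sig ≤ w l)
    (hrat : ∀ l, 1 ≤ l → l + 1 ≤ K → rat ≤ w (l + 1) / w l)
    (hlo : ∀ l, 1 ≤ l → l ≤ K → w l - δ ≤ lam l) (hup : ∀ l, 1 ≤ l → l ≤ K → lam l ≤ w l + δ)
    (hgt : ∀ l, K < l → l ≤ Kbar + 1 → lam l ≤ δ) (hneg : ∀ l, 1 ≤ l → l ≤ Kbar + 1 → -δ ≤ lam l)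
    (hk1 : 1 ≤ k) (hk : k ≤ Kbar)
    (hmin : (lam (k + 1) + c) / (lam k + c) ≤ (lam (K + 1) + c) / (lam K + c)) : k = K := by
  have hcs' : c ≤ sig / 10 := by nlinarith
  -- The numerator is at most `5 c / 4 ≤ sig * rat / 8`, the denominator at least `sig`.
  have hRK : (lam (K + 1) + c) / (lam K + c) ≤ rat / 8 := by
    have h1 := hgt (K + 1) (by omega) (by omega)
    have h2 := hlo K hK1 le_rfl
    have h3 := hsig K hK1 le_rfl
    rw [div_le_iff₀ (by linarith)]
    have h4 : sig ≤ lam K + c := by linarith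
    have : rat / 8 * sig ≤ rat / 8 * (lam K + c) := mul_le_mul_of_nonneg_left h4 (by linarith)
    linarith
  have h0 := hmin.trans hRK
  have hpos : 0 < lam k + c := by
    have := hneg k hk1 (by omega)
    linarith
  rw [div_le_iff₀ hpos] at h0
  rcases lt_trichotomy k K with h | h | h
  -- Too few components: the numerator is at least `rat * w k` and the denominator at most `2 * w
  -- k`, so the ratio is at least `rat / 2`.
  · exfalso
    have h1 := hlo (k + 1) (by omega) (by omega)
    have h2 := hup k hk1 h.le
    have h3 := hsig k hk1 h.le
    have h4 := hrat k hk1 h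
    rw [le_div_iff₀ (by linarith)] at h4
    have h5 : rat / 8 * (lam k + c) ≤ rat / 8 * (2 * w k) :=
      mul_le_mul_of_nonneg_left (by linarith) (by linarith)
    have h6 : 0 < rat * w k := mul_pos hrat0 (by linarith)
    linarith
  · exact h
  -- Too many components: both eigenvalues are noise, so the ratio is at least `(3 c / 4) / (5 c /
  -- 4) = 3 / 5`.
  · exfalso
    have h1 := hgt k h (by omega)
    have h2 := hneg (k + 1) (by omega) (by omega)
    have h5 : rat / 8 * (lam k + c) ≤ 1 / 8 * (lam k + c) :=
      mul_le_mul_of_nonneg_right (by linarith) hpos.le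
    linarith

end eigen

/-! ### Deterministic consistency of the ridge-type ratio -/

section selection

variable {N p : ℕ}

/-- The rearrangement merely permutes entries, so it transfers the padding error to the symmetric
matrix without loss. -/
theorem frob_rearr_sub (M M' : Matrix (Fin N × Fin N) (Fin N × Fin N) ℝ) :
    frob (rearr M - rearr M') = frob (M - M') := by
  unfold frob
  congr 1
  simp only [Fintype.sum_prod_type, Matrix.sub_apply, rearr, Matrix.of_apply]
  refine Finset.sum_congr rfl fun i _ => ?_
  rw [Finset.sum_comm]

theorem orthoDesc_vec {θ : Param N p} (hθ : θ.Restricted) (i : Fin p) :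
    OrthoDesc (fun k (a : Fin N × Fin N) => θ.A i k a.1 a.2) (θ.K i) ∧
      ∀ k, (fun a : Fin N × Fin N => θ.A i k a.1 a.2) ⬝ᵥ (fun a => θ.A i k a.1 a.2) =
        frob (θ.A i k) ^ 2 := by
  have hn : ∀ k, (fun a : Fin N × Fin N => θ.A i k a.1 a.2) ⬝ᵥ (fun a => θ.A i k a.1 a.2) =
      frob (θ.A i k) ^ 2 := fun k => by
    rw [frob_sq, dotProduct, Fintype.sum_prod_type]
    simp only [sq]
  have ho : ∀ k l, (fun a : Fin N × Fin N => θ.A i k a.1 a.2) ⬝ᵥ (fun a => θ.A i l a.1 a.2) =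
      frobInner (θ.A i k) (θ.A i l) := fun k l => by
    rw [frobInner, Matrix.trace, dotProduct, Fintype.sum_prod_type, Finset.sum_comm]
    simp [Matrix.mul_apply]
  refine ⟨⟨?_, ?_, ?_⟩, hn⟩
  · intro k l hk hl hne
    rw [Finset.mem_Icc] at hk hl
    rcases lt_or_gt_of_ne hne with h | h
    · rw [ho]; exact hθ.orth i k l hk.1 h hl.2
    · rw [dotProduct_comm, ho]; exact hθ.orth i l k hl.1 h hk.2
  · intro k hk
    rw [Finset.mem_Icc] at hk
    rw [hn]
    have := hθ.pos i k hk.1 hk.2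
    positivity
  · intro k l hk hkl hl
    rw [hn, hn]
    refine pow_le_pow_left₀ (frob_nonneg _) ?_ 2
    induction l, hkl using Nat.le_induction with
    | base => exact le_rfl
    | succ l hkl ih => exact (hθ.desc i l (by omega) (by omega)).le.trans (ih (by omega))

/-- The ridge-type ratio selects the true number of components if the padded matrix is close to the
true one. -/
theorem ridgeArgmin_eq {θ : Param N p} (hθ : θ.Restricted) (i : Fin p)
    {Φ : Matrix (VechIdx N) (VechIdx N) ℝ} {W : Matrix (StrictIdx N) (StrictIdx N) ℝ} {c : ℝ}
    {Kbar k : ℕ} (hc : 0 < c)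
    (hclose : frob (padding Φ W - padding (θ.Phi i) (θ.auxW i)) ≤ c / 4)
    (hcs : c ≤ θ.signal * θ.minRatio / 10) (hK : θ.K i ≤ Kbar) (hN : Kbar < N ^ 2)
    (hk : IsRidgeArgmin Φ W c Kbar k) : k = θ.K i := by
  have hp : 1 ≤ p := Nat.succ_le_of_lt (lt_of_le_of_lt (Nat.zero_le _) i.2)
  obtain ⟨hv, hn⟩ := orthoDesc_vec hθ i
  set v : ℕ → Fin N × Fin N → ℝ := fun k a => θ.A i k a.1 a.2 with hvdef
  set M := rearr (padding Φ W) with hMdef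
  have hM : M.IsHermitian := rearr_padding_isHermitian Φ W
  set δ := frob (padding Φ W - padding (θ.Phi i) (θ.auxW i))
  have hcard : Fintype.card (Fin N × Fin N) = N ^ 2 := by simp [sq]
  have hq : QuadClose M v (θ.K i) δ := by
    intro x
    have e : ∑ k ∈ Finset.Icc 1 (θ.K i), (v k ⬝ᵥ x) ^ 2 =
        x ⬝ᵥ (rearr (padding (θ.Phi i) (θ.auxW i)) *ᵥ x) := by
      simp only [dotProduct, Matrix.mulVec, θ.rearr_padding_apply, Finset.mul_sum, Finset.sum_mul,
        sq, hvdef]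
      rw [Finset.sum_comm]
      refine Finset.sum_congr rfl fun a _ => ?_
      rw [Finset.sum_comm]
      refine Finset.sum_congr rfl fun b _ => ?_
      exact Finset.sum_congr rfl fun k _ => by ring
    rw [e, ← dotProduct_sub, ← Matrix.sub_mulVec]
    refine (abs_dotProduct_mulVec_le_frob _ x).trans (le_of_eq ?_)
    rw [hMdef, frob_rearr_sub]
  have hnv : ∀ k, v k ⬝ᵥ v k = frob (θ.A i k) ^ 2 := hn
  refine argmin_ratio_eq (lam := eigDesc hM) (w := fun k => v k ⬝ᵥ v k) (δ := δ) hc hclose hcs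
    (minRatio_le_one θ) (minRatio_pos hθ) (signal_pos hθ hp) (hθ.one_le_K i) hK ?_ ?_
    (fun l h1 h2 => hv.le_eigDesc hM hq h1 h2 (by omega))
    (fun l h1 h2 => hv.eigDesc_le hM hq h1 h2 (by omega))
    (fun l h1 h2 => eigDesc_le_of_gt hM hq h1 (by omega))
    (fun l h1 h2 => neg_le_eigDesc hM hq h1 (by omega)) hk.1.1 hk.1.2
    (hk.2 _ (hθ.one_le_K i) hK)
  · intro l h1 h2
    refine le_trans ?_ (hv.desc l (θ.K i) h1 h2 le_rfl)
    rw [hnv]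
    exact ciInf_le (f := fun i => frob (θ.A i (θ.K i)) ^ 2) (Set.finite_range _).bddBelow i
  · intro l h1 h2
    simp only [hnv]
    exact minRatio_le θ h1 h2

end selection

/-! ### Regularized least squares -/

section lasso

theorem lamMin_mul_le {n : Type*} [Fintype n] [DecidableEq n] {M : Matrix n n ℝ}
    (hM : M.IsHermitian) (x : n → ℝ) : lamMin hM * (x ⬝ᵥ x) ≤ x ⬝ᵥ (M *ᵥ x) := by
  rw [dotProduct_mulVec_eq_sum hM, dotProduct_self_eq_sum hM, Finset.mul_sum]
  refine Finset.sum_le_sum fun j _ => mul_le_mul_of_nonneg_right ?_ (sq_nonneg _)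
  rw [← eigenvalues_equiv]
  exact ciInf_le (Set.finite_range _).bddBelow _

/-- Error bound for the lasso, under bounds on the score and on the error of the Gram matrix. -/
theorem lasso_error_le {ι : Type*} [Fintype ι] [DecidableEq ι] {T : ℕ} (hT : 0 < T)
    (X : Fin T → ι → ℝ) (y : Fin T → ℝ) (bh b : ι → ℝ) {lam κ : ℝ} {s : ℕ} (hlam : 0 < lam)
    (hbasic : 1 / (2 * T) * ∑ t, (y t - ∑ a, X t a * bh a) ^ 2 + lam * ∑ a, |bh a| ≤
      1 / (2 * T) * ∑ t, (y t - ∑ a, X t a * b a) ^ 2 + lam * ∑ a, |b a|)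
    (hs : {a | b a ≠ 0}.ncard ≤ s)
    (hscore : ∀ a, |1 / (T : ℝ) * ∑ t, X t a * (y t - ∑ a', X t a' * b a')| ≤ lam / 2)
    {Γ : Matrix ι ι ℝ} (hΓ : Γ.IsHermitian) (hpos : 0 < lamMin hΓ)
    (hgram : ∀ a a', |1 / (T : ℝ) * ∑ t, X t a * X t a' - Γ a a'| ≤ κ)
    (hκ : 16 * s * κ ≤ lamMin hΓ / 2) :
    ∑ a, (bh a - b a) ^ 2 ≤ 36 * lam ^ 2 * s / lamMin hΓ ^ 2 := by
  classical
  have hTr : (0 : ℝ) < T := by exact_mod_cast hT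
  set l := lamMin hΓ
  set Δ : ι → ℝ := fun a => bh a - b a with hΔ
  set D := ∑ a, Δ a ^ 2 with hD
  set S := Finset.univ.filter fun a => b a ≠ 0 with hS
  have hScard : (S.card : ℝ) ≤ s := by
    have : S.card = {a | b a ≠ 0}.ncard := by
      rw [← Set.ncard_coe_finset, hS]; congr 1; ext a; simp
    rw [this]; exact_mod_cast hs
  set P := ∑ a ∈ S, |Δ a| with hP
  set Q := ∑ a ∈ Sᶜ, |Δ a| with hQ
  have hP0 : 0 ≤ P := Finset.sum_nonneg fun _ _ => abs_nonneg _
  have hQ0 : 0 ≤ Q := Finset.sum_nonneg fun _ _ => abs_nonneg _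
  have hD0 : 0 ≤ D := Finset.sum_nonneg fun _ _ => sq_nonneg _
  have hPQ : ∑ a, |Δ a| = P + Q := (Finset.sum_add_sum_compl S _).symm
  set V := 1 / (T : ℝ) * ∑ t, (∑ a, X t a * Δ a) ^ 2 with hV
  have hV0 : 0 ≤ V := mul_nonneg (by positivity) (Finset.sum_nonneg fun _ _ => sq_nonneg _)
  have hexp : ∑ t, (y t - ∑ a, X t a * bh a) ^ 2 = ∑ t, (y t - ∑ a, X t a * b a) ^ 2 -
      2 * ∑ t, (y t - ∑ a, X t a * b a) * (∑ a, X t a * Δ a) +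
      ∑ t, (∑ a, X t a * Δ a) ^ 2 := by
    rw [Finset.mul_sum, ← Finset.sum_sub_distrib, ← Finset.sum_add_distrib]
    refine Finset.sum_congr rfl fun t _ => ?_
    have : ∑ a, X t a * bh a = ∑ a, X t a * b a + ∑ a, X t a * Δ a := by
      rw [← Finset.sum_add_distrib]
      exact Finset.sum_congr rfl fun a _ => by simp only [hΔ]; ring
    rw [this]; ring
  have hcross : 1 / (T : ℝ) * ∑ t, (y t - ∑ a, X t a * b a) * (∑ a, X t a * Δ a) ≤
      lam / 2 * (P + Q) := by
    have e : 1 / (T : ℝ) * ∑ t, (y t - ∑ a, X t a * b a) * (∑ a, X t a * Δ a) =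
        ∑ a, (1 / (T : ℝ) * ∑ t, X t a * (y t - ∑ a', X t a' * b a')) * Δ a := by
      have e' : ∀ t, (y t - ∑ a, X t a * b a) * (∑ a, X t a * Δ a) =
          ∑ a, X t a * (y t - ∑ a', X t a' * b a') * Δ a := fun t => by
        rw [Finset.mul_sum]
        exact Finset.sum_congr rfl fun a _ => by ring
      simp only [e', mul_assoc, Finset.sum_mul]
      rw [Finset.sum_comm, Finset.mul_sum]
    rw [e, ← hPQ, Finset.mul_sum]
    refine Finset.sum_le_sum fun a _ => (le_abs_self _).trans ?_
    rw [abs_mul]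
    exact mul_le_mul_of_nonneg_right (hscore a) (abs_nonneg _)
  have hl1 : ∑ a, |b a| - ∑ a, |bh a| ≤ P - Q := by
    rw [← Finset.sum_sub_distrib, ← Finset.sum_add_sum_compl S, sub_eq_add_neg, hQ,
      ← Finset.sum_neg_distrib]
    refine add_le_add (Finset.sum_le_sum fun a _ => ?_) (Finset.sum_le_sum fun a ha => ?_)
    · rw [abs_sub_comm (bh a) (b a)]
      exact abs_sub_abs_le_abs_sub _ _
    · have : b a = 0 := by simpa [hS] using ha
      simp [hΔ, this]
  -- Basic inequality of the lasso: the score contributes `lam / 2 * (P + Q)` and the penalties `lam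
  -- * (P - Q)`, together at least `V / 2`.
  have hbound : V ≤ lam * (3 * P - Q) := by
    rw [hexp] at hbasic
    have e1 : 1 / (2 * (T : ℝ)) = 1 / 2 * (1 / (T : ℝ)) := by field_simp
    rw [e1] at hbasic
    have h4 := mul_le_mul_of_nonneg_left hl1 hlam.le
    have h5 : 1 / 2 * V ≤ lam / 2 * (P + Q) + lam * (P - Q) := by
      rw [hV]
      linarith
    linarith
  by_cases hDz : D = 0
  · change D ≤ _
    rw [hDz]; positivity
  have hDpos : 0 < D := lt_of_le_of_ne hD0 (Ne.symm hDz)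
  have hP2 : P ^ 2 ≤ s * D := by
    have h1 := sq_sum_le_card_mul_sum_sq (s := S) (f := fun a => |Δ a|)
    simp only [sq_abs] at h1
    refine h1.trans (mul_le_mul hScard ?_ (Finset.sum_nonneg fun _ _ => sq_nonneg _)
      (Nat.cast_nonneg _))
    exact Finset.sum_le_sum_of_subset_of_nonneg (Finset.subset_univ _) fun _ _ _ => sq_nonneg _
  -- An entrywise error `κ` of the Gram matrix changes its quadratic form at `Δ` by at most `κ`
  -- times the squared `ℓ₁` norm.
  have hlow : l * D - κ * (P + Q) ^ 2 ≤ V := by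
    have h1 := lamMin_mul_le hΓ Δ
    have e1 : Δ ⬝ᵥ Δ = D := by simp [dotProduct, hD, sq]
    have e2 : V = ∑ a, ∑ a', Δ a * Δ a' * (1 / (T : ℝ) * ∑ t, X t a * X t a') := by
      rw [hV]
      have e' : ∀ t, (∑ a, X t a * Δ a) ^ 2 = ∑ a, ∑ a', Δ a * Δ a' * (X t a * X t a') :=
        fun t => by
          rw [sq, Finset.sum_mul_sum]
          exact Finset.sum_congr rfl fun a _ => Finset.sum_congr rfl fun a' _ => by ring
      simp only [e']
      rw [Finset.sum_comm, Finset.mul_sum]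
      refine Finset.sum_congr rfl fun a _ => ?_
      rw [Finset.sum_comm, Finset.mul_sum]
      refine Finset.sum_congr rfl fun a' _ => ?_
      rw [← Finset.mul_sum]; ring
    have e3 : Δ ⬝ᵥ (Γ *ᵥ Δ) = ∑ a, ∑ a', Δ a * Δ a' * Γ a a' := by
      simp only [dotProduct, Matrix.mulVec, Finset.mul_sum]
      exact Finset.sum_congr rfl fun a _ => Finset.sum_congr rfl fun a' _ => by ring
    have h2 : ∑ a, ∑ a', Δ a * Δ a' * Γ a a' - V ≤ κ * (P + Q) ^ 2 := by
      rw [e2, ← Finset.sum_sub_distrib, ← hPQ, sq, Finset.sum_mul_sum, Finset.mul_sum]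
      refine Finset.sum_le_sum fun a _ => ?_
      rw [← Finset.sum_sub_distrib, Finset.mul_sum]
      refine Finset.sum_le_sum fun a' _ => ?_
      rw [← mul_sub]
      refine (le_abs_self _).trans ?_
      rw [abs_mul, abs_mul, abs_sub_comm (Γ a a'), mul_comm κ]
      exact mul_le_mul_of_nonneg_left (hgram a a') (by positivity)
    rw [e1, e3] at h1
    linarith
  have hκ0 : 0 ≤ κ := by
    by_contra h
    have hι : Nonempty ι := by
      by_contra he
      rw [not_nonempty_iff] at he
      simp [hD] at hDz
    obtain ⟨a⟩ := hι
    exact h ((abs_nonneg _).trans (hgram a a))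
  -- The cone condition, which gives `(P + Q) ^ 2 ≤ 16 * s * D`; by `hκ` the Gram error then uses up
  -- at most half of the smallest eigenvalue.
  have hQ3 : Q ≤ 3 * P := by
    have := hV0.trans hbound
    have := nonneg_of_mul_nonneg_right this hlam
    linarith
  have hPQ2 : (P + Q) ^ 2 ≤ 16 * (s * D) := by
    have : (P + Q) ^ 2 ≤ (4 * P) ^ 2 := pow_le_pow_left₀ (by positivity) (by linarith) 2
    linarith [mul_pow 4 P 2]
  have h6 : l / 2 * D ≤ 3 * lam * P := by
    have h7 := mul_le_mul_of_nonneg_left hPQ2 hκ0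
    have h8 := mul_le_mul_of_nonneg_right hκ hD0
    have h9 : lam * (3 * P - Q) ≤ lam * (3 * P) := mul_le_mul_of_nonneg_left (by linarith) hlam.le
    linarith
  have h7 : (l / 2 * D) ^ 2 ≤ 9 * lam ^ 2 * (s * D) := by
    refine (pow_le_pow_left₀ (by positivity) h6 2).trans ?_
    have := mul_le_mul_of_nonneg_left hP2 (by positivity : 0 ≤ 9 * lam ^ 2)
    linarith [show (3 * lam * P) ^ 2 = 9 * lam ^ 2 * P ^ 2 by ring]
  change D ≤ _
  rw [le_div_iff₀ (by positivity)]
  have h8 : (D * l ^ 2) * D ≤ (36 * lam ^ 2 * s) * D := by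
    linarith [show (D * l ^ 2) * D = 4 * (l / 2 * D) ^ 2 by ring]
  exact le_of_mul_le_mul_right h8 hDpos

variable {N p : ℕ}

theorem objective_eq_sum (T : ℕ) (lam τ : ℝ) (path : ℤ → Fin N → ℝ)
    (Θ : Matrix (RegIdx N p) (VechIdx N) ℝ) :
    objective T lam τ path Θ = ∑ q, (1 / (2 * T) * ∑ t : Fin T, (yMat T (trunc τ path) t q -
      ∑ a, xMat p T (trunc τ path) t a * Θ a q) ^ 2 + lam * ∑ a, |Θ a q|) := by
  rw [objective, frob_sq, norm11, Finset.sum_add_distrib, Finset.sum_comm, ← Finset.mul_sum,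
    ← Finset.mul_sum]
  simp only [Matrix.sub_apply, Matrix.mul_apply]

/-- The objective is a sum over columns, so each column of a minimizer solves its own lasso. -/
theorem IsRLSE.column {T : ℕ} {lam τ : ℝ} {path : ℤ → Fin N → ℝ}
    {Θh : Matrix (RegIdx N p) (VechIdx N) ℝ} (h : IsRLSE T lam τ path Θh) (q : VechIdx N)
    (b : RegIdx N p → ℝ) :
    1 / (2 * T) * ∑ t : Fin T, (yMat T (trunc τ path) t q -
        ∑ a, xMat p T (trunc τ path) t a * Θh a q) ^ 2 + lam * ∑ a, |Θh a q| ≤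
      1 / (2 * T) * ∑ t : Fin T, (yMat T (trunc τ path) t q -
        ∑ a, xMat p T (trunc τ path) t a * b a) ^ 2 + lam * ∑ a, |b a| := by
  have h1 := h (Θh.updateCol q b)
  rw [objective_eq_sum, objective_eq_sum, ← Finset.add_sum_erase _ _ (Finset.mem_univ q),
    ← Finset.add_sum_erase _ _ (Finset.mem_univ q)] at h1
  have h2 : ∀ q' ∈ Finset.univ.erase q, ∀ a, Θh.updateCol q b a q' = Θh a q' := fun q' hq' a =>
    Matrix.updateCol_ne (Finset.ne_of_mem_erase hq')
  have h3 : ∑ q' ∈ Finset.univ.erase q, (1 / (2 * (T : ℝ)) * ∑ t : Fin T,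
      (yMat T (trunc τ path) t q' - ∑ a, xMat p T (trunc τ path) t a *
        Θh.updateCol q b a q') ^ 2 + lam * ∑ a, |Θh.updateCol q b a q'|) =
      ∑ q' ∈ Finset.univ.erase q, (1 / (2 * (T : ℝ)) * ∑ t : Fin T, (yMat T (trunc τ path) t q' -
        ∑ a, xMat p T (trunc τ path) t a * Θh a q') ^ 2 + lam * ∑ a, |Θh a q'|) :=
    Finset.sum_congr rfl fun q' hq' => by simp only [h2 q' hq']
  rw [h3] at h1
  simp only [Matrix.updateCol_self] at h1
  exact le_of_add_le_add_right h1

theorem card_vechIdx_le (N : ℕ) : Fintype.card (VechIdx N) ≤ N ^ 2 := by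
  refine (Fintype.card_subtype_le _).trans (le_of_eq ?_)
  simp [sq]

/-- Frobenius error bound for the regularized least squares estimate. -/
theorem IsRLSE.frob_lagBlock_sub_le {T : ℕ} (hT : 0 < T) {lam τ κ : ℝ} {s : ℕ}
    {path : ℤ → Fin N → ℝ} {Θh : Matrix (RegIdx N p) (VechIdx N) ℝ}
    (h : IsRLSE T lam τ path Θh) (θ : Param N p) (hlam : 0 < lam)
    (hs : ∀ q, {a | θ.Theta a q ≠ 0}.ncard ≤ s)
    (hscore : ∀ a q, |1 / (T : ℝ) * ∑ t : Fin T, xMat p T (trunc τ path) t a *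
      (yMat T (trunc τ path) t q - ∑ a', xMat p T (trunc τ path) t a' * θ.Theta a' q)| ≤ lam / 2)
    {Γ : Matrix (RegIdx N p) (RegIdx N p) ℝ} (hΓ : Γ.IsHermitian) (hpos : 0 < lamMin hΓ)
    (hgram : ∀ a a', |1 / (T : ℝ) * ∑ t : Fin T, xMat p T (trunc τ path) t a *
      xMat p T (trunc τ path) t a' - Γ a a'| ≤ κ)
    (hκ : 16 * s * κ ≤ lamMin hΓ / 2) (i : Fin p) :
    frob (lagBlock Θh i - θ.Phi i) ≤ 6 * (lam * Real.sqrt s * N * (lamMin hΓ)⁻¹) := by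
  refine (sq_le_sq₀ (frob_nonneg _) (by positivity)).1 ?_
  have hcol : ∀ q, ∑ q', (Θh (some (i, q')) q - θ.Theta (some (i, q')) q) ^ 2 ≤
      36 * lam ^ 2 * s / lamMin hΓ ^ 2 := fun q => by
    have h1 := lasso_error_le hT (xMat p T (trunc τ path)) (fun t => yMat T (trunc τ path) t q)
      (fun a => Θh a q) (fun a => θ.Theta a q) hlam (h.column q fun a => θ.Theta a q) (hs q)
      (fun a => hscore a q) hΓ hpos hgram hκ
    refine le_trans ?_ h1
    have hinj : Function.Injective fun q' : VechIdx N => (some (i, q') : RegIdx N p) := by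
      intro x y hxy
      simpa using hxy
    rw [← Finset.sum_image (f := fun a => (Θh a q - θ.Theta a q) ^ 2)
      (g := fun q' : VechIdx N => (some (i, q') : RegIdx N p)) (fun x _ y _ h => hinj h)]
    exact Finset.sum_le_sum_of_subset_of_nonneg (Finset.subset_univ _) fun _ _ _ => sq_nonneg _
  rw [frob_sq]
  have h2 : ∑ q, ∑ q', (lagBlock Θh i - θ.Phi i) q q' ^ 2 ≤
      ∑ _q : VechIdx N, 36 * lam ^ 2 * s / lamMin hΓ ^ 2 := Finset.sum_le_sum fun q _ => hcol q
  refine h2.trans ?_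
  rw [Finset.sum_const, nsmul_eq_mul, Finset.card_univ]
  -- Summing the column bounds over at most `N ^ 2` columns yields the factor `N` in the error rate.
  have h3 : (Fintype.card (VechIdx N) : ℝ) ≤ (N : ℝ) ^ 2 := by exact_mod_cast card_vechIdx_le N
  refine (mul_le_mul_of_nonneg_right h3 (by positivity)).trans (le_of_eq ?_)
  rw [mul_pow, mul_pow, mul_pow, mul_pow, Real.sq_sqrt (Nat.cast_nonneg s), inv_pow]
  ring

end lasso

/-! ### Rates -/

section rates

variable {N p T : ℕ} {ε Mom : ℝ}

theorem tauRate_pos (hL : 0 < logDim N p) (hT : 0 < Teff T) : 0 < tauRate N p T ε Mom := by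
  unfold tauRate; positivity

theorem baseRate_pos (hL : 0 < logDim N p) (hT : 0 < Teff T) : 0 < baseRate N p T ε Mom := by
  unfold baseRate; positivity

/-- The truncation bias at the prescribed level has exactly the order of the base rate. -/
theorem max_mul_tauRate_rpow (hε0 : 0 < ε) (hL : 0 < logDim N p) (hT : 0 < Teff T) :
    max Mom 1 * tauRate N p T ε Mom ^ (-(4 * ε)) = baseRate N p T ε Mom := by
  have hM : 0 < max Mom 1 := by positivity
  unfold tauRate baseRate
  set M := max Mom 1
  set L := logDim N p
  set Te := Teff T
  set Q := M * Te / L with hQ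
  have hQ0 : 0 < Q := by positivity
  have e1 : M ^ (1 / ε) * L / Te = M ^ (1 / ε + 1) * Q⁻¹ := by
    rw [Real.rpow_add hM, Real.rpow_one, hQ]; field_simp
  rw [e1, Real.mul_rpow (by positivity) (by positivity), ← Real.rpow_mul hM.le,
    ← Real.rpow_mul hQ0.le, Real.inv_rpow hQ0.le, ← Real.rpow_neg hQ0.le,
    show (1 / ε + 1) * (ε / (1 + ε)) = 1 by field_simp, Real.rpow_one,
    show 1 / (4 + 4 * ε) * -(4 * ε) = -(ε / (1 + ε)) by field_simp]

/-- The Bernstein side of the balance: with effective sample size `Teff T` and summands of size `τ ^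
4`, a deviation of the base rate has exponent of order `log (p d + 1)`. -/
theorem baseRate_mul_Teff (hε0 : 0 < ε) (hL : 0 < logDim N p) (hT : 0 < Teff T) :
    baseRate N p T ε Mom * Teff T = logDim N p * tauRate N p T ε Mom ^ 4 := by
  have hM : 0 < max Mom 1 := by positivity
  have hR := tauRate_pos (ε := ε) (Mom := Mom) hL hT
  rw [← max_mul_tauRate_rpow hε0 hL hT, Real.rpow_neg hR.le]
  have e : tauRate N p T ε Mom ^ 4 * tauRate N p T ε Mom ^ (4 * ε) =
      max Mom 1 * Teff T / logDim N p := by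
    rw [← Real.rpow_natCast, ← Real.rpow_add hR]
    unfold tauRate
    rw [← Real.rpow_mul (by positivity),
      show 1 / (4 + 4 * ε) * (((4 : ℕ) : ℝ) + 4 * ε) = 1 by push_cast; field_simp, Real.rpow_one]
  have h0 : 0 < tauRate N p T ε Mom ^ (4 * ε) := by positivity
  rw [eq_div_iff hL.ne'] at e
  field_simp
  linarith

theorem card_vechIdx (N : ℕ) : (Fintype.card (VechIdx N) : ℝ) = N * (N + 1) / 2 := by
  have h : Fintype.card (VechIdx N) = (N + 1).choose 2 := by
    rw [← Fintype.card_congr (Sym2.sortEquiv (α := Fin N)), Sym2.card, Fintype.card_fin]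
  rw [h, Nat.cast_choose_two]
  push_cast
  ring

theorem exp_logDim (N p : ℕ) : Real.exp (logDim N p) = Fintype.card (RegIdx N p) := by
  rw [logDim, Real.exp_log (by positivity), Fintype.card_option, Fintype.card_prod,
    Fintype.card_fin]
  push_cast
  rw [card_vechIdx]

theorem card_vechIdx_le_regIdx (N : ℕ) (hp : 1 ≤ p) :
    Fintype.card (VechIdx N) ≤ Fintype.card (RegIdx N p) := by
  rw [Fintype.card_option, Fintype.card_prod, Fintype.card_fin]
  nlinarith

theorem log_le_logDim (hp : 1 ≤ p) (hN : 1 ≤ N) : Real.log N ≤ logDim N p := by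
  have hN' : (1 : ℝ) ≤ N := by exact_mod_cast hN
  have hp' : (1 : ℝ) ≤ p := by exact_mod_cast hp
  refine Real.log_le_log (by linarith) ?_
  have h1 : (N : ℝ) ≤ N * (N + 1) / 2 := by nlinarith
  nlinarith

theorem logDim_pos (hp : 1 ≤ p) (hN : 1 ≤ N) : 0 < logDim N p := by
  have hN' : (1 : ℝ) ≤ N := by exact_mod_cast hN
  have hp' : (1 : ℝ) ≤ p := by exact_mod_cast hp
  refine Real.log_pos ?_
  have : 0 < (p : ℝ) * (N * (N + 1) / 2) := by positivity
  linarith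

theorem Teff_pos (hT : 2 ≤ T) : 0 < Teff T := by
  have hT' : (2 : ℝ) ≤ T := by exact_mod_cast hT
  have : 0 < Real.log T := Real.log_pos (by linarith)
  unfold Teff
  positivity

end rates

/-! ### Uniform deviation of the sample moments and the score -/

section concentration

variable {N p : ℕ} {Ω : Type*} [m0 : MeasurableSpace Ω] {μ : Measure Ω} [IsProbabilityMeasure μ]
  {r : ℤ → Ω → Fin N → ℝ}

/-- A sample moment of the truncated process exceeds the base rate with small probability. -/
theorem measure_sampleMoment_rate_le (hr : ∀ t, Measurable (r t)) {ε Mom : ℝ} (hε0 : 0 < ε)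
    (hε1 : ε ≤ 1) (hmom : MomentBound μ r (4 + 4 * ε) Mom) (hs : StrictlyStationary μ r)
    {C z : ℝ} (hC : 1 ≤ C) (hz0 : 0 < z) (hz1 : z ≤ 1) (hα : ∀ l, alphaCoef μ r l ≤ C * z ^ l)
    {m G J T : ℕ} (hm : 0 < m) (hGJ : G + J ≤ m) (hT2 : 2 ≤ T)
    (hT : T ≤ 2 ^ J * m) (hT' : 2 ^ J * m ≤ 2 * T) (hG : 2 * T * (C / z ^ p * z ^ G) ≤ 1)
    {c₁ : ℝ} (hc₁ : 0 < c₁) (hmT : (m : ℝ) ≤ c₁ * Real.log T) (hL : 0 < logDim N p)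
    {τ cτ Cτ κ : ℝ} (hcτ : 0 < cτ) (hCτ : 0 < Cτ) (hτ : 1 ≤ τ)
    (hτlo : cτ * tauRate N p T ε Mom ≤ τ) (hτup : τ ≤ Cτ * tauRate N p T ε Mom)
    (hκ0 : 0 < κ) (hκ1 : 6 * κ * Cτ ^ 4 * c₁ ≤ 1)
    (hκ2 : 12 * κ * Cτ ^ 4 * c₁ ≤ Real.log (1 / z))
    (hκ3 : 144 * c₁ * cτ ^ (-(4 * ε)) * Cτ ^ 4 * κ ≤ 1) (hκT : 6 ≤ κ * Real.log T)
    {k : Fin 4 → Option (ℕ × Fin N)} (hk : LagLE p k) :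
    μ.real {ω | (1 + 8 * cτ ^ (-(4 * ε))) * baseRate N p T ε Mom ≤
        |(1 / T : ℝ) * ∑ t : Fin T, lagProd (trunc τ fun s => r s ω) (((t : ℕ) : ℤ) + 1) k -
          ∫ ω, lagProd (fun s => r s ω) 0 k ∂μ|} ≤ 2 * Real.exp (1 - 3 * logDim N p) := by
  have hTe := Teff_pos hT2
  have hTr : (0 : ℝ) < T := by positivity
  have hR := tauRate_pos (ε := ε) (Mom := Mom) hL hTe
  have hρ := baseRate_pos (ε := ε) (Mom := Mom) hL hTe
  have hMρ := max_mul_tauRate_rpow (Mom := Mom) hε0 hL hTe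
  have hρT := baseRate_mul_Teff (Mom := Mom) hε0 hL hTe
  set R := tauRate N p T ε Mom
  set ρ := baseRate N p T ε Mom
  set L := logDim N p
  set M := max Mom 1
  set ℓ := Real.log T with hℓ
  have hM : 0 < M := by positivity
  have hℓ0 : 0 < ℓ := Real.log_pos (by exact_mod_cast hT2)
  have hτ0 : 0 < τ := by linarith
  have hρT' : ρ * T = L * R ^ 4 * ℓ ^ 2 := by
    rw [← hρT, Teff, ← hℓ]; field_simp
  have hMτ : M * τ ^ (-(4 * ε)) ≤ cτ ^ (-(4 * ε)) * ρ := by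
    have h1 : τ ^ (-(4 * ε)) ≤ (cτ * R) ^ (-(4 * ε)) :=
      Real.rpow_le_rpow_of_nonpos (by positivity) hτlo (by linarith)
    rw [Real.mul_rpow hcτ.le hR.le] at h1
    calc M * τ ^ (-(4 * ε)) ≤ M * (cτ ^ (-(4 * ε)) * R ^ (-(4 * ε))) :=
          mul_le_mul_of_nonneg_left h1 hM.le
      _ = cτ ^ (-(4 * ε)) * ρ := by rw [← hMρ]; ring
  have hτ4 : τ ^ 4 ≤ Cτ ^ 4 * R ^ 4 := by
    rw [← mul_pow]; exact pow_le_pow_left₀ hτ0.le hτup 4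
  -- The largest order permitted by the constraint that `lam * τ ^ 4 * m` be bounded, as `τ ^ 4` is
  -- of order at most `R ^ 4` and `m` of order at most `ℓ`.
  set lam := κ / (R ^ 4 * ℓ) with hlam
  have hlam0 : 0 < lam := by positivity
  have hlm : lam * (τ ^ 4 * m) ≤ κ * Cτ ^ 4 * c₁ := by
    calc lam * (τ ^ 4 * m) ≤ lam * (Cτ ^ 4 * R ^ 4 * (c₁ * ℓ)) :=
          mul_le_mul_of_nonneg_left (mul_le_mul hτ4 hmT (by positivity) (by positivity)) hlam0.le
      _ = κ * Cτ ^ 4 * c₁ := by rw [hlam]; field_simp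
  have hmain := measure_sampleMoment_le hr hε0 hε1 hmom hs hC hz0 hz1 hα hm hGJ (by omega) hT hT' hG
    hτ hlam0.le (by linarith) (by linarith) ρ hk
  refine (measureReal_mono fun ω hω => ?_).trans (hmain.trans ?_)
  · simp only [Set.mem_ofPred_eq] at hω ⊢
    refine le_trans ?_ hω
    linarith
  · refine mul_le_mul_of_nonneg_left (Real.exp_le_exp.2 ?_) (by norm_num)
    have e1 : lam * (ρ * T) = κ * (L * ℓ) := by rw [hρT', hlam]; field_simp
    have hv : M * τ ^ (4 - 4 * ε) ≤ cτ ^ (-(4 * ε)) * ρ * (Cτ ^ 4 * R ^ 4) := by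
      have : τ ^ (4 - 4 * ε) = τ ^ (-(4 * ε)) * τ ^ 4 := by
        rw [← Real.rpow_natCast τ 4, ← Real.rpow_add hτ0]; congr 1; push_cast; ring
      rw [this, ← mul_assoc]
      exact mul_le_mul hMτ hτ4 (by positivity) (by positivity)
    -- The variance term uses up at most half of the linear gain `lam * (ρ * T) = κ * (L * ℓ)`;
    -- `hκ3` is calibrated for this.
    have e2 : 18 * (lam ^ 2 * (T * m * (4 * M * τ ^ (4 - 4 * ε)))) ≤ κ * (L * ℓ) / 2 := by
      calc 18 * (lam ^ 2 * (T * m * (4 * M * τ ^ (4 - 4 * ε))))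
          = 72 * lam ^ 2 * T * (m * (M * τ ^ (4 - 4 * ε))) := by ring
        _ ≤ 72 * lam ^ 2 * T * ((c₁ * ℓ) * (cτ ^ (-(4 * ε)) * ρ * (Cτ ^ 4 * R ^ 4))) :=
          mul_le_mul_of_nonneg_left (mul_le_mul hmT hv (by positivity) (by positivity))
            (by positivity)
        _ = 72 * c₁ * cτ ^ (-(4 * ε)) * Cτ ^ 4 * lam * (ℓ * R ^ 4) * (lam * (ρ * T)) := by ring
        _ = (144 * c₁ * cτ ^ (-(4 * ε)) * Cτ ^ 4 * κ) * (κ * (L * ℓ) / 2) := by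
          rw [e1, hlam]; field_simp; ring
        _ ≤ 1 * (κ * (L * ℓ) / 2) := mul_le_mul_of_nonneg_right hκ3 (by positivity)
        _ = _ := one_mul _
    -- One logarithm of `T_eff` is left over after the block length has used the other. It lifts the
    -- surviving `κ * (L * ℓ) / 2` above `3 * L`.
    have h3 : 6 * L ≤ κ * (L * ℓ) := by nlinarith
    linarith

/-- The paths along which some sample moment of the truncated process deviates by `κ`. -/
def badEvent (p : ℕ) (μ : Measure Ω) (r : ℤ → Ω → Fin N → ℝ) (T : ℕ) (τ κ : ℝ) : Set Ω :=
  ⋃ ab : RegIdx N p × (RegIdx N p ⊕ VechIdx N), {ω | κ ≤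
    |(1 / T : ℝ) * ∑ t : Fin T, lagProd (trunc τ fun s => r s ω) (((t : ℕ) : ℤ) + 1)
        (pairLag (xLag ab.1) (Sum.elim xLag yLag ab.2)) -
      ∫ ω, lagProd (fun s => r s ω) 0 (pairLag (xLag ab.1) (Sum.elim xLag yLag ab.2)) ∂μ|}

-- Union bound: there are at most `2 * exp (2 L)` moments with `L = logDim N p`, against the
-- individual probability `2 * exp (1 - 3 L)`.
omit [IsProbabilityMeasure μ] in
theorem measure_badEvent_le {T : ℕ} {τ κ : ℝ} (hp : 1 ≤ p)
    (h : ∀ k : Fin 4 → Option (ℕ × Fin N), LagLE p k →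
      μ.real {ω | κ ≤ |(1 / T : ℝ) * ∑ t : Fin T,
        lagProd (trunc τ fun s => r s ω) (((t : ℕ) : ℤ) + 1) k -
          ∫ ω, lagProd (fun s => r s ω) 0 k ∂μ|} ≤ 2 * Real.exp (1 - 3 * logDim N p)) :
    μ.real (badEvent p μ r T τ κ) ≤ 4 * Real.exp (1 - logDim N p) := by
  refine (measureReal_iUnion_fintype_le _).trans ?_
  have h1 : ∀ ab : RegIdx N p × (RegIdx N p ⊕ VechIdx N),
      LagLE p (pairLag (xLag ab.1) (Sum.elim xLag yLag ab.2)) := by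
    rintro ⟨a, b | q⟩
    · exact lagLE_pairLag (xLag_le a) (xLag_le b)
    · exact lagLE_pairLag (xLag_le a) (yLag_le q)
  refine (Finset.sum_le_sum fun ab _ => h _ (h1 ab)).trans ?_
  rw [Finset.sum_const, nsmul_eq_mul, Finset.card_univ, Fintype.card_prod, Fintype.card_sum]
  push_cast
  have h2 : (Fintype.card (VechIdx N) : ℝ) ≤ Fintype.card (RegIdx N p) := by
    exact_mod_cast card_vechIdx_le_regIdx N hp
  rw [← exp_logDim] at h2 ⊢
  set E := Real.exp (logDim N p) with hE
  have hE0 : 0 < E := Real.exp_pos _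
  calc E * (E + Fintype.card (VechIdx N)) * (2 * Real.exp (1 - 3 * logDim N p))
      ≤ E * (E + E) * (2 * Real.exp (1 - 3 * logDim N p)) := by
        refine mul_le_mul_of_nonneg_right (mul_le_mul_of_nonneg_left ?_ hE0.le) (by positivity)
        linarith
    _ = 4 * (E * E * Real.exp (1 - 3 * logDim N p)) := by ring
    _ = 4 * Real.exp (1 - logDim N p) := by
        rw [hE, ← Real.exp_add, ← Real.exp_add]; congr 2; ring

omit [IsProbabilityMeasure μ] in
theorem gram_error_lt_of_notMem_badEvent {T : ℕ} {τ κ : ℝ} {ω : Ω}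
    (hω : ω ∉ badEvent p μ r T τ κ) (a b : RegIdx N p) :
    |1 / (T : ℝ) * ∑ t : Fin T, xMat p T (trunc τ fun s => r s ω) t a *
      xMat p T (trunc τ fun s => r s ω) t b - gramX p μ r a b| < κ := by
  have h : ω ∉ _ := fun h => hω (Set.mem_iUnion.2 ⟨(a, Sum.inl b), h⟩)
  simp only [Set.mem_ofPred_eq, not_le, Sum.elim_inl, ← xVec_mul_xVec] at h
  exact h

omit [IsProbabilityMeasure μ] in
theorem cross_error_lt_of_notMem_badEvent {T : ℕ} {τ κ : ℝ} {ω : Ω}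
    (hω : ω ∉ badEvent p μ r T τ κ) (a : RegIdx N p) (q : VechIdx N) :
    |1 / (T : ℝ) * ∑ t : Fin T, xMat p T (trunc τ fun s => r s ω) t a *
      yMat T (trunc τ fun s => r s ω) t q -
        ∫ ω, xVec p (fun s => r s ω) 0 a * yVec (fun s => r s ω) 0 q ∂μ| < κ := by
  have h : ω ∉ _ := fun h => hω (Set.mem_iUnion.2 ⟨(a, Sum.inr q), h⟩)
  simp only [Set.mem_ofPred_eq, not_le, Sum.elim_inr, ← xVec_mul_yVec] at h
  exact h

/-- By the regression equation the population score vanishes. The sample score is thus the error of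
the cross moments minus the error of the Gram matrix applied to a column of `Θ`, and the column norm
bounds the latter. -/
theorem score_le_of_notMem_badEvent {η : ℤ → Ω → Fin N → ℝ} {θ : Param N p} (hB : IsBekk μ θ r η)
    {ε Mom : ℝ} (hε0 : 0 < ε) (hmom : MomentBound μ r (4 + 4 * ε) Mom) {T : ℕ} {τ κ : ℝ} {ω : Ω}
    (hω : ω ∉ badEvent p μ r T τ κ) (a : RegIdx N p) (q : VechIdx N) :
    |1 / (T : ℝ) * ∑ t : Fin T, xMat p T (trunc τ fun s => r s ω) t a *
      (yMat T (trunc τ fun s => r s ω) t q -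
        ∑ b, xMat p T (trunc τ fun s => r s ω) t b * θ.Theta b q)| ≤
      κ * (1 + norm1Inf θ.Theta) := by
  have h1 := (cross_error_lt_of_notMem_badEvent hω a q).le
  have h2 := gram_error_lt_of_notMem_badEvent hω a
  rw [hB.integral_xVec_mul_yVec hε0 hmom a q] at h1
  set X := xMat p T (trunc τ fun s => r s ω)
  set Y := yMat T (trunc τ fun s => r s ω)
  have e : 1 / (T : ℝ) * ∑ t : Fin T, X t a * (Y t q - ∑ b, X t b * θ.Theta b q) =
      (1 / (T : ℝ) * ∑ t : Fin T, X t a * Y t q - ∑ b, gramX p μ r a b * θ.Theta b q) -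
      ∑ b, (1 / (T : ℝ) * ∑ t : Fin T, X t a * X t b - gramX p μ r a b) * θ.Theta b q := by
    have e1 : ∑ b, (1 / (T : ℝ) * ∑ t : Fin T, X t a * X t b) * θ.Theta b q =
        1 / (T : ℝ) * ∑ t : Fin T, X t a * ∑ b, X t b * θ.Theta b q := by
      simp only [Finset.mul_sum, Finset.sum_mul]
      rw [Finset.sum_comm]
      exact Finset.sum_congr rfl fun t _ => Finset.sum_congr rfl fun b _ => by ring
    simp only [sub_mul, mul_sub, Finset.sum_sub_distrib]
    rw [e1]; ring
  rw [e, mul_add, mul_one]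
  refine (abs_sub _ _).trans (add_le_add h1 ?_)
  refine (Finset.abs_sum_le_sum_abs _ _).trans ?_
  have hκ : 0 ≤ κ := (abs_nonneg _).trans h1
  refine le_trans ?_ (mul_le_mul_of_nonneg_left (sum_abs_le_norm1Inf θ.Theta q) hκ)
  rw [Finset.mul_sum]
  refine Finset.sum_le_sum fun b _ => ?_
  rw [abs_mul]
  exact mul_le_mul_of_nonneg_right (h2 b).le (abs_nonneg _)

/-- The intercept has second moment `1`, so the first coordinate vector is a test vector. -/
theorem lamMinGram_le_one : lamMinGram p μ r ≤ 1 := by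
  have h := lamMin_mul_le (gramX_isHermitian p μ r) (Pi.single none 1)
  simpa [gramX, xVec, lamMinGram] using h

theorem one_le_sparsity {θ : Param N p} {s : ℕ} (hs : ∀ q, {a | θ.Theta a q ≠ 0}.ncard ≤ s)
    (hpos : 0 < norm1Inf θ.Theta) : 1 ≤ s := by
  by_contra h
  have hz : ∀ a q, θ.Theta a q = 0 := by
    intro a q
    have h1 : {a | θ.Theta a q ≠ 0}.ncard = 0 := by have := hs q; omega
    rw [Set.ncard_eq_zero] at h1
    by_contra hne
    have : a ∈ {a | θ.Theta a q ≠ 0} := hne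
    rw [h1] at this
    exact this
  have : norm1Inf θ.Theta = 0 := by simp [norm1Inf, hz]
  linarith

end concentration

/-! ### From the rate conditions to the selection event -/

section assembly

variable {N p : ℕ}

/-- In the product of the two quantities assumed to vanish `c` cancels, and `N * norm1Inf θ.Theta`
in the error rate outweighs the signal. What remains dominates the sparsity condition of the lasso.
-/
theorem sparsity_mul_baseRate_le {θ : Param N p} (hθ : θ.Restricted) (hp : 1 ≤ p)
    {T s : ℕ} {ε Mom lmin c : ℝ} (hs : 1 ≤ s) (hl : 0 < lmin) (hc : 0 < c)
    (hρ : 0 ≤ baseRate N p T ε Mom) :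
    s * baseRate N p T ε Mom / lmin ≤
      θ.errRate T s ε Mom lmin / c * (c / (θ.signal * θ.minRatio)) := by
  have hsig := signal_pos hθ hp
  have hrat := minRatio_pos hθ
  have hle : θ.signal * θ.minRatio ≤ N * norm1Inf θ.Theta :=
    (mul_le_of_le_one_right hsig.le (minRatio_le_one θ)).trans (signal_le_norm1Inf hθ hp)
  have hs1 : (1 : ℝ) ≤ s := by exact_mod_cast hs
  have hs32 : (s : ℝ) ≤ (s : ℝ) ^ (3 / 2 : ℝ) := by
    conv_lhs => rw [← Real.rpow_one (s : ℝ)]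
    exact Real.rpow_le_rpow_of_exponent_le hs1 (by norm_num)
  rw [div_mul_div_cancel₀ hc.ne', le_div_iff₀ (by positivity), Param.errRate]
  calc s * baseRate N p T ε Mom / lmin * (θ.signal * θ.minRatio)
      ≤ (s : ℝ) ^ (3 / 2 : ℝ) * baseRate N p T ε Mom / lmin * (N * norm1Inf θ.Theta) := by
        refine mul_le_mul ?_ hle (by positivity) (by positivity)
        exact div_le_div_of_nonneg_right (mul_le_mul_of_nonneg_right hs32 hρ) hl.le
    _ = _ := by rw [div_eq_mul_inv]; ring

theorem lamRate_mul_eq_errRate (θ : Param N p) (T s : ℕ) (ε Mom lmin : ℝ) :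
    θ.lamRate T s ε Mom * Real.sqrt s * N * lmin⁻¹ = θ.errRate T s ε Mom lmin := by
  have h : (s : ℝ) ^ (3 / 2 : ℝ) = s * Real.sqrt s := by
    rcases Nat.eq_zero_or_pos s with h | h
    · subst h; norm_num
    · have hs : (0 : ℝ) < s := by exact_mod_cast h
      rw [Real.sqrt_eq_rpow, show (3 / 2 : ℝ) = 1 + 1 / 2 by norm_num, Real.rpow_add hs,
        Real.rpow_one]
  rw [Param.lamRate, Param.errRate, h]; ring

/-- Truncation levels at the prescribed rate exceed `1` once the base rate is small. -/
theorem one_le_mul_tauRate {T : ℕ} {ε Mom cτ : ℝ} (hε0 : 0 < ε) (hcτ : 0 < cτ)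
    (hL : 0 < logDim N p) (hT : 0 < Teff T) (hρ : baseRate N p T ε Mom ≤ cτ ^ (4 * ε)) :
    1 ≤ cτ * tauRate N p T ε Mom := by
  have hR := tauRate_pos (ε := ε) (Mom := Mom) hL hT
  by_contra! h
  have h1 : 1 < (cτ * tauRate N p T ε Mom) ^ (-(4 * ε)) :=
    Real.one_lt_rpow_of_pos_of_lt_one_of_neg (by positivity) h (by linarith)
  rw [Real.mul_rpow hcτ.le hR.le, Real.rpow_neg hcτ.le, inv_mul_eq_div,
    lt_div_iff₀ (by positivity), one_mul] at h1
  have h2 : tauRate N p T ε Mom ^ (-(4 * ε)) ≤ baseRate N p T ε Mom := by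
    rw [← max_mul_tauRate_rpow hε0 hL hT]
    exact le_mul_of_one_le_left (by positivity) (le_max_right _ _)
  linarith

variable {Ω : Type*} [m0 : MeasurableSpace Ω] {μ : Measure Ω} [IsProbabilityMeasure μ]
  {r η : ℤ → Ω → Fin N → ℝ}

/-- Off the bad event, a small padding error makes the ridge-type ratio select the true number of
components. -/
theorem ridgeArgmin_eq_of_notMem_badEvent {θ : Param N p} (hθ : θ.Restricted)
    (hB : IsBekk μ θ r η) {ε Mom : ℝ} (hε0 : 0 < ε) (hmom : MomentBound μ r (4 + 4 * ε) Mom)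
    (hlmin : 0 < lamMinGram p μ r) {s : ℕ} (hs : ∀ q, {a | θ.Theta a q ≠ 0}.ncard ≤ s)
    {θ₀ : ℝ} (hθ₀ : 0 < θ₀) (hθ₀' : θ₀ ≤ norm1Inf θ.Theta) {T : ℕ} (hT : 2 ≤ T) {b : ℝ}
    (hb : 0 < b) (hρ : 0 < baseRate N p T ε Mom) {lam τ Λ₁ Cpad c : ℝ}
    (hlam : 2 * b * (1 + 1 / θ₀) * θ.lamRate T s ε Mom ≤ lam)
    (hlam' : lam ≤ Λ₁ * θ.lamRate T s ε Mom) (hc : 0 < c)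
    (hsp : s * baseRate N p T ε Mom / lamMinGram p μ r ≤ 1 / (32 * b))
    (herr : 6 * |Cpad| * |Λ₁| * θ.errRate T s ε Mom (lamMinGram p μ r) ≤ c / 4)
    (hcs : c ≤ θ.signal * θ.minRatio / 10) {Kbar : ℕ} (hK : ∀ i, θ.K i ≤ Kbar)
    (hN : Kbar < N ^ 2) {ω : Ω} (hω : ω ∉ badEvent p μ r T τ (b * baseRate N p T ε Mom))
    {Θh : Matrix (RegIdx N p) (VechIdx N) ℝ} (hΘ : IsRLSE T lam τ (fun t => r t ω) Θh)
    {W : Fin p → Matrix (StrictIdx N) (StrictIdx N) ℝ} {Kh : Fin p → ℕ}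
    (hKh : ∀ i, IsRidgeArgmin (lagBlock Θh i) (W i) c Kbar (Kh i))
    (hpad : ∀ i, frob (padding (lagBlock Θh i) (W i) - padding (θ.Phi i) (θ.auxW i)) ≤
      Cpad * frob (lagBlock Θh i - θ.Phi i)) (i : Fin p) : Kh i = θ.K i := by
  set ρ := baseRate N p T ε Mom with hρdef
  set lmin := lamMinGram p μ r with hlmindef
  have hn0 : 0 < norm1Inf θ.Theta := hθ₀.trans_le hθ₀'
  have hs1 : (1 : ℝ) ≤ s := by exact_mod_cast one_le_sparsity hs hn0
  have hrate0 : 0 < θ.lamRate T s ε Mom := by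
    rw [Param.lamRate]; positivity
  have hlam0 : 0 < lam := lt_of_lt_of_le (by positivity) hlam
  have hscore : ∀ a q, |1 / (T : ℝ) * ∑ t : Fin T, xMat p T (trunc τ fun t => r t ω) t a *
      (yMat T (trunc τ fun t => r t ω) t q -
        ∑ a', xMat p T (trunc τ fun t => r t ω) t a' * θ.Theta a' q)| ≤ lam / 2 := by
    intro a q
    refine (score_le_of_notMem_badEvent hB hε0 hmom hω a q).trans ?_
    -- The lower bound `θ₀` absorbs the `1` coming from the cross moments into the coefficient norm.
    have h1 : 1 + norm1Inf θ.Theta ≤ (1 + 1 / θ₀) * norm1Inf θ.Theta := by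
      have : 1 ≤ 1 / θ₀ * norm1Inf θ.Theta := by
        rw [one_div, le_inv_mul_iff₀ hθ₀]; linarith
      linarith
    have h2 : norm1Inf θ.Theta * ρ ≤ θ.lamRate T s ε Mom := by
      rw [Param.lamRate, mul_assoc]
      exact le_mul_of_one_le_left (by positivity) hs1
    calc b * ρ * (1 + norm1Inf θ.Theta) ≤ b * ρ * ((1 + 1 / θ₀) * norm1Inf θ.Theta) :=
          mul_le_mul_of_nonneg_left h1 (by positivity)
      _ = b * (1 + 1 / θ₀) * (norm1Inf θ.Theta * ρ) := by ring
      _ ≤ b * (1 + 1 / θ₀) * θ.lamRate T s ε Mom :=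
          mul_le_mul_of_nonneg_left h2 (by positivity)
      _ ≤ lam / 2 := by linarith
  have hκ : 16 * s * (b * ρ) ≤ lmin / 2 := by
    rw [div_le_iff₀ hlmin, div_mul_eq_mul_div, one_mul, le_div_iff₀ (by positivity)] at hsp
    linarith
  have hfrob := hΘ.frob_lagBlock_sub_le (by omega) θ hlam0 hs hscore (gramX_isHermitian p μ r) hlmin
    (fun a a' => (gram_error_lt_of_notMem_badEvent hω a a').le) hκ i
  have hfrob' : frob (lagBlock Θh i - θ.Phi i) ≤ 6 * |Λ₁| * θ.errRate T s ε Mom lmin := by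
    refine hfrob.trans ?_
    rw [← lamRate_mul_eq_errRate]
    have h1 : lam ≤ |Λ₁| * θ.lamRate T s ε Mom :=
      hlam'.trans (mul_le_mul_of_nonneg_right (le_abs_self _) hrate0.le)
    have h2 : 0 ≤ Real.sqrt s * N * lmin⁻¹ := by positivity
    have := mul_le_mul_of_nonneg_right h1 h2
    change 6 * (lam * Real.sqrt s * N * lmin⁻¹) ≤ _
    linarith
  refine ridgeArgmin_eq hθ i hc ?_ hcs (hK i) hN (hKh i)
  refine (hpad i).trans (le_trans ?_ herr)
  calc Cpad * frob (lagBlock Θh i - θ.Phi i) ≤ |Cpad| * frob (lagBlock Θh i - θ.Phi i) :=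
        mul_le_mul_of_nonneg_right (le_abs_self _) (frob_nonneg _)
    _ ≤ |Cpad| * (6 * |Λ₁| * θ.errRate T s ε Mom lmin) :=
        mul_le_mul_of_nonneg_left hfrob' (abs_nonneg _)
    _ = _ := by ring

end assembly

end BekkArch

/-! ### The theorem -/

open BekkArch in
theorem theorem4 (p : ℕ) (hp : 1 ≤ p) (ε : ℝ) (hε0 : 0 < ε) (hε1 : ε ≤ 1)
    -- mixing constants, implied constants in `τ ≍ …`, lower bound of `‖Θ*‖_{1,∞}`
    (Cα ζbar cτ Cτ θ₀ : ℝ) (hζbar : ζbar < 1) (hcτ : 0 < cτ) (hθ₀ : 0 < θ₀) :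
    ∃ Λ₀ : ℝ, 0 < Λ₀ ∧
    -- a sequence of models, sample sizes, processes and tuning parameters
    ∀ (N T : ℕ → ℕ) (θ : ∀ n, Param (N n) p)
      (Ω : ℕ → Type*) [∀ n, MeasurableSpace (Ω n)]
      (μ : ∀ n, Measure (Ω n)) [∀ n, IsProbabilityMeasure (μ n)]
      (r η : ∀ n, ℤ → Ω n → Fin (N n) → ℝ)
      (Mom ζ τ lam c : ℕ → ℝ) (s Kbar : ℕ → ℕ)
      (Θhat : ∀ n, Ω n → Matrix (RegIdx (N n) p) (VechIdx (N n)) ℝ)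
      (What : ∀ n, Fin p → Ω n → Matrix (StrictIdx (N n)) (StrictIdx (N n)) ℝ)
      (Khat : ∀ n, Fin p → Ω n → ℕ)
      (cT Λ₁ Cpad : ℝ),
    Tendsto N atTop atTop → Tendsto T atTop atTop →
    -- the model
    (∀ n, (θ n).Restricted) →
    (∀ n, IsBekk (μ n) (θ n) (r n) (η n)) →
    -- the process
    (∀ n, StrictlyStationary (μ n) (r n)) →
    (∀ n, MomentBound (μ n) (r n) (4 + 4 * ε) (Mom n)) →
    (∀ n, 0 ≤ ζ n ∧ ζ n ≤ ζbar) →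
    (∀ n l, alphaCoef (μ n) (r n) l ≤ Cα * ζ n ^ l) →
    (∀ n, 0 < lamMinGram p (μ n) (r n)) →
    -- sparsity
    (∀ n q, {a | (θ n).Theta a q ≠ 0}.ncard ≤ s n) →
    (∀ n, θ₀ ≤ norm1Inf (θ n).Theta) →
    -- sample size and tuning parameters
    0 < cT → (∀ᶠ n in atTop, cT * logDim (N n) p ≤ T n) →
    (∀ᶠ n in atTop, cτ * tauRate (N n) p (T n) ε (Mom n) ≤ τ n ∧
      τ n ≤ Cτ * tauRate (N n) p (T n) ε (Mom n)) →
    (∀ᶠ n in atTop, Λ₀ * (θ n).lamRate (T n) (s n) ε (Mom n) ≤ lam n ∧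
      lam n ≤ Λ₁ * (θ n).lamRate (T n) (s n) ε (Mom n)) →
    -- the estimators
    (∀ n a q, Measurable fun ω => Θhat n ω a q) →
    (∀ n i a b, Measurable fun ω => What n i ω a b) →
    (∀ n i, Measurable (Khat n i)) →
    (∀ n ω, IsRLSE (T n) (lam n) (τ n) (fun t => r n t ω) (Θhat n ω)) →
    (∀ n i ω, IsPaddingArgmin (lagBlock (Θhat n ω) i) (What n i ω)) →
    (∀ n i ω, IsRidgeArgmin (lagBlock (Θhat n ω) i) (What n i ω) (c n) (Kbar n) (Khat n i ω)) →
    (∀ n i, (θ n).K i ≤ Kbar n) →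
    (∀ᶠ n in atTop, Kbar n < N n ^ 2) →
    -- padding error
    Tendsto (fun n => μ n {ω | ∀ i,
      frob (padding (lagBlock (Θhat n ω) i) (What n i ω) - padding ((θ n).Phi i) ((θ n).auxW i)) ≤
        Cpad * frob (lagBlock (Θhat n ω) i - (θ n).Phi i)}) atTop (𝓝 1) →
    -- the ridge parameter
    (∀ n, 0 < c n) →
    Tendsto (fun n => (θ n).errRate (T n) (s n) ε (Mom n) (lamMinGram p (μ n) (r n)) / c n)
      atTop (𝓝 0) →
    Tendsto (fun n => c n / ((θ n).signal * (θ n).minRatio)) atTop (𝓝 0) →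
    Tendsto (fun n => μ n {ω | ∀ i, Khat n i ω = (θ n).K i}) atTop (𝓝 1) := by
  classical
  -- A common mixing rate inside `(0, 1)`: the individual rates may vanish, while `log (1 / z)` and
  -- `1 / z ^ p` need `z > 0`.
  set z : ℝ := max ζbar (1 / 2) with hz
  have hz0 : 0 < z := lt_of_lt_of_le (by norm_num) (le_max_right _ _)
  have hz1 : z < 1 := max_lt hζbar (by norm_num)
  set C : ℝ := max Cα 1 with hC
  have hC1 : 1 ≤ C := le_max_right _ _
  -- In units of the base rate: `1` for the fluctuation, the rest for the truncation bias.
  set b : ℝ := 1 + 8 * cτ ^ (-(4 * ε)) with hb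
  have hb0 : 0 < b := by positivity
  -- Makes `lam / 2` dominate the score bound `b ρ (1 + ‖Θ‖)`, since `1 + ‖Θ‖ ≤ (1 + 1 / θ₀) ‖Θ‖`.
  refine ⟨2 * b * (1 + 1 / θ₀), by positivity, ?_⟩
  intro N T θ Ω _ μ _ r η Mom ζ τ lam c s Kbar Θhat What Khat cT Λ₁ Cpad hN hT hθ hB hstat hmom hζ hα
    hlmin hs hnorm _ _ hτ hlam _ _ _ hRLSE _ hRidge hK hKbar hpad hc herr hsig
  obtain ⟨c₁, hc₁, hblock⟩ := exists_block_parameters (C := C / z ^ p) (by positivity) hz0 hz1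
  have hlz : 0 < Real.log (1 / z) := Real.log_pos (by rw [lt_div_iff₀ hz0]; linarith)
  set D : ℝ := max Cτ 1 with hD
  have hD0 : 0 < D := lt_of_lt_of_le one_pos (le_max_right _ _)
  obtain ⟨κ, hκ0, hκ1, hκ2, hκ3⟩ : ∃ κ : ℝ, 0 < κ ∧ 6 * κ * D ^ 4 * c₁ ≤ 1 ∧
      12 * κ * D ^ 4 * c₁ ≤ Real.log (1 / z) ∧
      144 * c₁ * cτ ^ (-(4 * ε)) * D ^ 4 * κ ≤ 1 := by
    have q1 : 0 < 6 * D ^ 4 * c₁ := by positivity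
    have q2 : 0 < 12 * D ^ 4 * c₁ := by positivity
    have q3 : 0 < 144 * c₁ * cτ ^ (-(4 * ε)) * D ^ 4 := by positivity
    refine ⟨min (1 / (6 * D ^ 4 * c₁)) (min (Real.log (1 / z) / (12 * D ^ 4 * c₁))
      (1 / (144 * c₁ * cτ ^ (-(4 * ε)) * D ^ 4))), by positivity, ?_, ?_, ?_⟩
    · have := min_le_left (1 / (6 * D ^ 4 * c₁)) (min (Real.log (1 / z) / (12 * D ^ 4 * c₁))
        (1 / (144 * c₁ * cτ ^ (-(4 * ε)) * D ^ 4)))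
      rw [le_div_iff₀ q1] at this
      linarith
    · have := (min_le_right (1 / (6 * D ^ 4 * c₁)) (min (Real.log (1 / z) / (12 * D ^ 4 * c₁))
        (1 / (144 * c₁ * cτ ^ (-(4 * ε)) * D ^ 4)))).trans (min_le_left _ _)
      rw [le_div_iff₀ q2] at this
      linarith
    · have := (min_le_right (1 / (6 * D ^ 4 * c₁)) (min (Real.log (1 / z) / (12 * D ^ 4 * c₁))
        (1 / (144 * c₁ * cτ ^ (-(4 * ε)) * D ^ 4)))).trans (min_le_right _ _)
      rw [le_div_iff₀ q3] at this
      linarith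
  have hlogT : Tendsto (fun n => Real.log (T n)) atTop atTop :=
    Real.tendsto_log_atTop.comp (tendsto_natCast_atTop_atTop.comp hT)
  -- The product controls `s ρ / λ_min`. It serves twice: for the Gram condition of the lasso and,
  -- through `s ≥ 1` and `λ_min ≤ 1`, for `ρ → 0`, which forces `τ ≥ 1`.
  have hprod := herr.mul hsig
  rw [mul_zero] at hprod
  set bad : ∀ n, Set (Ω n) := fun n =>
    badEvent p (μ n) (r n) (T n) (τ n) (b * baseRate (N n) p (T n) ε (Mom n))
  have hev : ∀ᶠ n in atTop, (μ n).real (bad n) ≤ 4 * Real.exp (1 - logDim (N n) p) ∧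
      ∀ ω, ω ∉ bad n → (∀ i, frob (padding (lagBlock (Θhat n ω) i) (What n i ω) -
        padding ((θ n).Phi i) ((θ n).auxW i)) ≤ Cpad * frob (lagBlock (Θhat n ω) i - (θ n).Phi i)) →
        ∀ i, Khat n i ω = (θ n).K i := by
    filter_upwards [hN.eventually_ge_atTop 1, hT.eventually_ge_atTop 2, hT.eventually hblock,
      hlogT.eventually_ge_atTop (6 / κ), hτ, hlam, hKbar,
      herr.eventually_le_const (show (0 : ℝ) < 1 / (4 * (6 * |Cpad| * |Λ₁| + 1)) by positivity),
      hsig.eventually_le_const (show (0 : ℝ) < 1 / 10 by norm_num),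
      hprod.eventually_le_const (show (0 : ℝ) < 1 / (32 * b) by positivity),
      hprod.eventually_le_const (show (0 : ℝ) < cτ ^ (4 * ε) by positivity)] with n hN1 hT2
      ⟨m, G, J, hm, hGJ, hTJ, hTJ', hmT, hG⟩ hκT hτn hlamn hKn herrn hsign hpn hpn'
    have hL := logDim_pos hp hN1
    have hTe := Teff_pos hT2
    have hρ := baseRate_pos (ε := ε) (Mom := Mom n) hL hTe
    have hn0 : 0 < norm1Inf (θ n).Theta := hθ₀.trans_le (hnorm n)
    have hs1 := one_le_sparsity (hs n) hn0
    have hsρ := sparsity_mul_baseRate_le (T := T n) (ε := ε) (Mom := Mom n) (hθ n) hp hs1 (hlmin n)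
      (hc n) hρ.le
    have hρle : baseRate (N n) p (T n) ε (Mom n) ≤ cτ ^ (4 * ε) := by
      refine le_trans ?_ (hsρ.trans hpn')
      rw [le_div_iff₀ (hlmin n)]
      have h1 : lamMinGram p (μ n) (r n) ≤ 1 := lamMinGram_le_one
      have h2 : (1 : ℝ) ≤ s n := by exact_mod_cast hs1
      nlinarith
    have hτ1 := (one_le_mul_tauRate hε0 hcτ hL hTe hρle).trans hτn.1
    have hR := tauRate_pos (ε := ε) (Mom := Mom n) hL hTe
    have hα' : ∀ l, alphaCoef (μ n) (r n) l ≤ C * z ^ l := fun l => by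
      refine (hα n l).trans ?_
      refine mul_le_mul (le_max_left _ _)
        (pow_le_pow_left₀ (hζ n).1 ((hζ n).2.trans (le_max_left _ _)) l)
        (pow_nonneg (hζ n).1 l) (by positivity)
    refine ⟨measure_badEvent_le hp fun k hk => ?_, ?_⟩
    · exact measure_sampleMoment_rate_le (hB n).measurable_r hε0 hε1 (hmom n) (hstat n) hC1 hz0
        hz1.le hα' hm hGJ hT2 hTJ hTJ' hG hc₁ hmT hL hcτ hD0 hτ1 hτn.1
        (hτn.2.trans (mul_le_mul_of_nonneg_right (le_max_left _ _) hR.le)) hκ0 hκ1 hκ2 hκ3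
        (by rw [div_le_iff₀ hκ0] at hκT; linarith) hk
    · intro ω hω hpadω i
      have hsr : 0 < (θ n).signal * (θ n).minRatio :=
        mul_pos (signal_pos (hθ n) hp) (minRatio_pos (hθ n))
      refine ridgeArgmin_eq_of_notMem_badEvent (hθ n) (hB n) hε0 (hmom n) (hlmin n) (hs n) hθ₀
        (hnorm n) hT2 hb0 hρ hlamn.1 hlamn.2 (hc n) (hsρ.trans hpn) ?_ ?_ (hK n) hKn hω
        (hRLSE n ω) (fun i => hRidge n i ω) hpadω i
      · rw [div_le_iff₀ (hc n), div_mul_eq_mul_div, one_mul, le_div_iff₀ (by positivity)] at herrn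
        have h0 : 0 ≤ (θ n).errRate (T n) (s n) ε (Mom n) (lamMinGram p (μ n) (r n)) := by
          have := (hlmin n).le
          rw [Param.errRate]; positivity
        linarith
      · rw [div_le_iff₀ hsr] at hsign
        linarith
  have hL : Tendsto (fun n => logDim (N n) p) atTop atTop := by
    refine tendsto_atTop_mono' _ ?_
      (Real.tendsto_log_atTop.comp (tendsto_natCast_atTop_atTop.comp hN))
    filter_upwards [hN.eventually_ge_atTop 1] with n hn
    exact log_le_logDim hp hn
  have hbad : Tendsto (fun n => μ n (bad n)) atTop (𝓝 0) := by
    have h1 : Tendsto (fun n => ENNReal.ofReal (4 * Real.exp (1 - logDim (N n) p))) atTop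
        (𝓝 0) := by
      have h2 : Tendsto (fun n => 1 - logDim (N n) p) atTop atBot :=
        tendsto_atBot_add_const_left _ _ (tendsto_neg_atTop_atBot.comp hL)
      have h3 := (Real.tendsto_exp_atBot.comp h2).const_mul 4
      rw [mul_zero] at h3
      simpa using ENNReal.tendsto_ofReal h3
    refine tendsto_of_tendsto_of_tendsto_of_le_of_le' tendsto_const_nhds h1
      (Eventually.of_forall fun _ => zero_le) ?_
    filter_upwards [hev] with n hn
    rw [← ofReal_measureReal]
    exact ENNReal.ofReal_le_ofReal hn.1
  -- The event of a small padding error lies in the union of the selection event and the bad event;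
  -- subadditivity needs no measurability of these sets.
  have hsub := ENNReal.Tendsto.sub hpad hbad (Or.inl ENNReal.one_ne_top)
  rw [tsub_zero] at hsub
  refine tendsto_of_tendsto_of_tendsto_of_le_of_le' hsub tendsto_const_nhds ?_
    (Eventually.of_forall fun n => prob_le_one)
  filter_upwards [hev] with n hn
  rw [tsub_le_iff_right]
  refine (measure_mono fun ω hω => ?_).trans (measure_union_le _ _)
  by_cases h : ω ∈ bad n
  · exact Or.inr h
  · exact Or.inl (hn.2 ω h hω)
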